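/- Let $\mathcal A$ be an additive category. An $N$-complex over $\mathcal A$ is a $\mathbb Z$-indexed diagram $\cdots\to X^0\xrightarrow{d}X^1\xrightarrow{d}X^2\to\cdots$ in $\mathcal A$ with $d^N=0$. Let $\mathrm{Com}_N(\mathcal A)$ have the $N$-complexes as objects, chain maps as 1-morphisms, and, as 2-morphisms $f\Rightarrow g:X\to Y$, the homotopies, i.e. the families $h^i:X^{i+N-1}\to Y^i$ with $g-f=\sum_{j=1}^{N}d^{N-j}\,h\,d^{j-1}$ (composed vertically by addition). Let $\mathrm{Com}_\Delta(\mathcal A)$ be the simplicial category whose $n$-simplices are the $(n+1)$-complexes, where the face functor $\mathbf d_i:\mathrm{Com}_{n+1}(\mathcal A)\to\mathrm{Com}_{n}(\mathcal A)$ deletes the objects in degrees congruent to $i$ modulo $n+1$, the degeneracies repeat objects, and $\tau:\mathbf d_{i+1}\to\mathbf d_{i}$ is given by identities and differentials. Its décalage $\Sigma\mathrm{Com}_\Delta(\mathcal A)$, which forgets $\mathbf d_0$ and $\mathbf s_0$, has the 2-complexes as 0-simplices and the 3-complexes as 1-simplices. Write $\mathrm C=\mathrm{Com}_2(\mathcal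 A)$. The 1-simplices of the lax nerve $\mathbf{LN}_+(\mathrm C)$ form the lax arrow category $\mathrm{LArr}(\mathrm C)$: its objects are the morphisms $x:C\to X$ of $\mathrm C$, its morphisms $x\to y$ are triples $(f_0,f_1,\hat f)$ with $\hat f:y f_0\Rightarrow f_1x$ a homotopy, and its 2-morphisms $f\Rightarrow g$ are pairs of homotopies $\alpha_i:f_i\Rightarrow g_i$ with $\hat g+y\alpha_0=\alpha_1x+\hat f$. Its 2-simplices are the composable pairs $X_0\to X_1\to X_2$ in $\mathrm C$, with morphisms (pairs of adjacent squares filled by homotopies) and 2-morphisms (compatible triples of homotopies) defined analogously; they form a category $\mathrm{Pair}(\mathrm C)$. For the mapping cone triangulation of $\mathbf{LN}_+(\mathrm C)$, the triangle of $x:C\to X$ is $$T(x):\quad C\xrightarrow{\;x\;}X\xrightarrow{\binom{0}{1}}\mathrm{Cone}(x),\qquad \mathrm{Cone}(x)^i=C^{i+1}\oplus X^i,\quad d=\begin{pmatrix}-d&0\\x&d\end{pmatrix},$$ where $\mathrm{Cone}$ is a functor on $\mathrm{LArr}(\mathrm C)$ by $f\mapsto\begin{pmatrix}f_0&0\\\hat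 f&f_1\end{pmatrix}$. For the triangulation of $\Sigma\mathrm{Com}_\Delta(\mathcal A)$ given by the recalage $\mathrm{Com}_\Delta(\mathcal A)$, the triangle of a 3-complex $Y$ is $$T'(Y):\quad \mathbf d_2Y\xrightarrow{\;\tau\;}\mathbf d_1Y\xrightarrow{\;\tau\;}\mathbf d_0Y.$$ These are functors $T:\mathrm{LArr}(\mathrm C)\to\mathrm{Pair}(\mathrm C)$ and $T':\mathrm{Com}_3(\mathcal A)\to\mathrm{Pair}(\mathrm C)$. Two functors $F,G$ from an ordinary category to one of $\mathrm{Com}_3(\mathcal A)$, $\mathrm{LArr}(\mathrm C)$, $\mathrm{Pair}(\mathrm C)$ are called equivalent, $F\simeq G$, if there are lax natural transformations $F\to G$ and $G\to F$ whose two composites are isomorphic, through invertible modifications, to the identities. Then the triangles of $\mathbf{LN}_+(\mathrm C)$ and the triangles of $\Sigma\mathrm{Com}_\Delta(\mathcal A)$ are equivalent: 1. Let $\mathrm{Spine}:\mathrm{Com}_3(\mathcal A)\to\mathrm{LArr}(\mathrm C)$, $Y\mapsto(\tau:\mathbf d_2Y\to\mathbf d_1Y)$. There is a functor $\mathrm{Filler}:\mathrm{LArr}(\mathrm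 C)\to\mathrm{Com}_3(\mathcal A)$ such that $$\mathrm{Filler}\circ\mathrm{Spine}\simeq\mathrm{Id},\quad \mathrm{Spine}\circ\mathrm{Filler}\simeq\mathrm{Id},\quad \mathbf d_0\circ\mathrm{Filler}\cong\mathrm{Cone},\quad T'\circ\mathrm{Filler}\simeq T,\quad T\circ\mathrm{Spine}\simeq T',$$ where $\cong$ is a natural isomorphism of functors. 2. Let $\mathbf K(\mathrm C)$ be the category of 2-complexes and homotopy classes of chain maps. A diagram $X\to Y\to Z$ in $\mathbf K(\mathrm C)$ is isomorphic to the image of $T(x)$ for some morphism $x$ of chain complexes if and only if it is isomorphic to the image of $T'(Y)$ for some 3-complex $Y$. -/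

import Mathlib

open CategoryTheory CategoryTheory.Limits Opposite
open scoped ZeroObject

universe v u v' u' v'' u''

/-! ## Categories with additively composed 2-morphisms -/

/-- A category together with 2-morphisms `f ⟹ g` that compose vertically by addition.
A 2-morphism `f ⟹ g : X ⟶ Y` is an element `c` of the abelian group `Cell X Y` for which
`IsTwo f g c` holds; identities are `0`, vertical composition is `+`, hence every 2-morphism is
invertible with inverse `-c`. The operations `pre` and `post` are the pointwise composition of
the underlying data with 1-morphisms. -/
class TwoCells (C : Type u) [Category.{v} C] where
  Cell : C → C → Type v
  [addCommGroup : ∀ X Y, AddCommGroup (Cell X Y)]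
  pre : ∀ {X Y Z : C}, (X ⟶ Y) → Cell Y Z → Cell X Z
  post : ∀ {X Y Z : C}, Cell X Y → (Y ⟶ Z) → Cell X Z
  pre_id : ∀ {X Y : C} (c : Cell X Y), pre (𝟙 X) c = c
  pre_comp : ∀ {W X Y Z : C} (f : W ⟶ X) (g : X ⟶ Y) (c : Cell Y Z),
    pre (f ≫ g) c = pre f (pre g c)
  post_id : ∀ {X Y : C} (c : Cell X Y), post c (𝟙 Y) = c
  post_comp : ∀ {W X Y Z : C} (c : Cell W X) (f : X ⟶ Y) (g : Y ⟶ Z),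
    post c (f ≫ g) = post (post c f) g
  pre_post : ∀ {W X Y Z : C} (f : W ⟶ X) (c : Cell X Y) (g : Y ⟶ Z),
    post (pre f c) g = pre f (post c g)
  pre_add : ∀ {X Y Z : C} (f : X ⟶ Y) (c c' : Cell Y Z), pre f (c + c') = pre f c + pre f c'
  post_add : ∀ {X Y Z : C} (c c' : Cell X Y) (f : Y ⟶ Z),
    post (c + c') f = post c f + post c' f
  /-- `c` is a 2-morphism from `f` to `g`. -/
  IsTwo : ∀ {X Y : C}, (X ⟶ Y) → (X ⟶ Y) → Cell X Y → Prop
  isTwo_zero : ∀ {X Y : C} (f : X ⟶ Y), IsTwo f f 0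
  isTwo_add : ∀ {X Y : C} {f g h : X ⟶ Y} {c c' : Cell X Y},
    IsTwo f g c → IsTwo g h c' → IsTwo f h (c + c')
  isTwo_neg : ∀ {X Y : C} {f g : X ⟶ Y} {c : Cell X Y}, IsTwo f g c → IsTwo g f (-c)

attribute [instance] TwoCells.addCommGroup

/-- A sesquicategory with additively composed 2-morphisms: composing a 2-morphism with a
1-morphism gives a 2-morphism. -/
class AdditiveSesquicategory (C : Type u) [Category.{v} C] extends TwoCells C where
  isTwo_pre : ∀ {X Y Z : C} (f : X ⟶ Y) {g h : Y ⟶ Z} {c : Cell Y Z},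
    IsTwo g h c → IsTwo (f ≫ g) (f ≫ h) (pre f c)
  isTwo_post : ∀ {X Y Z : C} {f g : X ⟶ Y} {c : Cell X Y} (h : Y ⟶ Z),
    IsTwo f g c → IsTwo (f ≫ h) (g ≫ h) (post c h)

open TwoCells AdditiveSesquicategory

section General

variable {C : Type u} [Category.{v} C]

theorem TwoCells.pre_zero [TwoCells C] {X Y Z : C} (f : X ⟶ Y) :
    pre f (0 : Cell Y Z) = 0 := by
  have h := pre_add f (0 : Cell Y Z) 0
  simpa using h

theorem TwoCells.post_zero [TwoCells C] {X Y Z : C} (f : Y ⟶ Z) :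
    post (0 : Cell X Y) f = 0 := by
  have h := post_add (0 : Cell X Y) 0 f
  simpa using h

theorem TwoCells.pre_neg [TwoCells C] {X Y Z : C} (f : X ⟶ Y) (c : Cell Y Z) :
    pre f (-c) = -pre f c := by
  have h := pre_add f c (-c)
  rw [add_neg_cancel, pre_zero] at h
  exact (neg_eq_of_add_eq_zero_right h.symm).symm

theorem TwoCells.post_neg [TwoCells C] {X Y Z : C} (c : Cell X Y) (f : Y ⟶ Z) :
    post (-c) f = -post c f := by
  have h := post_add c (-c) f
  rw [add_neg_cancel, post_zero] at h
  exact (neg_eq_of_add_eq_zero_right h.symm).symm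

/-- `f` and `g` are related if there is a 2-morphism `f ⟹ g`. -/
def twoRel (C : Type u) [Category.{v} C] [TwoCells C] : HomRel C :=
  fun X Y f g => ∃ c : Cell X Y, IsTwo f g c

/-- The decategorification: the category with the same objects as `C`, whose morphisms are
the isomorphism classes of 1-morphisms of `C`. -/
abbrev Decat (C : Type u) [Category.{v} C] [AdditiveSesquicategory C] : Type u :=
  CategoryTheory.Quotient (twoRel C)

/-- The projection of a sesquicategory to its decategorification. -/
abbrev Decat.proj (C : Type u) [Category.{v} C] [AdditiveSesquicategory C] : C ⥤ Decat C :=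
  CategoryTheory.Quotient.functor (twoRel C)

/-! ### Lax natural transformations -/

/-- A lax natural transformation `F ⟶ G : D ⥤ C`, with `D` an ordinary category: 1-morphisms
`app X : F X ⟶ G X` and 2-morphisms
`cell f : (F f, then app Y) ⟹ (app X, then G f)` for `f : X ⟶ Y`, compatible with identities and
with composition in `D`. -/
structure LaxTrans {D : Type u'} [Category.{v'} D] [TwoCells C] (F G : D ⥤ C) where
  app : ∀ X : D, F.obj X ⟶ G.obj X
  cell : ∀ {X Y : D}, (X ⟶ Y) → Cell (F.obj X) (G.obj Y)
  cell_isTwo : ∀ {X Y : D} (f : X ⟶ Y), IsTwo (F.map f ≫ app Y) (app X ≫ G.map f) (cell f)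
  cell_id : ∀ X : D, cell (𝟙 X) = 0
  cell_comp : ∀ {X Y Z : D} (f : X ⟶ Y) (g : Y ⟶ Z),
    cell (f ≫ g) = pre (F.map f) (cell g) + post (cell f) (G.map g)

/-- An ordinary natural transformation is a lax one, with identity 2-morphisms. -/
def LaxTrans.ofNatTrans {D : Type u'} [Category.{v'} D] [TwoCells C] {F G : D ⥤ C}
    (α : F ⟶ G) : LaxTrans F G where
  app := α.app
  cell _ := 0
  cell_isTwo f := by
    rw [α.naturality]
    exact isTwo_zero _
  cell_id _ := rfl
  cell_comp f g := by rw [pre_zero, post_zero, add_zero]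

/-- An invertible modification `β α ⟹ id_F`, for lax natural transformations `α : F ⟶ G` and
`β : G ⟶ F`. The 2-morphism of the composite `β α` at `f : X ⟶ Y` is the pasting
`(F f, α Y, β Y) ⟹ (α X, G f, β Y) ⟹ (α X, β X, F f)`, and that of `id_F` is `0`. -/
structure CompModId {D : Type u'} [Category.{v'} D] [TwoCells C] {F G : D ⥤ C}
    (α : LaxTrans F G) (β : LaxTrans G F) where
  app : ∀ X : D, Cell (F.obj X) (F.obj X)
  isTwo : ∀ X : D, IsTwo (α.app X ≫ β.app X) (𝟙 (F.obj X)) (app X)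
  naturality : ∀ {X Y : D} (f : X ⟶ Y),
    (post (α.cell f) (β.app Y) + pre (α.app X) (β.cell f)) + post (app X) (F.map f) =
      pre (F.map f) (app Y)

/-- An equimorphism `F ≃ G` of functors `D ⥤ C`: lax natural transformations in both directions
whose two composites are isomorphic, by invertible modifications, to the identities. -/
structure LaxEquiv {D : Type u'} [Category.{v'} D] [TwoCells C] (F G : D ⥤ C) where
  hom : LaxTrans F G
  inv : LaxTrans G F
  homInv : CompModId hom inv
  invHom : CompModId inv hom

/-! ### The lax arrow category -/

/-- Objects of the lax arrow category of `C`: the 1-morphisms of `C`. These are the 1-simplices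
of the (augmented) lax nerve of `C`. -/
structure LArr (C : Type u) [Category.{v} C] where
  dom : C
  cod : C
  arr : dom ⟶ cod

/-- A 1-morphism `x ⟶ y` of the lax arrow category: a square filled with a 2-morphism
`hat : (f₀, then y) ⟹ (x, then f₁)`. -/
@[ext]
structure LArr.Hom [TwoCells C] (x y : LArr C) where
  f₀ : x.dom ⟶ y.dom
  f₁ : x.cod ⟶ y.cod
  hat : Cell x.dom y.cod
  isTwo : IsTwo (f₀ ≫ y.arr) (x.arr ≫ f₁) hat

instance LArr.category [AdditiveSesquicategory C] : Category.{v} (LArr C) where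
  Hom x y := LArr.Hom x y
  id x := ⟨𝟙 _, 𝟙 _, 0, by
    rw [Category.id_comp, Category.comp_id]; exact isTwo_zero _⟩
  comp {x y z} f g := ⟨f.f₀ ≫ g.f₀, f.f₁ ≫ g.f₁, pre f.f₀ g.hat + post f.hat g.f₁, by
    have h1 := isTwo_pre f.f₀ g.isTwo
    have h2 := isTwo_post g.f₁ f.isTwo
    rw [Category.assoc] at h2
    have h := isTwo_add h1 h2
    rwa [← Category.assoc, Category.assoc x.arr] at h⟩
  id_comp f := by
    apply LArr.Hom.ext
    · exact Category.id_comp _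
    · exact Category.id_comp _
    · show pre (𝟙 _) f.hat + post 0 f.f₁ = f.hat
      rw [pre_id, post_zero, add_zero]
  comp_id f := by
    apply LArr.Hom.ext
    · exact Category.comp_id _
    · exact Category.comp_id _
    · show pre f.f₀ 0 + post f.hat (𝟙 _) = f.hat
      rw [post_id, pre_zero, zero_add]
  assoc f g h := by
    apply LArr.Hom.ext
    · exact Category.assoc _ _ _
    · exact Category.assoc _ _ _
    · show pre (f.f₀ ≫ g.f₀) h.hat + post (pre f.f₀ g.hat + post f.hat g.f₁) h.f₁ =
        pre f.f₀ (pre g.f₀ h.hat + post g.hat h.f₁) + post f.hat (g.f₁ ≫ h.f₁)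
      rw [pre_comp, post_add, pre_add, post_comp, pre_post, add_assoc]

/-- The functor `dom : LArr C ⥤ C`. -/
def LArr.domF (C : Type u) [Category.{v} C] [AdditiveSesquicategory C] : LArr C ⥤ C where
  obj x := x.dom
  map f := f.f₀

/-- The functor `cod : LArr C ⥤ C`. -/
def LArr.codF (C : Type u) [Category.{v} C] [AdditiveSesquicategory C] : LArr C ⥤ C where
  obj x := x.cod
  map f := f.f₁

/-- 2-morphisms `f ⟹ g` of the lax arrow category: pairs of 2-morphisms `f₀ ⟹ g₀`, `f₁ ⟹ g₁`
that are compatible with the 2-morphisms filling the squares `f` and `g`. -/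
instance LArr.twoCells [AdditiveSesquicategory C] : TwoCells (LArr C) where
  Cell x y := Cell x.dom y.dom × Cell x.cod y.cod
  pre f c := (pre f.f₀ c.1, pre f.f₁ c.2)
  post c f := (post c.1 f.f₀, post c.2 f.f₁)
  pre_id c := Prod.ext (pre_id c.1) (pre_id c.2)
  pre_comp f g c := Prod.ext (pre_comp f.f₀ g.f₀ c.1) (pre_comp f.f₁ g.f₁ c.2)
  post_id c := Prod.ext (post_id c.1) (post_id c.2)
  post_comp c f g := Prod.ext (post_comp c.1 f.f₀ g.f₀) (post_comp c.2 f.f₁ g.f₁)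
  pre_post f c g := Prod.ext (pre_post f.f₀ c.1 g.f₀) (pre_post f.f₁ c.2 g.f₁)
  pre_add f c c' := Prod.ext (pre_add f.f₀ c.1 c'.1) (pre_add f.f₁ c.2 c'.2)
  post_add c c' f := Prod.ext (post_add c.1 c'.1 f.f₀) (post_add c.2 c'.2 f.f₁)
  IsTwo {x y} f g c := IsTwo f.f₀ g.f₀ c.1 ∧ IsTwo f.f₁ g.f₁ c.2 ∧
    post c.1 y.arr + g.hat = f.hat + pre x.arr c.2
  isTwo_zero f := ⟨isTwo_zero _, isTwo_zero _, by
    show post 0 _ + f.hat = f.hat + pre _ 0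
    rw [pre_zero, post_zero, add_zero, zero_add]⟩
  isTwo_add {x y f g h c c'} h1 h2 := ⟨isTwo_add h1.1 h2.1, isTwo_add h1.2.1 h2.2.1, by
    show post (c.1 + c'.1) y.arr + h.hat = f.hat + pre x.arr (c.2 + c'.2)
    rw [post_add, pre_add, add_assoc, h2.2.2, ← add_assoc, h1.2.2, add_assoc]⟩
  isTwo_neg {x y f g c} h := ⟨isTwo_neg h.1, isTwo_neg h.2.1, by
    show post (-c.1) y.arr + f.hat = g.hat + pre x.arr (-c.2)
    rw [pre_neg, post_neg, neg_add_eq_iff_eq_add, ← add_assoc, h.2.2, add_neg_cancel_right]⟩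

/-! ### Composable pairs: the 2-simplices of the lax nerve -/

/-- Composable pairs `X₀ ⟶ X₁ ⟶ X₂` of 1-morphisms of `C`, the 2-simplices of the lax nerve
of `C`, i.e. the objects of the pullback of `cod` and `dom : LArr C ⥤ C`. -/
structure LPair (C : Type u) [Category.{v} C] where
  X₀ : C
  X₁ : C
  X₂ : C
  a : X₀ ⟶ X₁
  b : X₁ ⟶ X₂

/-- A 1-morphism of composable pairs: two adjacent squares filled with 2-morphisms. -/
@[ext]
structure LPair.Hom [TwoCells C] (x y : LPair C) where
  f₀ : x.X₀ ⟶ y.X₀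
  f₁ : x.X₁ ⟶ y.X₁
  f₂ : x.X₂ ⟶ y.X₂
  hatA : Cell x.X₀ y.X₁
  hatB : Cell x.X₁ y.X₂
  isTwoA : IsTwo (f₀ ≫ y.a) (x.a ≫ f₁) hatA
  isTwoB : IsTwo (f₁ ≫ y.b) (x.b ≫ f₂) hatB

instance LPair.category [AdditiveSesquicategory C] : Category.{v} (LPair C) where
  Hom x y := LPair.Hom x y
  id x := ⟨𝟙 _, 𝟙 _, 𝟙 _, 0, 0,
    by rw [Category.id_comp, Category.comp_id]; exact isTwo_zero _,
    by rw [Category.id_comp, Category.comp_id]; exact isTwo_zero _⟩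
  comp {x y z} f g := ⟨f.f₀ ≫ g.f₀, f.f₁ ≫ g.f₁, f.f₂ ≫ g.f₂,
    pre f.f₀ g.hatA + post f.hatA g.f₁, pre f.f₁ g.hatB + post f.hatB g.f₂, by
    have h1 := isTwo_pre f.f₀ g.isTwoA
    have h2 := isTwo_post g.f₁ f.isTwoA
    rw [Category.assoc] at h2
    have h := isTwo_add h1 h2
    rwa [← Category.assoc, Category.assoc x.a] at h, by
    have h1 := isTwo_pre f.f₁ g.isTwoB
    have h2 := isTwo_post g.f₂ f.isTwoB
    rw [Category.assoc] at h2
    have h := isTwo_add h1 h2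
    rwa [← Category.assoc, Category.assoc x.b] at h⟩
  id_comp f := by
    apply LPair.Hom.ext
    · exact Category.id_comp _
    · exact Category.id_comp _
    · exact Category.id_comp _
    · show pre (𝟙 _) f.hatA + post 0 f.f₁ = f.hatA
      rw [pre_id, post_zero, add_zero]
    · show pre (𝟙 _) f.hatB + post 0 f.f₂ = f.hatB
      rw [pre_id, post_zero, add_zero]
  comp_id f := by
    apply LPair.Hom.ext
    · exact Category.comp_id _
    · exact Category.comp_id _
    · exact Category.comp_id _
    · show pre f.f₀ 0 + post f.hatA (𝟙 _) = f.hatA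
      rw [post_id, pre_zero, zero_add]
    · show pre f.f₁ 0 + post f.hatB (𝟙 _) = f.hatB
      rw [post_id, pre_zero, zero_add]
  assoc f g h := by
    apply LPair.Hom.ext
    · exact Category.assoc _ _ _
    · exact Category.assoc _ _ _
    · exact Category.assoc _ _ _
    · show pre (f.f₀ ≫ g.f₀) h.hatA + post (pre f.f₀ g.hatA + post f.hatA g.f₁) h.f₁ =
        pre f.f₀ (pre g.f₀ h.hatA + post g.hatA h.f₁) + post f.hatA (g.f₁ ≫ h.f₁)
      rw [pre_comp, post_add, pre_add, post_comp, pre_post, add_assoc]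
    · show pre (f.f₁ ≫ g.f₁) h.hatB + post (pre f.f₁ g.hatB + post f.hatB g.f₂) h.f₂ =
        pre f.f₁ (pre g.f₁ h.hatB + post g.hatB h.f₂) + post f.hatB (g.f₂ ≫ h.f₂)
      rw [pre_comp, post_add, pre_add, post_comp, pre_post, add_assoc]

/-- 2-morphisms of composable pairs: triples of 2-morphisms compatible with the 2-morphisms
that fill the squares. -/
instance LPair.twoCells [AdditiveSesquicategory C] : TwoCells (LPair C) where
  Cell x y := Cell x.X₀ y.X₀ × Cell x.X₁ y.X₁ × Cell x.X₂ y.X₂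
  pre f c := (pre f.f₀ c.1, pre f.f₁ c.2.1, pre f.f₂ c.2.2)
  post c f := (post c.1 f.f₀, post c.2.1 f.f₁, post c.2.2 f.f₂)
  pre_id c := Prod.ext (pre_id c.1) (Prod.ext (pre_id c.2.1) (pre_id c.2.2))
  pre_comp f g c := Prod.ext (pre_comp f.f₀ g.f₀ c.1)
    (Prod.ext (pre_comp f.f₁ g.f₁ c.2.1) (pre_comp f.f₂ g.f₂ c.2.2))
  post_id c := Prod.ext (post_id c.1) (Prod.ext (post_id c.2.1) (post_id c.2.2))
  post_comp c f g := Prod.ext (post_comp c.1 f.f₀ g.f₀)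
    (Prod.ext (post_comp c.2.1 f.f₁ g.f₁) (post_comp c.2.2 f.f₂ g.f₂))
  pre_post f c g := Prod.ext (pre_post f.f₀ c.1 g.f₀)
    (Prod.ext (pre_post f.f₁ c.2.1 g.f₁) (pre_post f.f₂ c.2.2 g.f₂))
  pre_add f c c' := Prod.ext (pre_add f.f₀ c.1 c'.1)
    (Prod.ext (pre_add f.f₁ c.2.1 c'.2.1) (pre_add f.f₂ c.2.2 c'.2.2))
  post_add c c' f := Prod.ext (post_add c.1 c'.1 f.f₀)
    (Prod.ext (post_add c.2.1 c'.2.1 f.f₁) (post_add c.2.2 c'.2.2 f.f₂))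
  IsTwo {x y} f g c :=
    IsTwo f.f₀ g.f₀ c.1 ∧ IsTwo f.f₁ g.f₁ c.2.1 ∧ IsTwo f.f₂ g.f₂ c.2.2 ∧
    post c.1 y.a + g.hatA = f.hatA + pre x.a c.2.1 ∧
    post c.2.1 y.b + g.hatB = f.hatB + pre x.b c.2.2
  isTwo_zero f := ⟨isTwo_zero _, isTwo_zero _, isTwo_zero _, by
    show post 0 _ + f.hatA = f.hatA + pre _ 0
    rw [pre_zero, post_zero, add_zero, zero_add], by
    show post 0 _ + f.hatB = f.hatB + pre _ 0
    rw [pre_zero, post_zero, add_zero, zero_add]⟩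
  isTwo_add {x y f g h c c'} h1 h2 := ⟨isTwo_add h1.1 h2.1, isTwo_add h1.2.1 h2.2.1,
    isTwo_add h1.2.2.1 h2.2.2.1, by
    show post (c.1 + c'.1) y.a + h.hatA = f.hatA + pre x.a (c.2.1 + c'.2.1)
    rw [post_add, pre_add, add_assoc, h2.2.2.2.1, ← add_assoc, h1.2.2.2.1, add_assoc], by
    show post (c.2.1 + c'.2.1) y.b + h.hatB = f.hatB + pre x.b (c.2.2 + c'.2.2)
    rw [post_add, pre_add, add_assoc, h2.2.2.2.2, ← add_assoc, h1.2.2.2.2, add_assoc]⟩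
  isTwo_neg {x y f g c} h := ⟨isTwo_neg h.1, isTwo_neg h.2.1, isTwo_neg h.2.2.1, by
    show post (-c.1) y.a + f.hatA = g.hatA + pre x.a (-c.2.1)
    rw [pre_neg, post_neg, neg_add_eq_iff_eq_add, ← add_assoc, h.2.2.2.1,
      add_neg_cancel_right], by
    show post (-c.2.1) y.b + f.hatB = g.hatB + pre x.b (-c.2.2)
    rw [pre_neg, post_neg, neg_add_eq_iff_eq_add, ← add_assoc, h.2.2.2.2,
      add_neg_cancel_right]⟩

/-! ### The data of a simplicial triangulation and its triangles -/

/-- The data (two functors and two lax natural transformations) of a simplicial triangulation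
on an augmented simplicial category whose `0`-, `1`- and `(-1)`-simplices are `C`, `S` and `P`:
`edge` sends a 1-simplex `s` to `τ : d₁ s ⟶ d₀ s`, and `aug : C ⥤ P` is the augmentation. The
added data are the mapping cone `cone = d₋₁`, the vertex functor `vertex = s₋₁`, and
`τd : d₀ ⟶ d₋₁` and `τs : s₋₁ d₀ ⟶ id`. -/
structure TriangulationData (C : Type u) [Category.{v} C] [AdditiveSesquicategory C]
    (S : Type u') [Category.{v'} S] (P : Type u'') [Category.{v''} P] where
  edge : S ⥤ LArr C
  aug : C ⥤ P
  cone : S ⥤ C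
  vertex : P ⥤ C
  τd : LaxTrans (edge ⋙ LArr.codF C) cone
  τs : LaxTrans (aug ⋙ vertex) (𝟭 C)

variable [AdditiveSesquicategory C] {S : Type u'} [Category.{v'} S]
  {P : Type u''} [Category.{v''} P]

/-- The triangle `d₁ s ⟶ d₀ s ⟶ d₋₁ s` of a 1-simplex `s`, functorially in `s`. -/
def TriangulationData.triangle (T : TriangulationData C S P) : S ⥤ LPair C where
  obj s := ⟨(T.edge.obj s).dom, (T.edge.obj s).cod, T.cone.obj s, (T.edge.obj s).arr, T.τd.app s⟩
  map f := ⟨(T.edge.map f).f₀, (T.edge.map f).f₁, T.cone.map f, (T.edge.map f).hat, T.τd.cell f,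
    (T.edge.map f).isTwo, T.τd.cell_isTwo f⟩
  map_id s := by
    apply LPair.Hom.ext
    · exact congrArg LArr.Hom.f₀ (T.edge.map_id s)
    · exact congrArg LArr.Hom.f₁ (T.edge.map_id s)
    · exact T.cone.map_id s
    · exact congrArg LArr.Hom.hat (T.edge.map_id s)
    · exact T.τd.cell_id s
  map_comp f g := by
    apply LPair.Hom.ext
    · exact congrArg LArr.Hom.f₀ (T.edge.map_comp f g)
    · exact congrArg LArr.Hom.f₁ (T.edge.map_comp f g)
    · exact T.cone.map_comp f g
    · exact congrArg LArr.Hom.hat (T.edge.map_comp f g)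
    · exact T.τd.cell_comp f g

/-- A diagram `X ⟶ Y ⟶ Z` in the decategorification of `C` is a triangle if it is isomorphic to
the image of the triangle `d₁ s ⟶ d₀ s ⟶ d₋₁ s` of some 1-simplex `s`. -/
def TriangulationData.IsTriangle (T : TriangulationData C S P)
    (D : ComposableArrows (Decat C) 2) : Prop :=
  ∃ s : S, Nonempty (D ≅ ComposableArrows.mk₂
    ((Decat.proj C).map (T.triangle.obj s).a) ((Decat.proj C).map (T.triangle.obj s).b))

end General

/-! ## `N`-complexes -/

noncomputable section Complexes

variable (A : Type u) [Category.{v} A] [Preadditive A]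

/-- An `N`-complex in `A`: a diagram `⋯ ⟶ X⁰ ⟶ X¹ ⟶ X² ⟶ ⋯`, i.e. a functor from the ordered
set `ℤ` to `A`, such that the composition of `N` consecutive differentials vanishes. -/
structure NCom (N : ℕ) where
  K : ℤ ⥤ A
  zero : ∀ i j : ℤ, (h : j = i + N) → K.map (homOfLE (by lia : i ≤ j)) = 0

variable {A}

namespace NCom

/-- 1-morphisms of `N`-complexes. -/
instance category (N : ℕ) : Category.{v} (NCom A N) where
  Hom X Y := X.K ⟶ Y.K
  id X := 𝟙 X.K
  comp f g := NatTrans.vcomp f g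

variable {N : ℕ}

/-- The object `X^i`. -/
abbrev ob (X : NCom A N) (i : ℤ) : A := X.K.obj i

/-- The iterated differential `d^{j-i} : X^i ⟶ X^j`. -/
abbrev D (X : NCom A N) (i j : ℤ) (h : i ≤ j) : X.ob i ⟶ X.ob j := X.K.map (homOfLE h)

theorem D_refl (X : NCom A N) (i : ℤ) (h : i ≤ i) : X.D i i h = 𝟙 _ := X.K.map_id i

theorem D_comp (X : NCom A N) (i j k : ℤ) (h : i ≤ j) (h' : j ≤ k) :
    X.D i j h ≫ X.D j k h' = X.D i k (h.trans h') := (X.K.map_comp _ _).symm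

/-- The component `f^i : X^i ⟶ Y^i` of a 1-morphism. -/
def c {X Y : NCom A N} (f : X ⟶ Y) (i : ℤ) : X.ob i ⟶ Y.ob i := NatTrans.app f i

@[ext]
theorem hom_ext {X Y : NCom A N} {f g : X ⟶ Y} (h : ∀ i, c f i = c g i) : f = g :=
  NatTrans.ext (funext h)

@[simp] theorem c_id (X : NCom A N) (i : ℤ) : c (𝟙 X) i = 𝟙 (X.ob i) := rfl

@[simp] theorem c_comp {X Y Z : NCom A N} (f : X ⟶ Y) (g : Y ⟶ Z) (i : ℤ) :
    c (f ≫ g) i = c f i ≫ c g i := rfl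

theorem D_c {X Y : NCom A N} (f : X ⟶ Y) (i j : ℤ) (h : i ≤ j) :
    X.D i j h ≫ c f j = c f i ≫ Y.D i j h := NatTrans.naturality f (homOfLE h)

theorem D_c_assoc {X Y : NCom A N} (f : X ⟶ Y) (i j : ℤ) (h : i ≤ j) {Z : A} (g : Y.ob j ⟶ Z) :
    X.D i j h ≫ c f j ≫ g = c f i ≫ Y.D i j h ≫ g := by
  rw [← Category.assoc, D_c, Category.assoc]

/-- The data of a homotopy: morphisms `h^i : X^{i+N-1} ⟶ Y^i`, written `h a i` with
`a = i + N - 1`. -/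
@[ext]
structure PreHtpy (X Y : NCom A N) : Type v where
  h : ∀ a i : ℤ, a + 1 = i + N → (X.ob a ⟶ Y.ob i)

namespace PreHtpy

variable {X Y : NCom A N}

instance : Zero (PreHtpy X Y) := ⟨⟨fun _ _ _ => 0⟩⟩
instance : Add (PreHtpy X Y) := ⟨fun s t => ⟨fun a i e => s.h a i e + t.h a i e⟩⟩
instance : Neg (PreHtpy X Y) := ⟨fun s => ⟨fun a i e => -s.h a i e⟩⟩

@[simp] theorem zero_h (a i : ℤ) (e : a + 1 = i + N) : (0 : PreHtpy X Y).h a i e = 0 := rfl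
@[simp] theorem add_h (s t : PreHtpy X Y) (a i : ℤ) (e : a + 1 = i + N) :
    (s + t).h a i e = s.h a i e + t.h a i e := rfl
@[simp] theorem neg_h (s : PreHtpy X Y) (a i : ℤ) (e : a + 1 = i + N) :
    (-s).h a i e = -s.h a i e := rfl

instance : AddCommGroup (PreHtpy X Y) where
  add_assoc r s t := by ext; simp [add_assoc]
  zero_add s := by ext; simp
  add_zero s := by ext; simp
  neg_add_cancel s := by ext; simp
  add_comm s t := by ext; simp [add_comm]
  nsmul := nsmulRec
  zsmul := zsmulRec

end PreHtpy

/-- `s` is a homotopy from `f` to `g`: `g - f = ∑ d^j s d^{N-1-j}`, the sum over `0 ≤ j < N`. -/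
def IsHtpy {X Y : NCom A N} (f g : X ⟶ Y) (s : PreHtpy X Y) : Prop :=
  ∀ i : ℤ, c g i - c f i = ∑ j : Fin N,
    X.D i (i - j + N - 1) (by have := j.2; lia) ≫ s.h (i - j + N - 1) (i - j) (by lia) ≫
      Y.D (i - j) i (by lia)

/-- `N`-complexes, chain maps and homotopies form a sesquicategory. -/
instance sesquicategory (N : ℕ) : AdditiveSesquicategory (NCom A N) where
  Cell X Y := PreHtpy X Y
  pre f s := ⟨fun a i e => c f a ≫ s.h a i e⟩
  post s f := ⟨fun a i e => s.h a i e ≫ c f i⟩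
  pre_id s := by ext; simp
  pre_comp f g s := by ext; simp
  post_id s := by ext; simp
  post_comp s f g := by ext; simp
  pre_post f s g := by ext; simp
  pre_add f s t := by ext; simp
  post_add s t f := by ext; simp
  IsTwo f g s := IsHtpy f g s
  isTwo_zero f := by intro i; simp
  isTwo_add {X Y f g k s t} h1 h2 := by
    intro i
    have e : c k i - c f i = (c g i - c f i) + (c k i - c g i) := by abel
    rw [e, h1 i, h2 i, ← Finset.sum_add_distrib]
    simp
  isTwo_neg {X Y f g s} h1 := by
    intro i
    rw [← neg_sub, h1 i]
    simp
  isTwo_pre {X Y Z} f {g k s} h1 := by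
    intro i
    rw [c_comp, c_comp, ← Preadditive.comp_sub, h1 i, Preadditive.comp_sum]
    refine Finset.sum_congr rfl fun j _ => ?_
    simp only [Category.assoc]
    rw [← D_c_assoc]
  isTwo_post {X Y Z f g s} k h1 := by
    intro i
    rw [c_comp, c_comp, ← Preadditive.sub_comp, h1 i, Preadditive.sum_comp]
    refine Finset.sum_congr rfl fun j _ => ?_
    simp only [Category.assoc]
    rw [D_c]

/-- A chain map from components that commute with the differentials. -/
def homMk {X Y : NCom A N} (f : ∀ i, X.ob i ⟶ Y.ob i)
    (w : ∀ i, X.D i (i + 1) (by lia) ≫ f (i + 1) = f i ≫ Y.D i (i + 1) (by lia)) : X ⟶ Y :=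
  show X.K ⟶ Y.K from
  { app := f
    naturality := by
      have key : ∀ (n : ℕ) (i j : ℤ) (h : j = i + n),
          X.D i j (by lia) ≫ f j = f i ≫ Y.D i j (by lia) := by
        intro n
        induction n with
        | zero =>
          intro i j h
          obtain rfl : j = i := by simpa using h
          simp [D]
        | succ n ih =>
          intro i j h
          obtain rfl : j = (i + n) + 1 := by push_cast at h; lia
          have e1 : X.D i (i + n + 1) (by lia) =
              X.D i (i + n) (by lia) ≫ X.D (i + n) (i + n + 1) (by lia) := by
            simp only [D, ← Functor.map_comp]; rfl
          have e2 : Y.D i (i + n + 1) (by lia) =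
              Y.D i (i + n) (by lia) ≫ Y.D (i + n) (i + n + 1) (by lia) := by
            simp only [D, ← Functor.map_comp]; rfl
          rw [e1, e2, Category.assoc, w, ← Category.assoc, ih i (i + n) rfl, Category.assoc]
      intro i j φ
      have hle := leOfHom φ
      obtain rfl : φ = homOfLE hle := Subsingleton.elim _ _
      exact key (j - i).toNat i j (by lia) }

@[simp] theorem c_homMk {X Y : NCom A N} (f : ∀ i, X.ob i ⟶ Y.ob i) (w) (i : ℤ) :
    c (homMk f w) i = f i := rfl

end NCom

/-! ### Functors out of `ℤ` from differentials -/

/-- The composition of `n` consecutive differentials, starting in degree `i`. -/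
def iterDiff (X : ℤ → A) (d : ∀ i, X i ⟶ X (i + 1)) (i : ℤ) :
    (n : ℕ) → (j : ℤ) → j = i + n → (X i ⟶ X j)
  | 0, j, h => eqToHom (by rw [h]; simp)
  | n + 1, j, h => iterDiff X d i n (i + n) rfl ≫ d (i + n) ≫
      eqToHom (by rw [h]; push_cast; rw [add_assoc])

theorem iterDiff_succ' (X : ℤ → A) (d : ∀ i, X i ⟶ X (i + 1)) (i : ℤ) (n : ℕ) (j k : ℤ)
    (h : j = i + n) (h' : k = i + (n + 1 : ℕ)) (e : j + 1 = k) :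
    iterDiff X d i (n + 1) k h' = iterDiff X d i n j h ≫ d j ≫ eqToHom (by rw [e]) := by
  subst h
  rfl

theorem iterDiff_add (X : ℤ → A) (d : ∀ i, X i ⟶ X (i + 1)) (i j : ℤ) (m : ℕ)
    (h : j = i + m) (n : ℕ) : ∀ (k : ℤ) (h' : k = j + n),
    iterDiff X d i (m + n) k (by rw [h', h]; push_cast; ring) =
      iterDiff X d i m j h ≫ iterDiff X d j n k h' := by
  induction n with
  | zero =>
    intro k h'
    obtain rfl : k = j := by simpa using h'
    simp [iterDiff]
  | succ n ih =>
    intro k h'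
    rw [iterDiff_succ' X d j n (j + n) k rfl h' (by rw [h']; push_cast; ring),
      ← Category.assoc, ← ih (j + n) rfl]
    exact iterDiff_succ' X d i (m + n) (j + n) k _ _ (by rw [h']; push_cast; ring)

/-- The functor `ℤ ⥤ A` with objects `X i` and differentials `d i`. -/
def ofDiff (X : ℤ → A) (d : ∀ i, X i ⟶ X (i + 1)) : ℤ ⥤ A where
  obj := X
  map {i j} φ := iterDiff X d i (j - i).toNat j (by have := leOfHom φ; lia)
  map_id i := by
    have key : ∀ (n : ℕ) (h : i = i + n), n = 0 → iterDiff X d i n i h = 𝟙 _ := by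
      rintro n h rfl; simp [iterDiff]
    exact key _ _ (by simp)
  map_comp {i j k} φ ψ := by
    have h1 := leOfHom φ
    have h2 := leOfHom ψ
    have key : ∀ (n : ℕ) (h : k = i + n), n = (j - i).toNat + (k - j).toNat →
        iterDiff X d i n k h = iterDiff X d i (j - i).toNat j (by lia) ≫
          iterDiff X d j (k - j).toNat k (by lia) := by
      rintro n h rfl
      exact iterDiff_add X d i j _ (by lia) _ k (by lia)
    exact key _ _ (by lia)

theorem ofDiff_map_succ (X : ℤ → A) (d : ∀ i, X i ⟶ X (i + 1)) (i : ℤ) (h : i ≤ i + 1) :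
    (ofDiff X d).map (homOfLE h) = d i := by
  have key : ∀ (n : ℕ) (h : i + 1 = i + n), n = 1 → iterDiff X d i n (i + 1) h = d i := by
    rintro n h rfl
    have e := iterDiff_succ' X d i 0 i (i + 1) (by simp) (by simp) rfl
    rw [e]
    simp [iterDiff]
  exact key _ _ (by simp)

/-- A chain complex (2-complex) from its objects and differentials. -/
def NCom.ofDiff₂ (X : ℤ → A) (d : ∀ i, X i ⟶ X (i + 1)) (w : ∀ i, d i ≫ d (i + 1) = 0) :
    NCom A 2 where
  K := ofDiff X d
  zero i j h := by
    obtain rfl : j = i + 1 + 1 := by push_cast at h; lia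
    have e : (ofDiff X d).map (homOfLE (by lia : i ≤ i + 1 + 1)) =
        (ofDiff X d).map (homOfLE (by lia : i ≤ i + 1)) ≫
          (ofDiff X d).map (homOfLE (by lia : i + 1 ≤ i + 1 + 1)) := by
      rw [← Functor.map_comp]; rfl
    rw [e, ofDiff_map_succ, ofDiff_map_succ]
    exact w i

theorem NCom.ofDiff₂_D (X : ℤ → A) (d : ∀ i, X i ⟶ X (i + 1)) (w : ∀ i, d i ≫ d (i + 1) = 0)
    (i : ℤ) (h : i ≤ i + 1) : (NCom.ofDiff₂ X d w).D i (i + 1) h = d i :=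
  ofDiff_map_succ X d i h

/-! ## The simplicial category of complexes -/

/-- The periodic extension of an order-preserving `f : [m] → [n]` to `ℤ`:
`q (m + 1) + r ↦ q (n + 1) + f r`, for `0 ≤ r ≤ m`. -/
def periodicFun {m n : ℕ} (f : Fin (m + 1) →o Fin (n + 1)) (k : ℤ) : ℤ :=
  (f ⟨(k % ((m + 1 : ℕ) : ℤ)).toNat, by
    have h1 := Int.emod_nonneg k (b := ((m + 1 : ℕ) : ℤ)) (by lia)
    have h2 := Int.emod_lt_of_pos k (b := ((m + 1 : ℕ) : ℤ)) (by lia)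
    lia⟩ : ℕ) + (n + 1 : ℕ) * (k / ((m + 1 : ℕ) : ℤ))

theorem periodicFun_eq {m n : ℕ} (f : Fin (m + 1) →o Fin (n + 1)) (q : ℤ) (r : Fin (m + 1)) :
    periodicFun f (r + (m + 1 : ℕ) * q) = (f r : ℕ) + (n + 1 : ℕ) * q := by
  have hr := r.2
  have h1 : ((r : ℕ) + ((m + 1 : ℕ) : ℤ) * q) % ((m + 1 : ℕ) : ℤ) = (r : ℕ) := by
    rw [Int.add_mul_emod_self_left]
    exact Int.emod_eq_of_lt (by lia) (by lia)
  have h2 : ((r : ℕ) + ((m + 1 : ℕ) : ℤ) * q) / ((m + 1 : ℕ) : ℤ) = q := by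
    rw [Int.add_mul_ediv_left _ _ (by lia), Int.ediv_eq_zero_of_lt (by lia) (by lia), zero_add]
  unfold periodicFun
  rw [h2]
  congr 4
  apply Fin.ext
  simp only [h1, Int.toNat_natCast]

theorem exists_rep (m : ℕ) (k : ℤ) :
    ∃ (q : ℤ) (r : Fin (m + 1)), k = (r : ℕ) + ((m + 1 : ℕ) : ℤ) * q := by
  have h1 := Int.emod_nonneg k (b := ((m + 1 : ℕ) : ℤ)) (by lia)
  have h2 := Int.emod_lt_of_pos k (b := ((m + 1 : ℕ) : ℤ)) (by lia)
  refine ⟨k / ((m + 1 : ℕ) : ℤ), ⟨(k % ((m + 1 : ℕ) : ℤ)).toNat, by lia⟩, ?_⟩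
  have h3 := Int.emod_add_mul_ediv k ((m + 1 : ℕ) : ℤ)
  simp only [Int.toNat_of_nonneg h1]
  exact h3.symm

theorem periodicFun_period {m n : ℕ} (f : Fin (m + 1) →o Fin (n + 1)) (k : ℤ) :
    periodicFun f (k + (m + 1 : ℕ)) = periodicFun f k + (n + 1 : ℕ) := by
  obtain ⟨q, r, rfl⟩ := exists_rep m k
  have e : ((r : ℕ) : ℤ) + ((m + 1 : ℕ) : ℤ) * q + (m + 1 : ℕ) =
      (r : ℕ) + ((m + 1 : ℕ) : ℤ) * (q + 1) := by ring
  rw [e, periodicFun_eq, periodicFun_eq]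
  ring

theorem periodicFun_mono {m n : ℕ} (f : Fin (m + 1) →o Fin (n + 1)) :
    Monotone (periodicFun f) := by
  refine monotone_int_of_le_succ fun k => ?_
  obtain ⟨q, r, rfl⟩ := exists_rep m k
  by_cases hr : (r : ℕ) + 1 < m + 1
  · have e : ((r : ℕ) : ℤ) + ((m + 1 : ℕ) : ℤ) * q + 1 =
        ((⟨r + 1, hr⟩ : Fin (m + 1)) : ℕ) + ((m + 1 : ℕ) : ℤ) * q := by push_cast; ring
    rw [e, periodicFun_eq, periodicFun_eq]
    have hle : f r ≤ f ⟨r + 1, hr⟩ := f.monotone (Fin.mk_le_mk.2 (Nat.le_succ _))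
    have : (f r : ℕ) ≤ (f ⟨r + 1, hr⟩ : ℕ) := hle
    lia
  · have hr' : (r : ℕ) = m := by have := r.2; lia
    have e : ((r : ℕ) : ℤ) + ((m + 1 : ℕ) : ℤ) * q + 1 =
        ((0 : Fin (m + 1)) : ℕ) + ((m + 1 : ℕ) : ℤ) * (q + 1) := by
      rw [hr']; push_cast; simp; ring
    rw [e, periodicFun_eq, periodicFun_eq]
    have := (f r).2
    rw [mul_add, mul_one]
    lia

theorem periodicFun_le {m n : ℕ} {f g : Fin (m + 1) →o Fin (n + 1)} (h : f ≤ g) (k : ℤ) :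
    periodicFun f k ≤ periodicFun g k := by
  obtain ⟨q, r, rfl⟩ := exists_rep m k
  rw [periodicFun_eq, periodicFun_eq]
  have : (f r : ℕ) ≤ (g r : ℕ) := h r
  lia

/-- The periodic extension as an order-preserving map. -/
def periodic {m n : ℕ} (f : Fin (m + 1) →o Fin (n + 1)) : ℤ →o ℤ :=
  ⟨periodicFun f, periodicFun_mono f⟩

theorem periodic_id (m : ℕ) : periodic (OrderHom.id : Fin (m + 1) →o Fin (m + 1)) =
    OrderHom.id := by
  ext k
  obtain ⟨q, r, rfl⟩ := exists_rep m k
  exact periodicFun_eq _ _ _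

theorem periodic_comp {l m n : ℕ} (f : Fin (m + 1) →o Fin (n + 1))
    (g : Fin (l + 1) →o Fin (m + 1)) :
    periodic (f.comp g) = (periodic f).comp (periodic g) := by
  ext k
  obtain ⟨q, r, rfl⟩ := exists_rep l k
  show periodicFun _ _ = periodicFun f (periodicFun g _)
  rw [periodicFun_eq, periodicFun_eq, periodicFun_eq]
  rfl

namespace NCom

/-- Restriction of complexes along an order-preserving map `p : ℤ → ℤ` with
`p (k + M) = p k + N`: the complex `i ↦ X^{p i}` with the (iterated) differentials of `X`. -/
def res {M N : ℕ} (p : ℤ →o ℤ) (hp : ∀ k, p (k + M) = p k + N) : NCom A N ⥤ NCom A M where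
  obj X :=
    { K := p.monotone.functor ⋙ X.K
      zero := fun i j h => X.zero (p i) (p j) (by rw [h, hp]) }
  map f := Functor.whiskerLeft p.monotone.functor f

/-- For `p ≤ q`, the natural transformation `res p ⟶ res q` given by the differentials. -/
def resτ {M N : ℕ} (p q : ℤ →o ℤ) (hp : ∀ k, p (k + M) = p k + N)
    (hq : ∀ k, q (k + M) = q k + N) (h : p ≤ q) :
    (res p hp : NCom A N ⥤ NCom A M) ⟶ res q hq where
  app X := show p.monotone.functor ⋙ X.K ⟶ q.monotone.functor ⋙ X.K from
    { app := fun i => X.K.map (homOfLE (h i))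
      naturality := fun i j φ => by
        simp only [Functor.comp_map, ← Functor.map_comp]
        rfl }
  naturality X Y f := by
    apply hom_ext
    intro i
    exact (NatTrans.naturality f (homOfLE (h i))).symm

theorem res_congr {M N : ℕ} {p q : ℤ →o ℤ} (e : p = q) (hp : ∀ k, p (k + M) = p k + N)
    (hq : ∀ k, q (k + M) = q k + N) : (res p hp : NCom A N ⥤ NCom A M) = res q hq := by
  subst e
  rfl

end NCom

/-- The action of `Δ` on complexes: an order-preserving `f : [m] → [n]` sends an
`(n+1)`-complex `X` to the `(m+1)`-complex obtained from `X` by deleting or repeating objects,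
periodically, as prescribed by `f`. -/
def comMap {m n : SimplexCategory} (f : m ⟶ n) : NCom A (n.len + 1) ⥤ NCom A (m.len + 1) :=
  NCom.res (periodic f.toOrderHom) (periodicFun_period f.toOrderHom)

/-- The action of the 2-morphisms of `Δ` (the pointwise order relation) on complexes: the
natural transformation `τ` whose components are identities or (iterated) differentials. -/
def comτ {m n : SimplexCategory} (f g : m ⟶ n) (h : f.toOrderHom ≤ g.toOrderHom) :
    (comMap f : NCom A (n.len + 1) ⥤ NCom A (m.len + 1)) ⟶ comMap g :=
  NCom.resτ _ _ _ _ (periodicFun_le h)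

variable (A) in
/-- The simplicial category of complexes; its `n`-simplices are the `(n+1)`-complexes. -/
def ComDelta : SimplexCategoryᵒᵖ ⥤ Cat.{v, max u v} where
  obj n := Cat.of (NCom A (n.unop.len + 1))
  map f := (comMap f.unop).toCatHom
  map_id n := by
    apply Cat.Hom.ext
    exact NCom.res_congr (periodic_id n.unop.len) (periodicFun_period _) (fun _ => rfl)
  map_comp f g := by
    apply Cat.Hom.ext
    exact NCom.res_congr (periodic_comp f.unop.toOrderHom g.unop.toOrderHom)
      (periodicFun_period _)
      (fun k => by
        show periodicFun _ (periodicFun _ _) = periodicFun _ (periodicFun _ _) + _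
        rw [periodicFun_period, periodicFun_period])

/-- The functor `σ : Δ ⥤ Δ` adding a new least element: `[n] ↦ [n+1]`, `dⁱ ↦ dⁱ⁺¹`,
`sⁱ ↦ sⁱ⁺¹`. -/
def sigmaΔ : SimplexCategory ⥤ SimplexCategory where
  obj n := SimplexCategory.mk (n.len + 1)
  map {m n} f := SimplexCategory.mkHom
    { toFun := Fin.cases 0 (fun i => (f.toOrderHom i).succ)
      monotone' := by
        intro i j h
        induction i using Fin.cases with
        | zero => exact Fin.zero_le _
        | succ i =>
          induction j using Fin.cases with
          | zero => exact absurd h (by simp)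
          | succ j => simpa using f.toOrderHom.monotone (Fin.succ_le_succ_iff.1 h) }
  map_id n := by
    ext i : 3
    induction i using Fin.cases with
    | zero => rfl
    | succ i => rfl
  map_comp f g := by
    ext i : 3
    induction i using Fin.cases with
    | zero => rfl
    | succ i => rfl

/-- The décalage `Σ S = S ∘ σ` of a simplicial category. -/
def decalage (S : SimplexCategoryᵒᵖ ⥤ Cat.{v', u'}) : SimplexCategoryᵒᵖ ⥤ Cat.{v', u'} :=
  sigmaΔ.op ⋙ S

/-- The 1-simplices of the décalage of the simplicial category of complexes are 3-complexes. -/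
theorem decalage_comDelta_one :
    (decalage (ComDelta A)).obj (op (SimplexCategory.mk 1)) = Cat.of (NCom A 3) := rfl

/-- The 0-simplices of the décalage of the simplicial category of complexes are 2-complexes. -/
theorem decalage_comDelta_zero :
    (decalage (ComDelta A)).obj (op (SimplexCategory.mk 0)) = Cat.of (NCom A 2) := rfl

variable (A) in
/-- The face functor `dᵢ` of the simplicial category of complexes: it deletes the objects of
degree congruent to `i` modulo `n + 2`. -/
def face (n : ℕ) (i : Fin (n + 2)) : NCom A (n + 2) ⥤ NCom A (n + 1) :=
  comMap (SimplexCategory.δ i : SimplexCategory.mk n ⟶ SimplexCategory.mk (n + 1))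

theorem face_eq (n : ℕ) (i : Fin (n + 2)) : (face A n i).toCatHom =
    (ComDelta A).map (SimplexCategory.δ i : SimplexCategory.mk n ⟶ _).op := rfl

theorem sigmaΔ_δ (n : ℕ) (i : Fin (n + 2)) :
    sigmaΔ.map (SimplexCategory.δ i : SimplexCategory.mk n ⟶ _) =
      SimplexCategory.δ i.succ := by
  ext j : 3
  induction j using Fin.cases with
  | zero => rfl
  | succ j => exact (Fin.succ_succAbove_succ i j).symm

/-- The natural transformation `τ : d_{i+1} ⟶ d_i` between face functors. -/
def faceτ (n : ℕ) (i : Fin (n + 1)) : face A n i.succ ⟶ face A n i.castSucc :=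
  comτ _ _ (fun j => by
    show i.succ.succAbove j ≤ i.castSucc.succAbove j
    simp only [Fin.succAbove, Fin.le_def, Fin.lt_def]
    split_ifs <;> simp_all <;> lia)

/-! ## The triangulation of the décalage given by the recalage -/

variable (A) in
/-- The spine in degree 1: a 3-complex `Y` is sent to `τ : d₂ Y ⟶ d₁ Y`. Here `d₂` and `d₁` are
the vertex functors of the décalage. -/
def spine : NCom A 3 ⥤ LArr (NCom A 2) where
  obj Y := ⟨(face A 1 2).obj Y, (face A 1 1).obj Y, (faceτ (A := A) 1 1).app Y⟩
  map f := ⟨(face A 1 2).map f, (face A 1 1).map f, 0, by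
    have h := (faceτ (A := A) 1 1).naturality f
    have h' : (face A 1 2).map f ≫ (faceτ (A := A) 1 1).app _ =
      (faceτ (A := A) 1 1).app _ ≫ (face A 1 1).map f := h
    rw [h']
    exact isTwo_zero _⟩
  map_id Y := by
    apply LArr.Hom.ext
    · exact (face A 1 2).map_id Y
    · exact (face A 1 1).map_id Y
    · rfl
  map_comp f g := by
    apply LArr.Hom.ext
    · exact (face A 1 2).map_comp f g
    · exact (face A 1 1).map_comp f g
    · show 0 = pre ((face A 1 2).map f) 0 + post 0 ((face A 1 1).map g)
      rw [pre_zero, post_zero, add_zero]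

theorem δ_comp_σ_le_id :
    (periodic (SimplexCategory.δ 1 : SimplexCategory.mk 0 ⟶ SimplexCategory.mk 1).toOrderHom).comp
      (periodic (SimplexCategory.σ 0 : SimplexCategory.mk 1 ⟶ SimplexCategory.mk 0).toOrderHom) ≤
    OrderHom.id := by
  rw [← periodic_comp, ← periodic_id 1]
  refine periodicFun_le (fun j => ?_)
  show (SimplexCategory.σ 0 ≫ SimplexCategory.δ 1 :
    SimplexCategory.mk 1 ⟶ SimplexCategory.mk 1).toOrderHom j ≤ j
  revert j
  decide

/-- The natural transformation `τ : s₀ d₁ = d₂ s₀ ⟶ d₁ s₀ = id` on 2-complexes. -/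
def vertexτ : face A 0 1 ⋙
    comMap (SimplexCategory.σ 0 : SimplexCategory.mk 1 ⟶ SimplexCategory.mk 0) ⟶
      𝟭 (NCom A 2) :=
  show NCom.res
      ((periodic (SimplexCategory.δ 1 :
        SimplexCategory.mk 0 ⟶ SimplexCategory.mk 1).toOrderHom).comp
        (periodic (SimplexCategory.σ 0 :
          SimplexCategory.mk 1 ⟶ SimplexCategory.mk 0).toOrderHom))
      (fun k => (congrArg _ (periodicFun_period _ k)).trans (periodicFun_period _ _)) ⟶
    (NCom.res OrderHom.id (fun _ => rfl) : NCom A 2 ⥤ NCom A 2) from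
  NCom.resτ _ _ _ _ δ_comp_σ_le_id

variable (A) in
/-- The triangulation on the décalage of the simplicial category of complexes given by the
recalage, i.e. by the face `d₀`, the degeneracy `s₀`, and the `τ`'s that the décalage forgets. The
triangle of a 3-complex `Y` is `d₂ Y ⟶ d₁ Y ⟶ d₀ Y`. -/
def recalageTriangulation : TriangulationData (NCom A 2) (NCom A 3) (NCom A 1) where
  edge := spine A
  aug := face A 0 1
  cone := face A 1 0
  vertex := comMap (SimplexCategory.σ 0 : SimplexCategory.mk 1 ⟶ SimplexCategory.mk 0)
  τd := LaxTrans.ofNatTrans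
    (show (face A 1 1 : NCom A 3 ⥤ NCom A 2) ⟶ face A 1 0 from faceτ (A := A) 1 0)
  τs := LaxTrans.ofNatTrans vertexτ

end Complexes

/-! ## The mapping cone triangulation -/

noncomputable section Cone

variable {A : Type u} [Category.{v} A] [Preadditive A] [HasFiniteBiproducts A]

attribute [local instance] hasBinaryBiproducts_of_finite_biproducts

theorem NCom.isHtpy_two {X Y : NCom A 2} {f g : X ⟶ Y} {s : NCom.PreHtpy X Y}
    (H : NCom.IsHtpy f g s) (i : ℤ) :
    NCom.c g (i + 1) - NCom.c f (i + 1) =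
      X.D (i + 1) (i + 1 + 1) (by lia) ≫ s.h (i + 1 + 1) (i + 1) (by push_cast; ring) +
      s.h (i + 1) i (by push_cast; ring) ≫ Y.D i (i + 1) (by lia) := by
  have key : ∀ (a b : ℤ) (ha : a = i + 1 + 1) (hb : b = i + 1) (p1 p2 p3),
      X.D (i + 1) a p1 ≫ s.h a b p2 ≫ Y.D b (i + 1) p3 =
        X.D (i + 1) (i + 1 + 1) (by lia) ≫ s.h (i + 1 + 1) (i + 1) (by push_cast; ring) := by
    rintro a b rfl rfl p1 p2 p3
    rw [NCom.D_refl, Category.comp_id]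
  have key' : ∀ (a b : ℤ) (ha : a = i + 1) (hb : b = i) (p1 p2 p3),
      X.D (i + 1) a p1 ≫ s.h a b p2 ≫ Y.D b (i + 1) p3 =
        s.h (i + 1) i (by push_cast; ring) ≫ Y.D i (i + 1) (Int.le_add_one le_rfl) := by
    rintro a b rfl rfl p1 p2 p3
    rw [NCom.D_refl, Category.id_comp]
  rw [H (i + 1), Fin.sum_univ_two]
  congr 1
  · exact key _ _ (by norm_num; ring) (by norm_num) _ _ _
  · exact key' _ _ (by norm_num; ring) (by norm_num) _ _ _

/-- The differential `(-d, 0; x, d)` of the mapping cone of `x : C ⟶ X`. -/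
def coneD (x : LArr (NCom A 2)) (i : ℤ) :
    x.dom.ob (i + 1) ⊞ x.cod.ob i ⟶ x.dom.ob (i + 1 + 1) ⊞ x.cod.ob (i + 1) :=
  biprod.lift (biprod.fst ≫ (-x.dom.D (i + 1) (i + 1 + 1) (by lia)))
    (biprod.fst ≫ NCom.c x.arr (i + 1) + biprod.snd ≫ x.cod.D i (i + 1) (by lia))

theorem NCom.D_D_zero (X : NCom A 2) (i : ℤ) :
    X.D i (i + 1) (by lia) ≫ X.D (i + 1) (i + 1 + 1) (by lia) = 0 := by
  rw [← X.zero i (i + 1 + 1) (by push_cast; ring)]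
  simp only [NCom.D, ← Functor.map_comp]
  rfl

theorem coneD_coneD (x : LArr (NCom A 2)) (i : ℤ) : coneD x i ≫ coneD x (i + 1) = 0 := by
  have h1 := NCom.D_D_zero x.dom (i + 1)
  have h2 := NCom.D_D_zero x.cod i
  have h3 := NCom.D_c x.arr (i + 1) (i + 1 + 1) (by lia)
  unfold coneD
  apply biprod.hom_ext
  · simp [h1]
  · simp [h2, h3]

/-- The mapping cone of a morphism `x : C ⟶ X` of chain complexes, with objects `C^{i+1} ⊞ X^i`
and differential `(-d, 0; x, d)`. -/
def coneObj (x : LArr (NCom A 2)) : NCom A 2 :=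
  NCom.ofDiff₂ (fun i => x.dom.ob (i + 1) ⊞ x.cod.ob i) (coneD x) (coneD_coneD x)

theorem coneObj_D (x : LArr (NCom A 2)) (i : ℤ) :
    (coneObj x).D i (i + 1) (by lia) = coneD x i :=
  NCom.ofDiff₂_D _ _ (coneD_coneD x) i _

/-- The component `(f₀, 0; hat, f₁)` of the mapping cone of a morphism of lax arrows. -/
def coneC {x y : LArr (NCom A 2)} (f : x ⟶ y) (i : ℤ) :
    x.dom.ob (i + 1) ⊞ x.cod.ob i ⟶ y.dom.ob (i + 1) ⊞ y.cod.ob i :=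
  biprod.lift (biprod.fst ≫ NCom.c f.f₀ (i + 1))
    (biprod.fst ≫ (show NCom.PreHtpy _ _ from f.hat).h (i + 1) i (by push_cast; ring) + biprod.snd ≫ NCom.c f.f₁ i)

theorem coneD_coneC {x y : LArr (NCom A 2)} (f : x ⟶ y) (i : ℤ) :
    coneD x i ≫ coneC f (i + 1) = coneC f i ≫ coneD y i := by
  have h0 := NCom.D_c f.f₀ (i + 1) (i + 1 + 1) (by lia)
  have h1 := NCom.D_c f.f₁ i (i + 1) (by lia)
  have h2 := NCom.isHtpy_two f.isTwo i
  simp only [NCom.c_comp] at h2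
  unfold coneD coneC
  apply biprod.hom_ext
  · simp [h0]
  · simp only [Category.assoc, biprod.lift_snd, biprod.lift_fst_assoc, Preadditive.comp_add,
      biprod.lift_snd_assoc, Preadditive.add_comp, Preadditive.comp_neg, Preadditive.neg_comp, h1]
    rw [← sub_eq_zero]
    have h2' := congrArg (fun t => biprod.fst (X := x.dom.ob (i + 1)) (Y := x.cod.ob i) ≫ t) h2
    simp only [Preadditive.comp_sub, Preadditive.comp_add] at h2'
    rw [sub_eq_iff_eq_add] at h2'
    rw [h2']
    abel

variable (A) in
/-- The mapping cone functor on the lax arrow category of chain complexes. -/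
def coneF : LArr (NCom A 2) ⥤ NCom A 2 where
  obj x := coneObj x
  map {x y} f := NCom.homMk (X := coneObj x) (Y := coneObj y) (coneC f) (fun i => by
    have h := coneD_coneC f i
    rw [← coneObj_D, ← coneObj_D] at h
    exact h)
  map_id x := by
    apply NCom.hom_ext
    intro i
    show coneC (𝟙 x) i = 𝟙 (x.dom.ob (i + 1) ⊞ x.cod.ob i)
    have e0 : (𝟙 x : x ⟶ x).f₀ = 𝟙 x.dom := rfl
    have e1 : (𝟙 x : x ⟶ x).f₁ = 𝟙 x.cod := rfl
    have e2 : (𝟙 x : x ⟶ x).hat = 0 := rfl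
    unfold coneC
    rw [e0, e1, e2]
    apply biprod.hom_ext
    · simp
    · simp
  map_comp {x y z} f g := by
    apply NCom.hom_ext
    intro i
    show coneC (f ≫ g) i = coneC f i ≫ coneC g i
    have e0 : (f ≫ g).f₀ = f.f₀ ≫ g.f₀ := rfl
    have e1 : (f ≫ g).f₁ = f.f₁ ≫ g.f₁ := rfl
    have e2 : ∀ a b e, (show NCom.PreHtpy _ _ from (f ≫ g).hat).h a b e =
      NCom.c f.f₀ a ≫ (show NCom.PreHtpy _ _ from g.hat).h a b e +
        (show NCom.PreHtpy _ _ from f.hat).h a b e ≫ NCom.c g.f₁ b := fun _ _ _ => rfl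
    unfold coneC
    rw [e0, e1, e2]
    apply biprod.hom_ext
    · simp
    · simp [add_assoc]

/-- The inclusion `(0, 1) : X ⟶ Cone x`. -/
def coneInr (x : LArr (NCom A 2)) : x.cod ⟶ coneObj x :=
  NCom.homMk (Y := coneObj x) (fun i => (biprod.inr : x.cod.ob i ⟶ x.dom.ob (i + 1) ⊞ x.cod.ob i))
    (fun i => by
      have h : x.cod.D i (i + 1) (by lia) ≫ biprod.inr = biprod.inr ≫ coneD x i := by
        unfold coneD
        apply biprod.hom_ext
        · simp
        · simp
      rw [← coneObj_D] at h
      exact h)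

/-- The zero chain complex. -/
def zeroCom (A : Type u) [Category.{v} A] [Preadditive A] [HasFiniteBiproducts A] :
    NCom A 2 :=
  haveI : HasZeroObject A := hasZeroObject_of_hasFiniteBiproducts A
  NCom.ofDiff₂ (fun _ => (0 : A)) (fun _ => 0) (fun _ => by simp)

/-- The zero morphism out of the zero chain complex. -/
def zeroComTo (X : NCom A 2) : zeroCom A ⟶ X :=
  NCom.homMk (fun _ => 0) (fun i => by simp)

variable (A) in
/-- The mapping cone triangulation on chain complexes: `d₋₁` is the mapping cone, `s₋₁` is the
zero complex, `τd = (0, 1) : X ⟶ Cone x` and `τs = 0`. The triangle of a morphism `x : C ⟶ X` of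
chain complexes is `C ⟶ X ⟶ Cone x`. -/
def coneTriangulation :
    TriangulationData (NCom A 2) (LArr (NCom A 2)) (Discrete PUnit.{1}) where
  edge := 𝟭 _
  aug := (Functor.const _).obj ⟨⟨⟩⟩
  cone := coneF A
  vertex := (Functor.const _).obj (zeroCom A)
  τd := LaxTrans.ofNatTrans
    { app := coneInr
      naturality := fun x y f => by
        apply NCom.hom_ext
        intro i
        show NCom.c f.f₁ i ≫ (biprod.inr : _ ⟶ y.dom.ob (i + 1) ⊞ y.cod.ob i) =
          biprod.inr ≫ coneC f i
        unfold coneC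
        apply biprod.hom_ext
        · simp
        · simp }
  τs := LaxTrans.ofNatTrans
    { app := zeroComTo
      naturality := fun X Y f => by
        apply NCom.hom_ext
        intro i
        show 𝟙 _ ≫ (0 : _ ⟶ Y.ob i) = (0 : _ ⟶ X.ob i) ≫ NCom.c f i
        simp }

end Cone

/-!
The filler of a morphism `x : C ⟶ X` of complexes is the 3-complex `F` whose objects in the degrees
`3q`, `3q + 1`, `3q + 2` are `C^{2q} ⊞ X^{2q}`, `C^{2q+1} ⊞ X^{2q}`, `C^{2q+2} ⊞ X^{2q+1}`, with the
differentials `(d, 0; -x, 1)`, `(d, 0; x, d)`, `(1, 0; 0, d)`. All the iterated differentials have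
the same shape: a diagonal of iterated differentials of `C` and `X`, and below it the multiple
`ind i - ind j` of a composite of `x` with differentials, where `ind` is the indicator function of
the degrees congruent to 1 modulo 3. Hence the differentials compose, and those of length 3 vanish.

* Deleting the degrees divisible by 3 leaves the mapping cone, up to signs (`fillerConeIso`).
* Deleting the degrees congruent to 2 or to 1 leaves complexes that contract to `C` and to `X`,
  respectively, because of the entries `1` of the differentials. The contractions, and the
  isomorphism with the cone, form an equivalence between the triangle `T'(F)` and the triangle
  `T(x)`; it is only lax natural in `x`, as a morphism of lax arrows carries a homotopy
  (`fillerTriangleEquiv`). Restricting it to the first arrows of the triangles gives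
  `Spine ∘ Filler ≃ Id`.
* A 3-complex `Y` is a strictly natural retract of the filler of its spine, and the resulting
  idempotent is homotopic to the identity (`spineFillerEquiv`); `d₀ Y` is likewise a deformation
  retract of the cone of the spine (`spineTriangleEquiv`).

A lax equivalence of functors to composable pairs becomes, at each object, an isomorphism of
diagrams in the homotopy category (`LaxEquiv.decatIso`). So the statement about diagrams in `K(C)`
follows by evaluating `fillerTriangleEquiv` at a morphism `x` and `spineTriangleEquiv` at a 3-complex `Y`.

Many degrees below agree only up to an arithmetic identity such as `degC (idx 2 k) = k`. Instead of
transporting along these identities, `NCom.E X i j` extends the iterated differentials by zero to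
all pairs of degrees, so that `E` is an identity morphism where the degrees happen to agree.
-/

/-! ### Lax equivalences of functors to composable pairs -/

section Pairs

variable {C : Type u} [Category.{v} C] [AdditiveSesquicategory C]

/-- The functor sending a composable pair to its first arrow, i.e. the face of the lax nerve that
forgets the last vertex. -/
def LPair.firstArrow (C : Type u) [Category.{v} C] [AdditiveSesquicategory C] :
    LPair C ⥤ LArr C where
  obj x := ⟨x.X₀, x.X₁, x.a⟩
  map f := ⟨f.f₀, f.f₁, f.hatA, f.isTwoA⟩

variable {D : Type u'} [Category.{v'} D] {F G : D ⥤ LPair C}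

/-- The restriction of a lax transformation along `LPair.firstArrow`, which is strictly compatible
with 2-morphisms. -/
def LaxTrans.firstArrow (α : LaxTrans F G) :
    LaxTrans (F ⋙ LPair.firstArrow C) (G ⋙ LPair.firstArrow C) where
  app X := (LPair.firstArrow C).map (α.app X)
  cell f := ((α.cell f).1, (α.cell f).2.1)
  cell_isTwo f := ⟨(α.cell_isTwo f).1, (α.cell_isTwo f).2.1, (α.cell_isTwo f).2.2.2.1⟩
  cell_id X := by rw [α.cell_id]; rfl
  cell_comp f g := by rw [α.cell_comp]; rfl

/-- The restriction of a modification along `LPair.firstArrow`. -/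
def CompModId.firstArrow {α : LaxTrans F G} {β : LaxTrans G F} (m : CompModId α β) :
    CompModId α.firstArrow β.firstArrow where
  app X := ((m.app X).1, (m.app X).2.1)
  isTwo X := ⟨(m.isTwo X).1, (m.isTwo X).2.1, (m.isTwo X).2.2.2.1⟩
  naturality {X Y} f := by
    have h := m.naturality f
    apply Prod.ext
    · exact congrArg (fun c => c.1) h
    · exact congrArg (fun c => c.2.1) h

/-- Equivalent functors to composable pairs have equivalent first arrows. -/
def LaxEquiv.firstArrow (e : LaxEquiv F G) :
    LaxEquiv (F ⋙ LPair.firstArrow C) (G ⋙ LPair.firstArrow C) where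
  hom := e.hom.firstArrow
  inv := e.inv.firstArrow
  homInv := e.homInv.firstArrow
  invHom := e.invHom.firstArrow

theorem Decat.proj_map_eq {X Y : C} {f g : X ⟶ Y} {c : Cell X Y} (h : IsTwo f g c) :
    (Decat.proj C).map f = (Decat.proj C).map g :=
  CategoryTheory.Quotient.sound _ ⟨c, h⟩

/-- The isomorphism in the decategorification defined by an equivalence `f`, `g` of objects. -/
def Decat.isoOfIsTwo {X Y : C} (f : X ⟶ Y) (g : Y ⟶ X) {c : Cell X X} {c' : Cell Y Y}
    (h : IsTwo (f ≫ g) (𝟙 X) c) (h' : IsTwo (g ≫ f) (𝟙 Y) c') :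
    (Decat.proj C).obj X ≅ (Decat.proj C).obj Y where
  hom := (Decat.proj C).map f
  inv := (Decat.proj C).map g
  hom_inv_id :=
    ((Decat.proj C).map_comp f g).symm.trans
      ((Decat.proj_map_eq h).trans ((Decat.proj C).map_id X))
  inv_hom_id :=
    ((Decat.proj C).map_comp g f).symm.trans
      ((Decat.proj_map_eq h').trans ((Decat.proj C).map_id Y))

/-- The image of a composable pair in the decategorification. -/
def LPair.decat (x : LPair C) : ComposableArrows (Decat C) 2 :=
  ComposableArrows.mk₂ ((Decat.proj C).map x.a) ((Decat.proj C).map x.b)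

/-- The values of equivalent functors to composable pairs are isomorphic in the
decategorification. -/
def LaxEquiv.decatIso (e : LaxEquiv F G) (X : D) : (F.obj X).decat ≅ (G.obj X).decat :=
  ComposableArrows.isoMk₂
    (Decat.isoOfIsTwo (e.hom.app X).f₀ (e.inv.app X).f₀ (e.homInv.isTwo X).1 (e.invHom.isTwo X).1)
    (Decat.isoOfIsTwo (e.hom.app X).f₁ (e.inv.app X).f₁ (e.homInv.isTwo X).2.1
      (e.invHom.isTwo X).2.1)
    (Decat.isoOfIsTwo (e.hom.app X).f₂ (e.inv.app X).f₂ (e.homInv.isTwo X).2.2.1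
      (e.invHom.isTwo X).2.2.1)
    (by
      have h := Decat.proj_map_eq (e.hom.app X).isTwoA
      rw [Functor.map_comp, Functor.map_comp] at h
      exact h.symm)
    (by
      have h := Decat.proj_map_eq (e.hom.app X).isTwoB
      rw [Functor.map_comp, Functor.map_comp] at h
      exact h.symm)

theorem TriangulationData.isTriangle_iff {S : Type u'} [Category.{v'} S]
    {P : Type u''} [Category.{v''} P] (T : TriangulationData C S P)
    (K : ComposableArrows (Decat C) 2) :
    T.IsTriangle K ↔ ∃ s : S, Nonempty (K ≅ (T.triangle.obj s).decat) := Iff.rfl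

end Pairs

/-! ### Iterated differentials between arbitrary degrees -/

noncomputable section Differentials

variable {A : Type u} [Category.{v} A] [Preadditive A]

namespace NCom

variable {N : ℕ}

/-- The iterated differential `X^i ⟶ X^j`, with the value `0` for `j < i`. As `i` and `j` are
arbitrary, this absorbs the identifications of objects in degrees that are only provably equal,
and many case distinctions on degrees modulo 2 and 3. -/
def E (X : NCom A N) (i j : ℤ) : X.ob i ⟶ X.ob j :=
  if h : i ≤ j then X.D i j h else 0

theorem E_of_le (X : NCom A N) {i j : ℤ} (h : i ≤ j) : X.E i j = X.D i j h := dif_pos h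

theorem E_of_lt (X : NCom A N) {i j : ℤ} (h : j < i) : X.E i j = 0 := dif_neg (by lia)

@[simp] theorem E_self (X : NCom A N) (i : ℤ) : X.E i i = 𝟙 (X.ob i) := by
  rw [E_of_le X le_rfl, D_refl]

theorem E_comp (X : NCom A N) {i j k : ℤ} (h : i ≤ j) (h' : j ≤ k) :
    X.E i j ≫ X.E j k = X.E i k := by
  rw [E_of_le X h, E_of_le X h', E_of_le X (h.trans h'), D_comp]

theorem E_comp_assoc (X : NCom A N) {i j k : ℤ} (h : i ≤ j) (h' : j ≤ k) {Z : A}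
    (g : X.ob k ⟶ Z) : X.E i j ≫ X.E j k ≫ g = X.E i k ≫ g := by
  rw [← Category.assoc, E_comp X h h']

theorem D_eq_zero (X : NCom A N) {i j : ℤ} (h : i + N ≤ j) : X.D i j (by lia) = 0 := by
  rw [← D_comp X i (i + N) j (by lia) h]
  have h0 : X.D i (i + N) (by lia) = 0 := X.zero i (i + N) rfl
  rw [h0, zero_comp]

theorem E_of_ge (X : NCom A N) {i j : ℤ} (h : i + N ≤ j) : X.E i j = 0 := by
  rw [E_of_le X (by lia), D_eq_zero X h]

theorem E_c {X Y : NCom A N} (f : X ⟶ Y) (i j : ℤ) :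
    X.E i j ≫ c f j = c f i ≫ Y.E i j := by
  by_cases h : i ≤ j
  · rw [E_of_le X h, E_of_le Y h, D_c]
  · rw [E_of_lt X (by lia), E_of_lt Y (by lia), zero_comp, comp_zero]

theorem E_c_assoc {X Y : NCom A N} (f : X ⟶ Y) (i j : ℤ) {Z : A} (g : Y.ob j ⟶ Z) :
    X.E i j ≫ c f j ≫ g = c f i ≫ Y.E i j ≫ g := by
  rw [← Category.assoc, E_c, Category.assoc]

/-- A chain map from components that commute with the differentials. -/
def homOfE {X Y : NCom A N} (f : ∀ i, X.ob i ⟶ Y.ob i)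
    (w : ∀ i, X.E i (i + 1) ≫ f (i + 1) = f i ≫ Y.E i (i + 1)) : X ⟶ Y :=
  homMk f fun i => by rw [← E_of_le, ← E_of_le, w]

/-- The component of a homotopy is determined by its value in one pair of degrees. -/
theorem PreHtpy.h_congr {X Y : NCom A N} (s : PreHtpy X Y) {a i a' i' : ℤ} (e : a + 1 = i + N)
    (ha : a = a') (hi : i' = i) :
    s.h a i e = X.E a a' ≫ s.h a' i' (by lia) ≫ Y.E i' i := by
  subst ha hi
  simp

theorem D_h_D_congr {X Y : NCom A N} (s : PreHtpy X Y) {i a b a' b' : ℤ} (h₁ : i ≤ a)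
    (e : a + 1 = b + N) (h₂ : b ≤ i) (ha : a = a') (hb : b = b') :
    X.D i a h₁ ≫ s.h a b e ≫ Y.D b i h₂ =
      X.E i a' ≫ s.h a' b' (by lia) ≫ Y.E b' i := by
  subst ha hb
  rw [E_of_le X h₁, E_of_le Y h₂]

theorem isHtpy_two_iff {X Y : NCom A 2} {f g : X ⟶ Y} {s : PreHtpy X Y} :
    IsHtpy f g s ↔ ∀ i : ℤ, c g i - c f i =
      X.E i (i + 1) ≫ s.h (i + 1) i (by push_cast; ring) +
        s.h i (i - 1) (by push_cast; ring) ≫ Y.E (i - 1) i := by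
  refine forall_congr' fun i => ?_
  rw [Fin.sum_univ_two,
    D_h_D_congr s _ _ _ (a' := i + 1) (b' := i) (by simp; lia) (by simp),
    D_h_D_congr s _ _ _ (a' := i) (b' := i - 1) (by simp; lia) (by simp),
    E_self, E_self, Category.comp_id, Category.id_comp]

theorem isHtpy_two_of {X Y : NCom A 2} {f g : X ⟶ Y} {s : PreHtpy X Y}
    (dX : ∀ k, X.ob k ⟶ X.ob (k + 1)) (dY : ∀ k, Y.ob (k - 1) ⟶ Y.ob k)
    (hX : ∀ k, X.E k (k + 1) = dX k) (hY : ∀ k, Y.E (k - 1) k = dY k)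
    (w : ∀ k : ℤ, c g k - c f k = dX k ≫ s.h (k + 1) k (by push_cast; ring) +
      s.h k (k - 1) (by push_cast; ring) ≫ dY k) : IsHtpy f g s :=
  isHtpy_two_iff.2 fun k => by rw [hX, hY, w]

theorem isHtpy_three_iff {X Y : NCom A 3} {f g : X ⟶ Y} {s : PreHtpy X Y} :
    IsHtpy f g s ↔ ∀ i : ℤ, c g i - c f i =
      X.E i (i + 2) ≫ s.h (i + 2) i (by push_cast; ring) +
        X.E i (i + 1) ≫ s.h (i + 1) (i - 1) (by push_cast; ring) ≫ Y.E (i - 1) i +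
        s.h i (i - 2) (by push_cast; ring) ≫ Y.E (i - 2) i := by
  refine forall_congr' fun i => ?_
  rw [Fin.sum_univ_three,
    D_h_D_congr s _ _ _ (a' := i + 2) (b' := i) (by simp; lia) (by simp),
    D_h_D_congr s _ _ _ (a' := i + 1) (b' := i - 1) (by simp; lia) (by simp),
    D_h_D_congr s _ _ _ (a' := i) (b' := i - 2) (by simp; lia) (by simp),
    E_self, E_self, Category.comp_id, Category.id_comp]

end NCom

/-- The filled square of a morphism of lax arrows, as a homotopy. -/
abbrev LArr.htpy {x y : LArr (NCom A 2)} (f : x ⟶ y) : NCom.PreHtpy x.dom y.cod := f.hat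

theorem LArr.htpy_comm {x y : LArr (NCom A 2)} (f : x ⟶ y) (i : ℤ) :
    NCom.c x.arr i ≫ NCom.c f.f₁ i - NCom.c f.f₀ i ≫ NCom.c y.arr i =
      x.dom.E i (i + 1) ≫ (htpy f).h (i + 1) i (by push_cast; ring) +
        (htpy f).h i (i - 1) (by push_cast; ring) ≫ y.cod.E (i - 1) i :=
  NCom.isHtpy_two_iff.1 f.isTwo i

end Differentials

/-! ### Lower triangular morphisms between biproducts -/

noncomputable section Filler

variable {A : Type u} [Category.{v} A] [Preadditive A] [HasFiniteBiproducts A]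

attribute [local instance] hasBinaryBiproducts_of_finite_biproducts

section Triangular

variable {M N M' N' M'' N'' : A}

/-- The lower triangular morphism `(a, 0; b, d) : M ⊞ N ⟶ M' ⊞ N'`. -/
def tri (a : M ⟶ M') (b : M ⟶ N') (d : N ⟶ N') : M ⊞ N ⟶ M' ⊞ N' :=
  biprod.lift (biprod.fst ≫ a) (biprod.fst ≫ b + biprod.snd ≫ d)

theorem tri_comp_tri (a : M ⟶ M') (b : M ⟶ N') (d : N ⟶ N') (a' : M' ⟶ M'') (b' : M' ⟶ N'')
    (d' : N' ⟶ N'') :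
    tri a b d ≫ tri a' b' d' = tri (a ≫ a') (a ≫ b' + b ≫ d') (d ≫ d') := by
  unfold tri
  apply biprod.hom_ext <;> simp [add_assoc]

theorem tri_id : tri (𝟙 M) 0 (𝟙 N) = 𝟙 (M ⊞ N) := by
  unfold tri
  apply biprod.hom_ext <;> simp

theorem tri_zero : tri (0 : M ⟶ M') 0 (0 : N ⟶ N') = 0 := by
  unfold tri
  apply biprod.hom_ext <;> simp

theorem tri_add (a : M ⟶ M') (b : M ⟶ N') (d : N ⟶ N') (a' b' d') :
    tri a b d + tri a' b' d' = tri (a + a') (b + b') (d + d') := by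
  unfold tri
  apply biprod.hom_ext
  · simp
  · simp; abel

theorem tri_sub (a : M ⟶ M') (b : M ⟶ N') (d : N ⟶ N') (a' b' d') :
    tri a b d - tri a' b' d' = tri (a - a') (b - b') (d - d') := by
  unfold tri
  apply biprod.hom_ext
  · simp
  · simp; abel

theorem inl_tri (a : M ⟶ M') (b : M ⟶ N') (d : N ⟶ N') :
    biprod.inl ≫ tri a b d = a ≫ biprod.inl + b ≫ biprod.inr := by
  unfold tri
  apply biprod.hom_ext <;> simp

theorem inr_tri (a : M ⟶ M') (b : M ⟶ N') (d : N ⟶ N') :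
    biprod.inr ≫ tri a b d = d ≫ biprod.inr := by
  unfold tri
  apply biprod.hom_ext <;> simp

theorem tri_fst (a : M ⟶ M') (b : M ⟶ N') (d : N ⟶ N') :
    tri a b d ≫ biprod.fst = biprod.fst ≫ a := by
  simp [tri]

theorem tri_snd (a : M ⟶ M') (b : M ⟶ N') (d : N ⟶ N') :
    tri a b d ≫ biprod.snd = biprod.fst ≫ b + biprod.snd ≫ d := by
  simp [tri]

theorem tri_fst_assoc (a : M ⟶ M') (b : M ⟶ N') (d : N ⟶ N') {Z : A} (g : M' ⟶ Z) :
    tri a b d ≫ biprod.fst ≫ g = biprod.fst ≫ a ≫ g := by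
  rw [← Category.assoc, tri_fst, Category.assoc]

theorem tri_snd_assoc (a : M ⟶ M') (b : M ⟶ N') (d : N ⟶ N') {Z : A} (g : N' ⟶ Z) :
    tri a b d ≫ biprod.snd ≫ g = biprod.fst ≫ b ≫ g + biprod.snd ≫ d ≫ g := by
  rw [← Category.assoc, tri_snd, Preadditive.add_comp, Category.assoc, Category.assoc]

end Triangular

/-! ### The filler functor -/

/-- The degree of `C` in degree `i` of the filler of `C ⟶ X`: `3q, 3q + 1, 3q + 2` are sent to
`2q, 2q + 1, 2q + 2`. -/
def degC (i : ℤ) : ℤ := i - i / 3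

/-- The degree of `X` in degree `i` of the filler of `C ⟶ X`: `3q, 3q + 1, 3q + 2` are sent to
`2q, 2q, 2q + 1`. -/
def degX (i : ℤ) : ℤ := i - (i + 2) / 3

/-- The indicator function of the degrees congruent to `1` modulo `3`. -/
def ind (i : ℤ) : ℤ := if i % 3 = 1 then 1 else 0

theorem ind_one {i : ℤ} (h : i % 3 = 1) : ind i = 1 := if_pos h

theorem ind_zero {i : ℤ} (h : i % 3 ≠ 1) : ind i = 0 := if_neg h

/-- The differential `F^i ⟶ F^j` of the filler of `x : C ⟶ X`. -/
def fillerD (x : LArr (NCom A 2)) (i j : ℤ) :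
    x.dom.ob (degC i) ⊞ x.cod.ob (degX i) ⟶ x.dom.ob (degC j) ⊞ x.cod.ob (degX j) :=
  tri (x.dom.E (degC i) (degC j))
    ((ind i - ind j) • (NCom.c x.arr (degC i) ≫ x.cod.E (degC i) (degX j)))
    (x.cod.E (degX i) (degX j))

theorem fillerD_self (x : LArr (NCom A 2)) (i : ℤ) : fillerD x i i = 𝟙 _ := by
  simp [fillerD, tri_id]

theorem fillerD_comp (x : LArr (NCom A 2)) {i j k : ℤ} (h : i ≤ j) (h' : j ≤ k) :
    fillerD x i j ≫ fillerD x j k = fillerD x i k := by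
  rcases h.eq_or_lt with rfl | hij
  · rw [fillerD_self, Category.id_comp]
  rcases h'.eq_or_lt with rfl | hjk
  · rw [fillerD_self, Category.comp_id]
  unfold fillerD degC degX
  simp only [tri_comp_tri, Preadditive.comp_zsmul, Preadditive.zsmul_comp, Category.assoc,
    NCom.E_c_assoc]
  simp (disch := omega) only [NCom.E_comp]
  rw [← add_smul]
  congr 2
  ring

theorem fillerD_eq_zero (x : LArr (NCom A 2)) {i j : ℤ} (h : j = i + 3) :
    fillerD x i j = 0 := by
  subst h
  have h : ind (i + 3) = ind i := by simp [ind]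
  unfold fillerD
  rw [h, NCom.E_of_ge x.dom (i := degC i) (by unfold degC; push_cast; lia),
    NCom.E_of_ge x.cod (i := degX i) (by unfold degX; push_cast; lia), sub_self, zero_smul,
    tri_zero]

/-- The filler of `x : C ⟶ X`. Its objects in the degrees `3q, 3q + 1, 3q + 2` are
`C^{2q} ⊞ X^{2q}`, `C^{2q+1} ⊞ X^{2q}`, `C^{2q+2} ⊞ X^{2q+1}`, and its differentials are
`(d, 0; -x, 1)`, `(d, 0; x, d)`, `(1, 0; 0, d)`. -/
def fillerObj (x : LArr (NCom A 2)) : NCom A 3 where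
  K :=
    { obj := fun i => x.dom.ob (degC i) ⊞ x.cod.ob (degX i)
      map := fun {i j} _ => fillerD x i j
      map_id := fun i => fillerD_self x i
      map_comp := fun φ ψ => (fillerD_comp x (leOfHom φ) (leOfHom ψ)).symm }
  zero _ _ h := fillerD_eq_zero x h

theorem fillerObj_E (x : LArr (NCom A 2)) {i j : ℤ} (h : i ≤ j) :
    (fillerObj x).E i j = fillerD x i j :=
  NCom.E_of_le _ h

/-- The component in degree `i` of the filler of a morphism of lax arrows. -/
def fillerC {x y : LArr (NCom A 2)} (f : x ⟶ y) (i : ℤ) :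
    x.dom.ob (degC i) ⊞ x.cod.ob (degX i) ⟶ y.dom.ob (degC i) ⊞ y.cod.ob (degX i) :=
  tri (NCom.c f.f₀ (degC i))
    ((2 * ind i - 1) • ((LArr.htpy f).h (degC i) (degC i - 1) (by push_cast; ring) ≫
      y.cod.E (degC i - 1) (degX i)))
    (NCom.c f.f₁ (degX i))

theorem fillerD_fillerC {x y : LArr (NCom A 2)} (f : x ⟶ y) (i : ℤ) :
    fillerD x i (i + 1) ≫ fillerC f (i + 1) = fillerC f i ≫ fillerD y i (i + 1) := by
  unfold fillerD fillerC
  rw [tri_comp_tri, tri_comp_tri, NCom.E_c, NCom.E_c]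
  congr 1
  simp only [Preadditive.comp_zsmul, Preadditive.zsmul_comp, Category.assoc, NCom.E_c]
  have hc := LArr.htpy_comm f (degC i)
  have hc' := congrArg (fun t => t ≫ y.cod.E (degC i) (degX (i + 1))) hc
  simp only [Preadditive.sub_comp, Preadditive.add_comp, Category.assoc] at hc'
  rcases (by lia : i % 3 = 0 ∨ i % 3 = 1 ∨ i % 3 = 2) with h | h | h
  · rw [ind_zero (i := i) (by lia), ind_one (i := i + 1) (by lia),
      (LArr.htpy f).h_congr _ (a := degC (i + 1)) (a' := degC i + 1) (i' := degC i)
        (by unfold degC; lia) (by unfold degC; lia)]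
    unfold degC degX at *
    simp (disch := omega) only [NCom.E_comp, NCom.E_comp_assoc, Category.assoc] at hc' ⊢
    linear_combination (norm := module) -hc'
  · rw [ind_one (i := i) (by lia), ind_zero (i := i + 1) (by lia),
      (LArr.htpy f).h_congr _ (a := degC (i + 1)) (a' := degC i + 1) (i' := degC i)
        (by unfold degC; lia) (by unfold degC; lia)]
    unfold degC degX at *
    simp (disch := omega) only [NCom.E_comp, NCom.E_comp_assoc, Category.assoc] at hc' ⊢
    linear_combination (norm := module) hc'
  · rw [ind_zero (i := i) (by lia), ind_zero (i := i + 1) (by lia),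
      (LArr.htpy f).h_congr _ (a := degC (i + 1)) (a' := degC i) (i' := degC i - 1)
        (by unfold degC; lia) (by unfold degC; lia)]
    unfold degC degX at *
    simp (disch := omega) only [NCom.E_comp, NCom.E_comp_assoc, NCom.E_self, Category.id_comp,
      Category.assoc]
    module

/-- The filler functor on the lax arrow category. A square `(f₀, f₁, h)` is sent to the chain map
with entries `(f₀, 0; ±h, f₁)` or `(f₀, 0; ±h d, f₁)`. -/
def fillerF (A : Type u) [Category.{v} A] [Preadditive A] [HasFiniteBiproducts A] :
    LArr (NCom A 2) ⥤ NCom A 3 where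
  obj x := fillerObj x
  map {x y} f := NCom.homMk (X := fillerObj x) (Y := fillerObj y) (fillerC f)
    (fun i => fillerD_fillerC f i)
  map_id x := by
    apply NCom.hom_ext
    intro i
    show tri _ ((2 * ind i - 1) • ((0 : _ ⟶ _) ≫ _)) _ = 𝟙 _
    rw [zero_comp, smul_zero]
    exact tri_id
  map_comp {x y z} f g := by
    apply NCom.hom_ext
    intro i
    show fillerC (f ≫ g) i = fillerC f i ≫ fillerC g i
    unfold fillerC
    rw [tri_comp_tri]
    have e : ∀ a b e, (LArr.htpy (f ≫ g)).h a b e =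
      NCom.c f.f₀ a ≫ (LArr.htpy g).h a b e +
        (LArr.htpy f).h a b e ≫ NCom.c g.f₁ b := fun _ _ _ => rfl
    congr 1
    rw [e]
    simp only [Preadditive.comp_zsmul, Preadditive.zsmul_comp, Category.assoc, NCom.E_c,
      Preadditive.add_comp, smul_add]

end Filler

/-! ### The faces of a 3-complex -/

noncomputable section Faces

variable {A : Type u} [Category.{v} A] [Preadditive A]

/-- The degree in a 3-complex of the object in degree `k` of its `i`-th face. -/
def idx (i : Fin 3) (k : ℤ) : ℤ :=
  periodicFun (SimplexCategory.δ i : SimplexCategory.mk 1 ⟶ SimplexCategory.mk 2).toOrderHom k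

theorem idx_zero (k : ℤ) : idx 0 k = k + k / 2 + 1 := by
  obtain ⟨q, r, rfl⟩ := exists_rep 1 k
  have h := periodicFun_eq
    (SimplexCategory.δ (0 : Fin 3) : SimplexCategory.mk 1 ⟶ SimplexCategory.mk 2).toOrderHom q r
  refine h.trans ?_
  fin_cases r
  · have e : (SimplexCategory.δ (0 : Fin 3) :
      SimplexCategory.mk 1 ⟶ SimplexCategory.mk 2).toOrderHom 0 = (1 : Fin 3) := rfl
    simp [e]; lia
  · have e : (SimplexCategory.δ (0 : Fin 3) :
      SimplexCategory.mk 1 ⟶ SimplexCategory.mk 2).toOrderHom 1 = (2 : Fin 3) := rfl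
    simp [e]; lia

theorem idx_one (k : ℤ) : idx 1 k = k + (k + 1) / 2 := by
  obtain ⟨q, r, rfl⟩ := exists_rep 1 k
  have h := periodicFun_eq
    (SimplexCategory.δ (1 : Fin 3) : SimplexCategory.mk 1 ⟶ SimplexCategory.mk 2).toOrderHom q r
  refine h.trans ?_
  fin_cases r
  · have e : (SimplexCategory.δ (1 : Fin 3) :
      SimplexCategory.mk 1 ⟶ SimplexCategory.mk 2).toOrderHom 0 = (0 : Fin 3) := rfl
    simp [e]; lia
  · have e : (SimplexCategory.δ (1 : Fin 3) :
      SimplexCategory.mk 1 ⟶ SimplexCategory.mk 2).toOrderHom 1 = (2 : Fin 3) := rfl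
    simp [e]; lia

theorem idx_two (k : ℤ) : idx 2 k = k + k / 2 := by
  obtain ⟨q, r, rfl⟩ := exists_rep 1 k
  have h := periodicFun_eq
    (SimplexCategory.δ (2 : Fin 3) : SimplexCategory.mk 1 ⟶ SimplexCategory.mk 2).toOrderHom q r
  refine h.trans ?_
  fin_cases r
  · have e : (SimplexCategory.δ (2 : Fin 3) :
      SimplexCategory.mk 1 ⟶ SimplexCategory.mk 2).toOrderHom 0 = (0 : Fin 3) := rfl
    simp [e]; lia
  · have e : (SimplexCategory.δ (2 : Fin 3) :
      SimplexCategory.mk 1 ⟶ SimplexCategory.mk 2).toOrderHom 1 = (1 : Fin 3) := rfl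
    simp [e]; lia

theorem idx_le_idx (i : Fin 3) {a b : ℤ} : idx i a ≤ idx i b ↔ a ≤ b := by
  fin_cases i
  · have h := idx_zero a
    have h' := idx_zero b
    show idx 0 a ≤ idx 0 b ↔ _
    lia
  · have h := idx_one a
    have h' := idx_one b
    show idx 1 a ≤ idx 1 b ↔ _
    lia
  · have h := idx_two a
    have h' := idx_two b
    show idx 2 a ≤ idx 2 b ↔ _
    lia

theorem face_E (Y : NCom A 3) (i : Fin 3) (a b : ℤ) :
    ((face A 1 i).obj Y).E a b = Y.E (idx i a) (idx i b) := by
  by_cases h : a ≤ b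
  · rw [NCom.E_of_le _ h, NCom.E_of_le Y ((idx_le_idx i).2 h)]
    rfl
  · rw [NCom.E_of_lt _ (by lia), NCom.E_of_lt Y (by rw [← not_le, idx_le_idx]; exact h)]
    rfl

theorem faceτ_one_c (Y : NCom A 3) (k : ℤ) :
    NCom.c ((faceτ (A := A) 1 1).app Y) k = Y.E (idx 2 k) (idx 1 k) :=
  (NCom.E_of_le Y (show idx 2 k ≤ idx 1 k by rw [idx_one, idx_two]; lia)).symm

theorem faceτ_zero_c (Y : NCom A 3) (k : ℤ) :
    NCom.c ((faceτ (A := A) 1 0).app Y) k = Y.E (idx 1 k) (idx 0 k) :=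
  (NCom.E_of_le Y (show idx 1 k ≤ idx 0 k by rw [idx_one, idx_zero]; lia)).symm

theorem spine_dom_E (Y : NCom A 3) (a b : ℤ) :
    ((spine A).obj Y).dom.E a b = Y.E (idx 2 a) (idx 2 b) := face_E Y 2 a b

theorem spine_cod_E (Y : NCom A 3) (a b : ℤ) :
    ((spine A).obj Y).cod.E a b = Y.E (idx 1 a) (idx 1 b) := face_E Y 1 a b

theorem spine_arr_c (Y : NCom A 3) (k : ℤ) :
    NCom.c ((spine A).obj Y).arr k = Y.E (idx 2 k) (idx 1 k) := faceτ_one_c Y k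

end Faces

/-! ### Comparison of the triangles of the filler with the cone triangles -/

noncomputable section FillerTriangle

variable {A : Type u} [Category.{v} A] [Preadditive A] [HasFiniteBiproducts A]

attribute [local instance] hasBinaryBiproducts_of_finite_biproducts

theorem ind_idx_one (k : ℤ) : ind (idx 1 k) = 0 := ind_zero (by rw [idx_one]; lia)

/-- The sign `(-1)^k`. -/
def sgn (k : ℤ) : ℤ := if k % 2 = 0 then 1 else -1

theorem sgn_mul_self (k : ℤ) : sgn k * sgn k = 1 := by
  unfold sgn; split_ifs <;> rfl

theorem sgn_succ (k : ℤ) : sgn (k + 1) = -sgn k := by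
  unfold sgn; split_ifs <;> lia

theorem ind_sub_ind_idx_zero (k : ℤ) : ind (idx 0 k) - ind (idx 0 (k + 1)) = sgn k := by
  have h := idx_zero k
  have h' := idx_zero (k + 1)
  unfold ind sgn; split_ifs <;> lia

theorem face_fillerObj_E (x : LArr (NCom A 2)) (i : Fin 3) {a b : ℤ} (h : a ≤ b) :
    ((face A 1 i).obj (fillerObj x)).E a b = fillerD x (idx i a) (idx i b) := by
  rw [face_E, fillerObj_E x ((idx_le_idx i).2 h)]

theorem coneObj_E (x : LArr (NCom A 2)) (k : ℤ) :
    (coneObj x).E k (k + 1) =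
      tri (-x.dom.E (k + 1) (k + 1 + 1)) (NCom.c x.arr (k + 1)) (x.cod.E k (k + 1)) := by
  rw [NCom.E_of_le _ (by lia), coneObj_D, NCom.E_of_le _ (by lia), NCom.E_of_le _ (by lia)]
  rfl

theorem coneObj_E_pred (x : LArr (NCom A 2)) (k : ℤ) :
    (coneObj x).E (k - 1) k =
      tri (-x.dom.E (k - 1 + 1) (k + 1)) (NCom.c x.arr (k - 1 + 1) ≫ x.cod.E (k - 1 + 1) k)
        (x.cod.E (k - 1) k) := by
  obtain ⟨l, rfl⟩ : ∃ l, k = l + 1 := ⟨k - 1, by ring⟩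
  have key : ∀ m : ℤ, m = l → (coneObj x).E m (l + 1) =
      tri (-x.dom.E (m + 1) (l + 1 + 1)) (NCom.c x.arr (m + 1) ≫ x.cod.E (m + 1) (l + 1))
        (x.cod.E m (l + 1)) := by
    rintro m rfl
    rw [coneObj_E, NCom.E_self, Category.comp_id]
  exact key _ (by ring)

variable (x : LArr (NCom A 2))

/-- The component in degree `k` of `toDom`. -/
def toDomC (k : ℤ) : x.dom.ob (degC (idx 2 k)) ⊞ x.cod.ob (degX (idx 2 k)) ⟶ x.dom.ob k :=
  biprod.fst ≫ x.dom.E (degC (idx 2 k)) k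

/-- The projection `(1, 0)` of `d₂` of the filler of `x : C ⟶ X` to `C`. -/
def toDom : (face A 1 2).obj (fillerObj x) ⟶ x.dom :=
  NCom.homOfE (toDomC x) fun k => by
    rw [face_fillerObj_E x 2 (by lia)]
    show fillerD x (idx 2 k) (idx 2 (k + 1)) ≫ toDomC x (k + 1) = toDomC x k ≫ _
    have h := idx_two k
    have h' := idx_two (k + 1)
    unfold fillerD toDomC degC
    rw [tri_fst_assoc]
    simp (disch := omega) only [Category.assoc, NCom.E_comp]

/-- The component in degree `k` of `toCod`. -/
def toCodC (k : ℤ) : x.dom.ob (degC (idx 1 k)) ⊞ x.cod.ob (degX (idx 1 k)) ⟶ x.cod.ob k :=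
  biprod.snd ≫ x.cod.E (degX (idx 1 k)) k

/-- The projection `(0, 1)` of `d₁` of the filler of `x : C ⟶ X` to `X`. -/
def toCod : (face A 1 1).obj (fillerObj x) ⟶ x.cod :=
  NCom.homOfE (toCodC x) fun k => by
    rw [face_fillerObj_E x 1 (by lia)]
    show fillerD x (idx 1 k) (idx 1 (k + 1)) ≫ toCodC x (k + 1) = toCodC x k ≫ _
    have h := idx_one k
    have h' := idx_one (k + 1)
    unfold fillerD toCodC degX
    rw [tri_snd_assoc, ind_idx_one, ind_idx_one, sub_self, zero_smul, zero_comp, comp_zero,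
      zero_add]
    simp (disch := omega) only [Category.assoc, NCom.E_comp]

/-- The component in degree `k` of `toCone`. -/
def toConeC (k : ℤ) : x.dom.ob (degC (idx 0 k)) ⊞ x.cod.ob (degX (idx 0 k)) ⟶
    x.dom.ob (k + 1) ⊞ x.cod.ob k :=
  tri (sgn k • x.dom.E (degC (idx 0 k)) (k + 1)) 0 (x.cod.E (degX (idx 0 k)) k)

/-- The isomorphism `((-1)^k, 0; 0, 1)` of `d₀` of the filler of `x : C ⟶ X` to `Cone x`. -/
def toCone : (face A 1 0).obj (fillerObj x) ⟶ coneObj x :=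
  NCom.homOfE (Y := coneObj x) (toConeC x) fun k => by
    rw [face_fillerObj_E x 0 (by lia), coneObj_E]
    show fillerD x (idx 0 k) (idx 0 (k + 1)) ≫ toConeC x (k + 1) = toConeC x k ≫ tri _ _ _
    have h := idx_zero k
    have h' := idx_zero (k + 1)
    unfold fillerD toConeC
    rw [tri_comp_tri, tri_comp_tri, ind_sub_ind_idx_zero, sgn_succ]
    unfold degC degX
    simp (disch := omega) only [Preadditive.comp_zsmul, Preadditive.zsmul_comp, NCom.E_comp,
      Preadditive.comp_neg, comp_zero, zero_comp, zero_add, add_zero, neg_smul, NCom.E_c,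
      Category.assoc]

/-- The component in degree `k` of `fromCone`. -/
def fromConeC (k : ℤ) : x.dom.ob (k + 1) ⊞ x.cod.ob k ⟶
    x.dom.ob (degC (idx 0 k)) ⊞ x.cod.ob (degX (idx 0 k)) :=
  tri (sgn k • x.dom.E (k + 1) (degC (idx 0 k))) 0 (x.cod.E k (degX (idx 0 k)))

/-- The inverse of `toCone`. -/
def fromCone : coneObj x ⟶ (face A 1 0).obj (fillerObj x) :=
  NCom.homOfE (X := coneObj x) (fromConeC x) fun k => by
    rw [face_fillerObj_E x 0 (by lia), coneObj_E]
    show tri _ _ _ ≫ fromConeC x (k + 1) = fromConeC x k ≫ fillerD x (idx 0 k) (idx 0 (k + 1))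
    have h := idx_zero k
    have h' := idx_zero (k + 1)
    unfold fillerD fromConeC
    rw [tri_comp_tri, tri_comp_tri, ind_sub_ind_idx_zero, sgn_succ]
    unfold degC degX
    simp (disch := omega) only [Preadditive.comp_zsmul, Preadditive.zsmul_comp, NCom.E_comp,
      Preadditive.neg_comp, Preadditive.comp_neg, comp_zero, zero_comp, zero_add, add_zero,
      neg_smul, smul_neg, neg_neg, NCom.E_c_assoc, smul_smul, sgn_mul_self, one_smul]

/-- The component in degree `k` of `fromDom`. -/
def fromDomC (k : ℤ) : x.dom.ob k ⟶ x.dom.ob (degC (idx 2 k)) ⊞ x.cod.ob (degX (idx 2 k)) :=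
  x.dom.E k (degC (idx 2 k)) ≫ biprod.inl +
    NCom.c x.arr k ≫ x.cod.E k (degX (idx 2 k)) ≫ biprod.inr

/-- The inclusion of `C` in `d₂` of the filler of `x : C ⟶ X`: in even degrees `(1; x)`, in odd
degrees `(1; 0)`. -/
def fromDom : x.dom ⟶ (face A 1 2).obj (fillerObj x) :=
  NCom.homOfE (fromDomC x) fun k => by
    rw [face_fillerObj_E x 2 (by lia)]
    show _ ≫ fromDomC x (k + 1) = fromDomC x k ≫ fillerD x (idx 2 k) (idx 2 (k + 1))
    have h := idx_two k
    have h' := idx_two (k + 1)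
    unfold fillerD fromDomC
    rw [Preadditive.add_comp]
    simp only [Category.assoc, inr_tri, inl_tri, Preadditive.comp_add, Preadditive.comp_zsmul,
      Preadditive.zsmul_comp, NCom.E_c_assoc]
    rcases (by lia : k % 2 = 0 ∨ k % 2 = 1) with hk | hk
    · rw [ind_zero (i := idx 2 k) (by lia), ind_one (i := idx 2 (k + 1)) (by lia)]
      unfold degC degX
      simp (disch := omega) only [NCom.E_comp_assoc, NCom.E_of_lt x.cod (i := k + 1)]
      simp
    · rw [ind_one (i := idx 2 k) (by lia), ind_zero (i := idx 2 (k + 1)) (by lia)]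
      unfold degC degX
      simp (disch := omega) only [NCom.E_comp_assoc, NCom.E_of_lt x.cod (i := k)]
      simp

/-- The component in degree `k` of `fromCod`. -/
def fromCodC (k : ℤ) : x.cod.ob k ⟶ x.dom.ob (degC (idx 1 k)) ⊞ x.cod.ob (degX (idx 1 k)) :=
  x.cod.E k (degX (idx 1 k)) ≫ biprod.inr

/-- The inclusion of `X` in `d₁` of the filler of `x : C ⟶ X`. -/
def fromCod : x.cod ⟶ (face A 1 1).obj (fillerObj x) :=
  NCom.homOfE (fromCodC x) fun k => by
    rw [face_fillerObj_E x 1 (by lia)]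
    show _ ≫ fromCodC x (k + 1) = fromCodC x k ≫ fillerD x (idx 1 k) (idx 1 (k + 1))
    have h := idx_one k
    have h' := idx_one (k + 1)
    unfold fillerD fromCodC degX
    rw [Category.assoc, inr_tri]
    simp (disch := omega) only [NCom.E_comp_assoc]

theorem fromDom_toDom : fromDom x ≫ toDom x = 𝟙 x.dom := by
  apply NCom.hom_ext
  intro k
  show fromDomC x k ≫ toDomC x k = 𝟙 _
  have h := idx_two k
  unfold fromDomC toDomC degC
  simp (disch := omega) [NCom.E_comp]

theorem fromCod_toCod : fromCod x ≫ toCod x = 𝟙 x.cod := by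
  apply NCom.hom_ext
  intro k
  show fromCodC x k ≫ toCodC x k = 𝟙 _
  have h := idx_one k
  unfold fromCodC toCodC degX
  simp (disch := omega) [NCom.E_comp]

theorem fromCone_toCone : fromCone x ≫ toCone x = 𝟙 (coneObj x) := by
  apply NCom.hom_ext
  intro k
  show fromConeC x k ≫ toConeC x k = 𝟙 (x.dom.ob (k + 1) ⊞ x.cod.ob k)
  have h := idx_zero k
  unfold fromConeC toConeC
  rw [tri_comp_tri, ← tri_id]
  unfold degC degX
  simp (disch := omega) [NCom.E_comp, smul_smul, sgn_mul_self]

theorem toCone_fromCone : toCone x ≫ fromCone x = 𝟙 ((face A 1 0).obj (fillerObj x)) := by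
  apply NCom.hom_ext
  intro k
  show toConeC x k ≫ fromConeC x k =
    𝟙 (x.dom.ob (degC (idx 0 k)) ⊞ x.cod.ob (degX (idx 0 k)))
  have h := idx_zero k
  unfold fromConeC toConeC
  rw [tri_comp_tri, ← tri_id]
  unfold degC degX
  simp (disch := omega) [NCom.E_comp, smul_smul, sgn_mul_self]

theorem fromCod_faceτ :
    fromCod x ≫ (faceτ (A := A) 1 0).app (fillerObj x) = coneInr x ≫ fromCone x := by
  apply NCom.hom_ext
  intro k
  rw [NCom.c_comp, NCom.c_comp, faceτ_zero_c,
    fillerObj_E x (by rw [idx_one, idx_zero]; lia)]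
  show fromCodC x k ≫ fillerD x (idx 1 k) (idx 0 k) = biprod.inr ≫ fromConeC x k
  have h := idx_zero k
  have h' := idx_one k
  unfold fromCodC fillerD fromConeC degC degX
  rw [Category.assoc, inr_tri, inr_tri]
  simp (disch := omega) only [NCom.E_comp_assoc]

variable {x} {y : LArr (NCom A 2)} (f : x ⟶ y)

theorem toDom_naturality :
    (face A 1 2).map ((fillerF A).map f) ≫ toDom y = toDom x ≫ f.f₀ := by
  apply NCom.hom_ext
  intro k
  show fillerC f (idx 2 k) ≫ toDomC y k = toDomC x k ≫ NCom.c f.f₀ k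
  unfold fillerC toDomC
  rw [tri_fst_assoc, Category.assoc, NCom.E_c]

theorem fromCod_naturality :
    f.f₁ ≫ fromCod y = fromCod x ≫ (face A 1 1).map ((fillerF A).map f) := by
  apply NCom.hom_ext
  intro k
  show NCom.c f.f₁ k ≫ fromCodC y k = fromCodC x k ≫ fillerC f (idx 1 k)
  unfold fillerC fromCodC
  rw [Category.assoc, inr_tri, NCom.E_c_assoc]

theorem toCone_naturality :
    (face A 1 0).map ((fillerF A).map f) ≫ toCone y = toCone x ≫ (coneF A).map f := by
  apply NCom.hom_ext
  intro k
  show fillerC f (idx 0 k) ≫ toConeC y k = toConeC x k ≫ tri (NCom.c f.f₀ (k + 1))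
    ((LArr.htpy f).h (k + 1) k (by push_cast; ring)) (NCom.c f.f₁ k)
  have h := idx_zero k
  have hs : 2 * ind (idx 0 k) - 1 = sgn k := by
    unfold ind sgn; split_ifs <;> lia
  unfold fillerC toConeC
  rw [tri_comp_tri, tri_comp_tri, hs,
    (LArr.htpy f).h_congr _ (a := k + 1) (a' := degC (idx 0 k)) (i' := degC (idx 0 k) - 1)
      (by unfold degC; lia) (by unfold degC; lia)]
  unfold degC degX
  simp (disch := omega) only [Preadditive.comp_zsmul, Preadditive.zsmul_comp, NCom.E_comp,
      comp_zero, zero_comp, zero_add, add_zero, NCom.E_c, Category.assoc,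
      NCom.E_comp_assoc, NCom.E_self, Category.id_comp]

variable (A) in
/-- The isomorphism between `d₀` of the filler and the mapping cone. -/
def fillerConeIso : fillerF A ⋙ face A 1 0 ≅ coneF A :=
  NatIso.ofComponents (fun x => ⟨toCone x, fromCone x, toCone_fromCone x, fromCone_toCone x⟩)
    (fun f => toCone_naturality f)

theorem fromCone_naturality :
    (coneF A).map f ≫ fromCone y = fromCone x ≫ (face A 1 0).map ((fillerF A).map f) :=
  (fillerConeIso A).inv.naturality f

end FillerTriangle

/-! ### Homotopies between the triangles of the filler and the cone triangles -/

noncomputable section FillerHomotopies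

variable {A : Type u} [Category.{v} A] [Preadditive A] [HasFiniteBiproducts A]

attribute [local instance] hasBinaryBiproducts_of_finite_biproducts

variable (x : LArr (NCom A 2))

/-- The homotopy filling the first square of the morphism from the triangle of the filler to the
cone triangle. -/
def toHatA : NCom.PreHtpy ((face A 1 2).obj (fillerObj x)) x.cod :=
  ⟨fun a i _ => (biprod.snd ≫ x.cod.E (degX (idx 2 a)) i :
    x.dom.ob (degC (idx 2 a)) ⊞ x.cod.ob (degX (idx 2 a)) ⟶ x.cod.ob i)⟩

theorem isHtpy_toHatA : NCom.IsHtpy (toDom x ≫ x.arr)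
    ((faceτ (A := A) 1 1).app (fillerObj x) ≫ toCod x) (toHatA x) := by
  have key : ∀ k : ℤ,
      fillerD x (idx 2 k) (idx 1 k) ≫ toCodC x k - toDomC x k ≫ NCom.c x.arr k =
      fillerD x (idx 2 k) (idx 2 (k + 1)) ≫ biprod.snd ≫ x.cod.E (degX (idx 2 (k + 1))) k +
        (biprod.snd ≫ x.cod.E (degX (idx 2 k)) (k - 1)) ≫ x.cod.E (k - 1) k := by
    intro k
    have h := idx_two k
    have h' := idx_two (k + 1)
    have h'' := idx_one k
    unfold fillerD toCodC toDomC
    rw [tri_snd_assoc, tri_snd_assoc, ind_idx_one]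
    simp only [Category.assoc, NCom.E_c, Preadditive.zsmul_comp]
    rcases (by lia : k % 2 = 0 ∨ k % 2 = 1) with hk | hk
    · rw [ind_zero (i := idx 2 k) (by lia), ind_one (i := idx 2 (k + 1)) (by lia)]
      unfold degC degX
      simp (disch := omega) only [NCom.E_comp, NCom.E_of_lt x.cod (j := k - 1)]
      simp
      abel
    · rw [ind_one (i := idx 2 k) (by lia), ind_zero (i := idx 2 (k + 1)) (by lia)]
      unfold degC degX
      simp (disch := omega) only [NCom.E_comp, NCom.E_of_lt x.cod (j := k)]
      simp
  exact NCom.isHtpy_two_of (fun k => fillerD x (idx 2 k) (idx 2 (k + 1)))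
    (fun k => x.cod.E (k - 1) k)
    (fun k => face_fillerObj_E x 2 (by lia)) (fun k => rfl) key

/-- The homotopy filling the second square of the morphism from the triangle of the filler to the
cone triangle. -/
def toHatB : NCom.PreHtpy ((face A 1 1).obj (fillerObj x)) (coneObj x) :=
  ⟨fun a i _ => (tri (-x.dom.E (degC (idx 1 a)) (i + 1)) 0 0 :
    x.dom.ob (degC (idx 1 a)) ⊞ x.cod.ob (degX (idx 1 a)) ⟶ x.dom.ob (i + 1) ⊞ x.cod.ob i)⟩

theorem isHtpy_toHatB : NCom.IsHtpy (toCod x ≫ coneInr x)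
    ((faceτ (A := A) 1 0).app (fillerObj x) ≫ toCone x) (toHatB x) := by
  have key : ∀ k : ℤ,
      fillerD x (idx 1 k) (idx 0 k) ≫ toConeC x k - toCodC x k ≫ biprod.inr =
      fillerD x (idx 1 k) (idx 1 (k + 1)) ≫ tri (-x.dom.E (degC (idx 1 (k + 1))) (k + 1)) 0 0 +
        tri (-x.dom.E (degC (idx 1 k)) (k - 1 + 1)) 0 (0 : _ ⟶ x.cod.ob (k - 1)) ≫
          tri (-x.dom.E (k - 1 + 1) (k + 1))
            (NCom.c x.arr (k - 1 + 1) ≫ x.cod.E (k - 1 + 1) k) (x.cod.E (k - 1) k) := by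
    intro k
    have h := idx_one k
    have h' := idx_one (k + 1)
    have h'' := idx_zero k
    have e : toCodC x k ≫ biprod.inr (X := x.dom.ob (k + 1)) =
        tri 0 0 (x.cod.E (degX (idx 1 k)) k) := by
      unfold toCodC tri
      apply biprod.hom_ext <;> simp
    rw [e]
    unfold fillerD toConeC
    rw [tri_comp_tri, tri_comp_tri, tri_comp_tri, tri_sub, tri_add, ind_idx_one]
    simp only [Category.assoc, Preadditive.zsmul_comp, Preadditive.comp_zsmul,
      Preadditive.neg_comp, Preadditive.comp_neg, NCom.E_c_assoc]
    rcases (by lia : k % 2 = 0 ∨ k % 2 = 1) with hk | hk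
    · rw [ind_one (i := idx 0 k) (by lia), show sgn k = 1 from if_pos hk]
      unfold degC degX
      simp (disch := omega) only [NCom.E_comp, NCom.E_of_lt x.dom (j := k + 1)]
      simp
    · rw [ind_zero (i := idx 0 k) (by lia), show sgn k = -1 from if_neg (by lia)]
      unfold degC degX
      simp (disch := omega) only [NCom.E_comp, NCom.E_of_lt x.dom (j := k - 1 + 1),
        NCom.E_of_lt x.cod (j := k - 1 + 1)]
      simp
  exact NCom.isHtpy_two_of (fun k => fillerD x (idx 1 k) (idx 1 (k + 1)))
    (fun k => _)
    (fun k => face_fillerObj_E x 1 (by lia)) (fun k => coneObj_E_pred x k) key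

/-- The homotopy filling the first square of the morphism from the cone triangle to the triangle
of the filler. -/
def fromHatA : NCom.PreHtpy x.dom ((face A 1 1).obj (fillerObj x)) :=
  ⟨fun a i _ => (-(x.dom.E a (degC (idx 1 i)) ≫ biprod.inl) :
    x.dom.ob a ⟶ x.dom.ob (degC (idx 1 i)) ⊞ x.cod.ob (degX (idx 1 i)))⟩

theorem isHtpy_fromHatA : NCom.IsHtpy (fromDom x ≫ (faceτ (A := A) 1 1).app (fillerObj x))
    (x.arr ≫ fromCod x) (fromHatA x) := by
  have key : ∀ k : ℤ,
      NCom.c x.arr k ≫ fromCodC x k - fromDomC x k ≫ fillerD x (idx 2 k) (idx 1 k) =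
      x.dom.E k (k + 1) ≫ (-(x.dom.E (k + 1) (degC (idx 1 k)) ≫ biprod.inl)) +
        (-(x.dom.E k (degC (idx 1 (k - 1))) ≫ biprod.inl)) ≫
          fillerD x (idx 1 (k - 1)) (idx 1 k) := by
    intro k
    have h := idx_one k
    have h' := idx_one (k - 1)
    have h'' := idx_two k
    unfold fillerD fromCodC fromDomC
    rw [Preadditive.add_comp, ind_idx_one, ind_idx_one]
    simp only [Category.assoc, inr_tri, inl_tri, Preadditive.comp_add, Preadditive.comp_zsmul,
        Preadditive.zsmul_comp, Preadditive.neg_comp, Preadditive.comp_neg, NCom.E_c_assoc]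
    rcases (by lia : k % 2 = 0 ∨ k % 2 = 1) with hk | hk
    · rw [ind_zero (i := idx 2 k) (by lia)]
      unfold degC degX
      simp (disch := omega) only [NCom.E_comp_assoc, NCom.E_of_lt x.dom (i := k + 1)]
      simp
    · rw [ind_one (i := idx 2 k) (by lia)]
      unfold degC degX
      simp (disch := omega) only [NCom.E_comp_assoc, NCom.E_of_lt x.dom (i := k),
        NCom.E_of_lt x.cod (i := k)]
      simp
  exact NCom.isHtpy_two_of (fun k => x.dom.E k (k + 1))
    (fun k => fillerD x (idx 1 (k - 1)) (idx 1 k))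
    (fun k => rfl) (fun k => face_fillerObj_E x 1 (by lia)) key

/-- The homotopy from the composite `(1; x) (1, 0)` to the identity of `d₂` of the filler. -/
def htpyDom : NCom.PreHtpy ((face A 1 2).obj (fillerObj x)) ((face A 1 2).obj (fillerObj x)) :=
  ⟨fun a i _ => (tri 0 0 (x.cod.E (degX (idx 2 a)) (degX (idx 2 i))) :
    x.dom.ob (degC (idx 2 a)) ⊞ x.cod.ob (degX (idx 2 a)) ⟶
      x.dom.ob (degC (idx 2 i)) ⊞ x.cod.ob (degX (idx 2 i)))⟩

theorem isHtpy_htpyDom : NCom.IsHtpy (toDom x ≫ fromDom x) (𝟙 _) (htpyDom x) := by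
  have key : ∀ k : ℤ,
      𝟙 (x.dom.ob (degC (idx 2 k)) ⊞ x.cod.ob (degX (idx 2 k))) - toDomC x k ≫ fromDomC x k =
      fillerD x (idx 2 k) (idx 2 (k + 1)) ≫
          tri 0 0 (x.cod.E (degX (idx 2 (k + 1))) (degX (idx 2 k))) +
        tri 0 0 (x.cod.E (degX (idx 2 k)) (degX (idx 2 (k - 1)))) ≫
          fillerD x (idx 2 (k - 1)) (idx 2 k) := by
    intro k
    have h := idx_two k
    have h' := idx_two (k - 1)
    have h'' := idx_two (k + 1)
    have e : toDomC x k ≫ fromDomC x k =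
        tri (x.dom.E (degC (idx 2 k)) k ≫ x.dom.E k (degC (idx 2 k)))
          (x.dom.E (degC (idx 2 k)) k ≫ NCom.c x.arr k ≫ x.cod.E k (degX (idx 2 k))) 0 := by
      unfold toDomC fromDomC tri
      apply biprod.hom_ext <;> simp
    rw [e, ← tri_id]
    unfold fillerD
    rw [tri_comp_tri, tri_comp_tri, tri_sub, tri_add]
    simp only [Category.assoc, Preadditive.zsmul_comp, NCom.E_c_assoc]
    rcases (by lia : k % 2 = 0 ∨ k % 2 = 1) with hk | hk
    · rw [ind_zero (i := idx 2 k) (by lia), ind_one (i := idx 2 (k + 1)) (by lia)]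
      unfold degC degX
      simp (disch := omega) only [NCom.E_comp, NCom.E_of_lt x.cod (i := idx 2 k - (idx 2 k + 2) / 3)
        (j := idx 2 (k - 1) - (idx 2 (k - 1) + 2) / 3)]
      simp
    · rw [ind_one (i := idx 2 k) (by lia), ind_zero (i := idx 2 (k + 1)) (by lia)]
      unfold degC degX
      simp (disch := omega) only [NCom.E_comp, NCom.E_of_lt x.cod (i := k), NCom.E_of_lt x.cod
        (i := idx 2 (k + 1) - (idx 2 (k + 1) + 2) / 3) (j := idx 2 k - (idx 2 k + 2) / 3)]
      simp
  exact NCom.isHtpy_two_of (fun k => fillerD x (idx 2 k) (idx 2 (k + 1)))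
    (fun k => fillerD x (idx 2 (k - 1)) (idx 2 k))
    (fun k => face_fillerObj_E x 2 (by lia)) (fun k => face_fillerObj_E x 2 (by lia)) key

/-- The homotopy from the composite `(0; 1) (0, 1)` to the identity of `d₁` of the filler. -/
def htpyCod : NCom.PreHtpy ((face A 1 1).obj (fillerObj x)) ((face A 1 1).obj (fillerObj x)) :=
  ⟨fun a i _ => (tri (x.dom.E (degC (idx 1 a)) (degC (idx 1 i))) 0 0 :
    x.dom.ob (degC (idx 1 a)) ⊞ x.cod.ob (degX (idx 1 a)) ⟶
      x.dom.ob (degC (idx 1 i)) ⊞ x.cod.ob (degX (idx 1 i)))⟩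

theorem isHtpy_htpyCod : NCom.IsHtpy (toCod x ≫ fromCod x) (𝟙 _) (htpyCod x) := by
  have key : ∀ k : ℤ,
      𝟙 (x.dom.ob (degC (idx 1 k)) ⊞ x.cod.ob (degX (idx 1 k))) - toCodC x k ≫ fromCodC x k =
      fillerD x (idx 1 k) (idx 1 (k + 1)) ≫
          tri (x.dom.E (degC (idx 1 (k + 1))) (degC (idx 1 k))) 0 0 +
        tri (x.dom.E (degC (idx 1 k)) (degC (idx 1 (k - 1)))) 0 0 ≫
          fillerD x (idx 1 (k - 1)) (idx 1 k) := by
    intro k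
    have h := idx_one k
    have h' := idx_one (k - 1)
    have h'' := idx_one (k + 1)
    have e : toCodC x k ≫ fromCodC x k =
        tri 0 0 (x.cod.E (degX (idx 1 k)) k ≫ x.cod.E k (degX (idx 1 k))) := by
      unfold toCodC fromCodC tri
      apply biprod.hom_ext <;> simp
    rw [e, ← tri_id]
    unfold fillerD
    rw [tri_comp_tri, tri_comp_tri, tri_sub, tri_add, ind_idx_one, ind_idx_one, ind_idx_one]
    rcases (by lia : k % 2 = 0 ∨ k % 2 = 1) with hk | hk
    · unfold degC degX
      simp (disch := omega) only [NCom.E_comp, NCom.E_of_lt x.dom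
        (i := idx 1 (k + 1) - idx 1 (k + 1) / 3) (j := idx 1 k - idx 1 k / 3)]
      simp
    · unfold degC degX
      simp (disch := omega) only [NCom.E_comp, NCom.E_of_lt x.dom
        (i := idx 1 k - idx 1 k / 3) (j := idx 1 (k - 1) - idx 1 (k - 1) / 3)]
      simp
  exact NCom.isHtpy_two_of (fun k => fillerD x (idx 1 k) (idx 1 (k + 1)))
    (fun k => fillerD x (idx 1 (k - 1)) (idx 1 k))
    (fun k => face_fillerObj_E x 1 (by lia)) (fun k => face_fillerObj_E x 1 (by lia)) key

variable {x} {y : LArr (NCom A 2)} (f : x ⟶ y)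

/-- The homotopy that makes `toCod` lax natural. -/
def toCodCell : NCom.PreHtpy ((face A 1 1).obj (fillerObj x)) y.cod :=
  ⟨fun a i e => (biprod.fst ≫ x.dom.E (degC (idx 1 a)) a ≫ (LArr.htpy f).h a i e :
    x.dom.ob (degC (idx 1 a)) ⊞ x.cod.ob (degX (idx 1 a)) ⟶ y.cod.ob i)⟩

theorem isHtpy_toCodCell :
    NCom.IsHtpy ((face A 1 1).map ((fillerF A).map f) ≫ toCod y) (toCod x ≫ f.f₁)
      (toCodCell f) := by
  have key : ∀ k : ℤ,
      toCodC x k ≫ NCom.c f.f₁ k - fillerC f (idx 1 k) ≫ toCodC y k =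
      fillerD x (idx 1 k) (idx 1 (k + 1)) ≫ biprod.fst ≫
          x.dom.E (degC (idx 1 (k + 1))) (k + 1) ≫ (LArr.htpy f).h (k + 1) k (by push_cast; ring) +
        (biprod.fst ≫ x.dom.E (degC (idx 1 k)) k ≫ (LArr.htpy f).h k (k - 1) (by push_cast; ring)) ≫
          y.cod.E (k - 1) k := by
    intro k
    have h := idx_one k
    have h' := idx_one (k + 1)
    unfold fillerD toCodC fillerC
    rw [tri_snd_assoc, tri_fst_assoc, ind_idx_one]
    simp only [Category.assoc, NCom.E_c, Preadditive.zsmul_comp]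
    rcases (by lia : k % 2 = 0 ∨ k % 2 = 1) with hk | hk
    · rw [(LArr.htpy f).h_congr _ (a := k) (a' := degC (idx 1 k)) (i' := degC (idx 1 k) - 1)
        (by unfold degC; lia) (by unfold degC; lia)]
      unfold degC degX
      simp (disch := omega) only [Category.assoc, NCom.E_comp, NCom.E_comp_assoc,
        NCom.E_of_lt x.dom (j := k + 1), NCom.E_self, Category.id_comp]
      simp
    · rw [(LArr.htpy f).h_congr _ (a := k + 1) (a' := degC (idx 1 k)) (i' := degC (idx 1 k) - 1)
        (by unfold degC; lia) (by unfold degC; lia)]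
      unfold degC degX
      simp (disch := omega) only [NCom.E_comp, NCom.E_comp_assoc,
        NCom.E_of_lt x.dom (j := k), NCom.E_self, Category.id_comp]
      simp
  exact NCom.isHtpy_two_of (fun k => fillerD x (idx 1 k) (idx 1 (k + 1)))
    (fun k => y.cod.E (k - 1) k)
    (fun k => face_fillerObj_E x 1 (by lia)) (fun k => rfl) key

/-- The homotopy that makes `fromDom` lax natural. -/
def fromDomCell : NCom.PreHtpy x.dom ((face A 1 2).obj (fillerObj y)) :=
  ⟨fun a i e => ((LArr.htpy f).h a i e ≫ y.cod.E i (degX (idx 2 i)) ≫ biprod.inr :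
    x.dom.ob a ⟶ y.dom.ob (degC (idx 2 i)) ⊞ y.cod.ob (degX (idx 2 i)))⟩

theorem isHtpy_fromDomCell :
    NCom.IsHtpy (f.f₀ ≫ fromDom y) (fromDom x ≫ (face A 1 2).map ((fillerF A).map f))
      (fromDomCell f) := by
  have key : ∀ k : ℤ,
      fromDomC x k ≫ fillerC f (idx 2 k) - NCom.c f.f₀ k ≫ fromDomC y k =
      x.dom.E k (k + 1) ≫ (LArr.htpy f).h (k + 1) k (by push_cast; ring) ≫
          y.cod.E k (degX (idx 2 k)) ≫ biprod.inr +
        ((LArr.htpy f).h k (k - 1) (by push_cast; ring) ≫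
          y.cod.E (k - 1) (degX (idx 2 (k - 1))) ≫ biprod.inr) ≫
            fillerD y (idx 2 (k - 1)) (idx 2 k) := by
    intro k
    have h := idx_two k
    have h' := idx_two (k - 1)
    have hc := LArr.htpy_comm f k
    have hc' := congrArg (fun t => t ≫ y.cod.E k (degX (idx 2 k)) ≫
      biprod.inr (X := y.dom.ob (degC (idx 2 k)))) hc
    simp only [Preadditive.sub_comp, Preadditive.add_comp, Category.assoc] at hc'
    unfold fillerD fromDomC fillerC
    rw [Preadditive.add_comp]
    simp only [Category.assoc, inr_tri, inl_tri, Preadditive.comp_add, Preadditive.comp_zsmul,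
        Preadditive.zsmul_comp, NCom.E_c_assoc]
    rw [(LArr.htpy f).h_congr _ (a := degC (idx 2 k)) (a' := k) (i' := k - 1)
        (by unfold degC; lia) (by unfold degC; lia)]
    rcases (by lia : k % 2 = 0 ∨ k % 2 = 1) with hk | hk
    · rw [ind_zero (i := idx 2 k) (by lia)]
      unfold degC degX at *
      simp (disch := omega) only [Category.assoc, NCom.E_comp_assoc, NCom.E_self,
        Category.id_comp, NCom.E_of_lt y.cod (i := k - 1)
          (j := idx 2 (k - 1) - (idx 2 (k - 1) + 2) / 3), zero_comp, comp_zero] at hc' ⊢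
      linear_combination (norm := module) hc'
    · rw [ind_one (i := idx 2 k) (by lia)]
      unfold degC degX at *
      simp (disch := omega) only [Category.assoc, NCom.E_comp_assoc,
        NCom.E_of_lt y.cod (i := k), NCom.E_self, Category.id_comp]
      simp
  exact NCom.isHtpy_two_of (fun k => x.dom.E k (k + 1))
    (fun k => fillerD y (idx 2 (k - 1)) (idx 2 k))
    (fun k => rfl) (fun k => face_fillerObj_E y 2 (by lia)) key

end FillerHomotopies

/-! ### The equivalence of the triangles of the filler and the cone triangles -/

noncomputable section FillerEquivalence

variable {A : Type u} [Category.{v} A] [Preadditive A] [HasFiniteBiproducts A]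

attribute [local instance] hasBinaryBiproducts_of_finite_biproducts

theorem isTwo_zero_of_eq {C : Type u} [Category.{v} C] [TwoCells C] {X Y : C} {f g : X ⟶ Y}
    (h : f = g) : IsTwo f g (0 : Cell X Y) := by
  rw [h]
  exact isTwo_zero _

section

variable {x y : LArr (NCom A 2)} (f : x ⟶ y) (a i : ℤ) (e : a + 1 = i + (2 : ℕ))

theorem toHatA_naturality :
    toDomC x a ≫ (LArr.htpy f).h a i e +
        (biprod.snd ≫ x.cod.E (degX (idx 2 a)) i) ≫ NCom.c f.f₁ i =
      fillerC f (idx 2 a) ≫ biprod.snd ≫ y.cod.E (degX (idx 2 a)) i +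
        fillerD x (idx 2 a) (idx 1 a) ≫
          biprod.fst ≫ x.dom.E (degC (idx 1 a)) a ≫ (LArr.htpy f).h a i e := by
  have h := idx_two a
  have h' := idx_one a
  unfold toDomC fillerC fillerD
  rw [tri_snd_assoc, tri_fst_assoc,
    (LArr.htpy f).h_congr _ (a := degC (idx 2 a)) (a' := a) (i' := i)
      (by unfold degC; lia) (by unfold degC; push_cast at e; lia)]
  simp only [Category.assoc, NCom.E_c, Preadditive.zsmul_comp]
  rcases (by lia : a % 2 = 0 ∨ a % 2 = 1) with hk | hk
  · rw [ind_zero (i := idx 2 a) (by lia)]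
    unfold degC degX
    simp (disch := omega) only [NCom.E_comp_assoc, NCom.E_of_lt y.cod (j := i)]
    simp
  · rw [ind_one (i := idx 2 a) (by lia)]
    unfold degC degX
    simp (disch := omega) only [NCom.E_comp, NCom.E_of_lt x.dom (j := a)]
    simp

theorem toHatB_naturality :
    (biprod.fst ≫ x.dom.E (degC (idx 1 a)) a ≫ (LArr.htpy f).h a i e) ≫ biprod.inr +
        tri (-x.dom.E (degC (idx 1 a)) (i + 1)) 0 (0 : _ ⟶ x.cod.ob i) ≫
          tri (NCom.c f.f₀ (i + 1)) ((LArr.htpy f).h (i + 1) i (by push_cast; ring))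
            (NCom.c f.f₁ i) =
      fillerC f (idx 1 a) ≫ tri (-y.dom.E (degC (idx 1 a)) (i + 1)) 0 (0 : _ ⟶ y.cod.ob i) := by
  obtain rfl : a = i + 1 := by push_cast at e; lia
  unfold fillerC
  rw [tri_comp_tri, tri_comp_tri]
  unfold tri
  apply biprod.hom_ext <;> simp [NCom.E_c]

theorem fromHatA_naturality :
    ((LArr.htpy f).h a i e ≫ y.cod.E i (degX (idx 2 i)) ≫ biprod.inr) ≫
          fillerD y (idx 2 i) (idx 1 i) +
        (-(x.dom.E a (degC (idx 1 i)) ≫ biprod.inl)) ≫ fillerC f (idx 1 i) =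
      NCom.c f.f₀ a ≫ (-(y.dom.E a (degC (idx 1 i)) ≫ biprod.inl)) +
        (LArr.htpy f).h a i e ≫ fromCodC y i := by
  have h := idx_two i
  have h' := idx_one i
  push_cast at e
  unfold fromCodC fillerC fillerD
  rw [ind_idx_one]
  simp only [Category.assoc, inr_tri, inl_tri, Preadditive.comp_add, Preadditive.comp_zsmul,
      Preadditive.zsmul_comp, Preadditive.neg_comp, Preadditive.comp_neg, NCom.E_c_assoc]
  rcases (by lia : i % 2 = 0 ∨ i % 2 = 1) with hk | hk
  · unfold degC degX
    simp (disch := omega) only [NCom.E_comp_assoc, NCom.E_of_lt x.dom (i := a),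
      NCom.E_of_lt y.dom (i := a)]
    simp
  · rw [(LArr.htpy f).h_congr _ (a := degC (idx 1 i)) (a' := a) (i' := i)
      (by unfold degC; lia) (by unfold degC; lia)]
    unfold degC degX
    simp (disch := omega) only [Category.assoc, NCom.E_comp_assoc, NCom.E_self,
      Category.id_comp, NCom.E_of_lt y.cod (j := idx 2 i - (idx 2 i + 2) / 3)]
    simp
    abel

theorem toCodCell_comp {z : LArr (NCom A 2)} (g : y ⟶ z) :
    biprod.fst ≫ x.dom.E (degC (idx 1 a)) a ≫ (LArr.htpy (f ≫ g)).h a i e =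
      fillerC f (idx 1 a) ≫ biprod.fst ≫ y.dom.E (degC (idx 1 a)) a ≫ (LArr.htpy g).h a i e +
        (biprod.fst ≫ x.dom.E (degC (idx 1 a)) a ≫ (LArr.htpy f).h a i e) ≫ NCom.c g.f₁ i := by
  have e : (LArr.htpy (f ≫ g)).h a i e =
      NCom.c f.f₀ a ≫ (LArr.htpy g).h a i e + (LArr.htpy f).h a i e ≫ NCom.c g.f₁ i := rfl
  rw [e]
  unfold fillerC
  rw [tri_fst_assoc]
  simp only [Category.assoc, Preadditive.comp_add, NCom.E_c_assoc]

theorem fromDomCell_comp {z : LArr (NCom A 2)} (g : y ⟶ z) :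
    (LArr.htpy (f ≫ g)).h a i e ≫ z.cod.E i (degX (idx 2 i)) ≫
        biprod.inr (X := z.dom.ob (degC (idx 2 i))) =
      NCom.c f.f₀ a ≫ (LArr.htpy g).h a i e ≫ z.cod.E i (degX (idx 2 i)) ≫ biprod.inr +
        ((LArr.htpy f).h a i e ≫ y.cod.E i (degX (idx 2 i)) ≫ biprod.inr) ≫
          fillerC g (idx 2 i) := by
  have e : (LArr.htpy (f ≫ g)).h a i e =
      NCom.c f.f₀ a ≫ (LArr.htpy g).h a i e + (LArr.htpy f).h a i e ≫ NCom.c g.f₁ i := rfl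
  rw [e]
  unfold fillerC
  simp only [Category.assoc, inr_tri, Preadditive.add_comp, NCom.E_c_assoc]

variable (x) in
theorem htpyDom_faceτ (e : a + 1 = i + (2 : ℕ)) :
    tri 0 0 (x.cod.E (degX (idx 2 a)) (degX (idx 2 i))) ≫ fillerD x (idx 2 i) (idx 1 i) =
      toDomC x a ≫ (-(x.dom.E a (degC (idx 1 i)) ≫ biprod.inl)) +
        (biprod.snd ≫ x.cod.E (degX (idx 2 a)) i) ≫ fromCodC x i +
        fillerD x (idx 2 a) (idx 1 a) ≫ tri (x.dom.E (degC (idx 1 a)) (degC (idx 1 i))) 0 0 := by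
  have h₁ := idx_one a
  have h₂ := idx_two a
  have h₃ := idx_one i
  have h₄ := idx_two i
  push_cast at e
  have e₁ : x.dom.E (degC (idx 2 a)) a ≫ x.dom.E a (degC (idx 1 i)) =
      x.dom.E (degC (idx 2 a)) (degC (idx 1 a)) ≫ x.dom.E (degC (idx 1 a)) (degC (idx 1 i)) := by
    unfold degC
    rcases (by lia : a % 2 = 0 ∨ a % 2 = 1) with hk | hk
    · simp (disch := omega) only [NCom.E_comp]
    · rw [NCom.E_of_lt x.dom (i := a) (by lia),
        NCom.E_of_lt x.dom (i := idx 1 a - idx 1 a / 3) (by lia), comp_zero, comp_zero]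
  have e₂ : x.cod.E (degX (idx 2 a)) (degX (idx 2 i)) ≫ x.cod.E (degX (idx 2 i)) (degX (idx 1 i)) =
      x.cod.E (degX (idx 2 a)) i ≫ x.cod.E i (degX (idx 1 i)) := by
    unfold degX
    rcases (by lia : a % 2 = 0 ∨ a % 2 = 1) with hk | hk
    · rw [NCom.E_of_lt x.cod (j := i) (by lia),
        NCom.E_of_lt x.cod (i := idx 2 a - (idx 2 a + 2) / 3) (by lia), zero_comp, zero_comp]
    · simp (disch := omega) only [NCom.E_comp]
  unfold fillerD toDomC fromCodC
  rw [tri_comp_tri, tri_comp_tri, e₂, ← e₁]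
  unfold tri
  apply biprod.hom_ext <;> simp

variable (x) in
theorem htpyCod_faceτ (e : a + 1 = i + (2 : ℕ)) :
    tri (x.dom.E (degC (idx 1 a)) (degC (idx 1 i))) 0 (0 : x.cod.ob (degX (idx 1 a)) ⟶ _) ≫
        fillerD x (idx 1 i) (idx 0 i) =
      tri (-x.dom.E (degC (idx 1 a)) (i + 1)) 0 0 ≫ fromConeC x i := by
  have h₁ := idx_one a
  have h₂ := idx_zero i
  have h₃ := idx_one i
  push_cast at e
  unfold fillerD fromConeC
  rw [tri_comp_tri, tri_comp_tri, ind_idx_one]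
  rcases (by lia : i % 2 = 0 ∨ i % 2 = 1) with hk | hk
  · unfold degC
    rw [NCom.E_of_lt x.dom (i := idx 1 a - idx 1 a / 3) (j := i + 1) (by lia),
      NCom.E_of_lt x.dom (i := idx 1 a - idx 1 a / 3) (j := idx 1 i - idx 1 i / 3) (by lia)]
    simp
  · rw [ind_zero (i := idx 0 i) (by lia), show sgn i = -1 from if_neg (by lia)]
    unfold degC
    simp (disch := omega) only [NCom.E_comp, Preadditive.comp_zsmul, Preadditive.neg_comp]
    simp

variable (x) in
theorem fromDom_toHatA (e : a + 1 = i + (2 : ℕ)) :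
    fromDomC x a ≫ biprod.snd ≫ x.cod.E (degX (idx 2 a)) i +
      (-(x.dom.E a (degC (idx 1 i)) ≫ biprod.inl)) ≫ toCodC x i = 0 := by
  have h₁ := idx_two a
  push_cast at e
  have e₁ : x.cod.E a (degX (idx 2 a)) ≫ x.cod.E (degX (idx 2 a)) i = 0 := by
    unfold degX
    rcases (by lia : a % 2 = 0 ∨ a % 2 = 1) with hk | hk
    · rw [NCom.E_of_lt x.cod (j := i) (by lia), comp_zero]
    · rw [NCom.E_of_lt x.cod (i := a) (by lia), zero_comp]
  unfold fromDomC toCodC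
  simp [e₁]

variable (x) in
theorem fromCod_toHatB :
    fromCodC x a ≫ tri (-x.dom.E (degC (idx 1 a)) (i + 1)) 0 (0 : _ ⟶ x.cod.ob i) = 0 := by
  unfold fromCodC
  rw [Category.assoc, inr_tri, zero_comp, comp_zero]

theorem htpyDom_naturality (e : a + 1 = i + (2 : ℕ)) :
    toDomC x a ≫ (LArr.htpy f).h a i e ≫ y.cod.E i (degX (idx 2 i)) ≫ biprod.inr +
        tri 0 0 (x.cod.E (degX (idx 2 a)) (degX (idx 2 i))) ≫ fillerC f (idx 2 i) =
      fillerC f (idx 2 a) ≫ tri 0 (0 : _ ⟶ y.cod.ob (degX (idx 2 i)))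
        (y.cod.E (degX (idx 2 a)) (degX (idx 2 i))) := by
  have h₂ := idx_two a
  have h₄ := idx_two i
  push_cast at e
  have e₁ : x.dom.E (degC (idx 2 a)) a ≫ (LArr.htpy f).h a i e ≫ y.cod.E i (degX (idx 2 i)) =
      ((2 * ind (idx 2 a) - 1) • ((LArr.htpy f).h (degC (idx 2 a)) (degC (idx 2 a) - 1)
        (by push_cast; ring) ≫ y.cod.E (degC (idx 2 a) - 1) (degX (idx 2 a)))) ≫
        y.cod.E (degX (idx 2 a)) (degX (idx 2 i)) := by
    rw [(LArr.htpy f).h_congr _ (a := degC (idx 2 a)) (a' := a) (i' := i)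
      (by unfold degC; lia) (by unfold degC; lia)]
    rcases (by lia : a % 2 = 0 ∨ a % 2 = 1) with hk | hk
    · unfold degC degX
      rw [NCom.E_of_lt y.cod (i := i) (j := idx 2 i - (idx 2 i + 2) / 3) (by lia),
        NCom.E_of_lt y.cod (j := idx 2 i - (idx 2 i + 2) / 3) (by lia)]
      simp
    · rw [ind_one (i := idx 2 a) (by lia)]
      unfold degC degX
      simp (disch := omega) only [NCom.E_comp, Category.assoc, Preadditive.zsmul_comp]
      simp
  unfold fillerC
  rw [tri_comp_tri, tri_comp_tri, ← e₁, NCom.E_c]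
  unfold toDomC tri
  apply biprod.hom_ext <;> simp

theorem htpyCod_naturality (e : a + 1 = i + (2 : ℕ)) :
    (biprod.fst ≫ x.dom.E (degC (idx 1 a)) a ≫ (LArr.htpy f).h a i e) ≫ fromCodC y i +
        tri (x.dom.E (degC (idx 1 a)) (degC (idx 1 i))) 0 0 ≫ fillerC f (idx 1 i) =
      fillerC f (idx 1 a) ≫ tri (y.dom.E (degC (idx 1 a)) (degC (idx 1 i)))
        (0 : _ ⟶ y.cod.ob (degX (idx 1 i))) 0 := by
  have h₂ := idx_one a
  have h₄ := idx_one i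
  push_cast at e
  have e₁ : x.dom.E (degC (idx 1 a)) (degC (idx 1 i)) ≫
      ((2 * ind (idx 1 i) - 1) • ((LArr.htpy f).h (degC (idx 1 i)) (degC (idx 1 i) - 1)
        (by push_cast; ring) ≫ y.cod.E (degC (idx 1 i) - 1) (degX (idx 1 i)))) =
      -(x.dom.E (degC (idx 1 a)) a ≫ (LArr.htpy f).h a i e ≫ y.cod.E i (degX (idx 1 i))) := by
    rw [ind_idx_one]
    rcases (by lia : a % 2 = 0 ∨ a % 2 = 1) with hk | hk
    · rw [(LArr.htpy f).h_congr _ (a := degC (idx 1 i)) (a' := a) (i' := i)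
        (by unfold degC; lia) (by unfold degC; lia)]
      unfold degC degX
      simp (disch := omega) only [NCom.E_comp, NCom.E_comp_assoc, Category.assoc,
        Preadditive.comp_zsmul]
      simp
    · unfold degC
      rw [NCom.E_of_lt x.dom (j := a) (by lia),
        NCom.E_of_lt x.dom (i := idx 1 a - idx 1 a / 3) (by lia)]
      simp
  unfold fillerC
  rw [tri_comp_tri, tri_comp_tri, e₁, NCom.E_c]
  unfold fromCodC tri
  apply biprod.hom_ext <;> simp

theorem fromDomCell_toDom :
    ((LArr.htpy f).h a i e ≫ y.cod.E i (degX (idx 2 i)) ≫ biprod.inr) ≫ toDomC y i = 0 := by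
  simp [toDomC]

theorem fromCod_toCodCell :
    fromCodC x a ≫ biprod.fst ≫ x.dom.E (degC (idx 1 a)) a ≫ (LArr.htpy f).h a i e = 0 := by
  simp [fromCodC]

section

variable {G : Type v} [AddCommGroup G] {p q r s t w : G}

theorem add_add_eq_of_left_zero (hp : p = 0) (hw : w = 0) (h : q + r = s + t) :
    p + (q + r) = s + w + t := by
  rw [hp, hw, zero_add, add_zero, h]

theorem add_add_eq_of_mid_zero (hq : q = 0) (ht : t = 0) (h : p + r = s + w) :
    p + (q + r) = s + w + t := by
  rw [hq, ht, zero_add, add_zero, h]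

theorem add_add_eq_zero (hp : p = 0) (hq : q = 0) (hr : r = 0) (hs : s = 0) :
    p + q + r = s := by
  rw [hp, hq, hr, hs, add_zero, add_zero]

end

variable (x) in
/-- The morphism with components `toDom`, `toCod`, `toCone` from the triangle of the filler to the
cone triangle. -/
def toPair : (fillerF A ⋙ (recalageTriangulation A).triangle).obj x ⟶
    (coneTriangulation A).triangle.obj x :=
  show LPair.Hom _ _ from
  ⟨toDom x, toCod x, toCone x, toHatA x, toHatB x, isHtpy_toHatA x, isHtpy_toHatB x⟩

variable (x) in
/-- The morphism with components `fromDom`, `fromCod`, `fromCone` from the cone triangle to the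
triangle of the filler. -/
def fromPair : (coneTriangulation A).triangle.obj x ⟶
    (fillerF A ⋙ (recalageTriangulation A).triangle).obj x :=
  show LPair.Hom _ _ from
  ⟨fromDom x, fromCod x, fromCone x, fromHatA x, 0, isHtpy_fromHatA x,
    isTwo_zero_of_eq (fromCod_faceτ x)⟩

theorem toPair_isTwo : IsTwo
    ((fillerF A ⋙ (recalageTriangulation A).triangle).map f ≫ toPair y)
    (toPair x ≫ (coneTriangulation A).triangle.map f) (0, toCodCell f, 0) := by
  refine ⟨isTwo_zero_of_eq (toDom_naturality f), isHtpy_toCodCell f,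
    isTwo_zero_of_eq (toCone_naturality f), ?_, ?_⟩
  · exact add_add_eq_of_left_zero (post_zero _) (post_zero _) (NCom.PreHtpy.ext
      (funext fun a => funext fun i => funext fun e => toHatA_naturality f a i e))
  · refine add_add_eq_of_mid_zero (pre_zero _) (pre_zero _) (Eq.trans ?_
      ((add_zero _).symm.trans (congrArg _ (post_zero _).symm)))
    exact NCom.PreHtpy.ext (funext fun a => funext fun i => funext fun e =>
        toHatB_naturality f a i e)

variable (A) in
/-- The lax natural transformation with components `toPair`. -/
def toTriangle : LaxTrans (fillerF A ⋙ (recalageTriangulation A).triangle)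
    (coneTriangulation A).triangle where
  app x := toPair x
  cell f := (0, toCodCell f, 0)
  cell_isTwo f := toPair_isTwo f
  cell_id x := by
    refine Prod.ext rfl (Prod.ext ?_ rfl)
    refine NCom.PreHtpy.ext (funext fun a => funext fun i => funext fun e => ?_)
    show (biprod.fst : x.dom.ob (degC (idx 1 a)) ⊞ x.cod.ob (degX (idx 1 a)) ⟶ _) ≫
      x.dom.E (degC (idx 1 a)) a ≫ (0 : x.dom.ob a ⟶ x.cod.ob i) = 0
    rw [comp_zero, comp_zero]
  cell_comp f g := by
    refine Prod.ext ?_ (Prod.ext ?_ ?_)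
    · exact ((congrArg₂ (· + ·) (pre_zero _) (post_zero _)).trans (zero_add _)).symm
    · exact NCom.PreHtpy.ext (funext fun a => funext fun i => funext fun e =>
        toCodCell_comp f a i e g)
    · exact ((congrArg₂ (· + ·) (pre_zero _) (post_zero _)).trans (zero_add _)).symm

theorem fromPair_isTwo : IsTwo ((coneTriangulation A).triangle.map f ≫ fromPair y)
    (fromPair x ≫ (fillerF A ⋙ (recalageTriangulation A).triangle).map f)
    (fromDomCell f, 0, 0) := by
  refine ⟨isHtpy_fromDomCell f, isTwo_zero_of_eq (fromCod_naturality f),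
    isTwo_zero_of_eq (fromCone_naturality f), ?_, ?_⟩
  · exact add_add_eq_of_mid_zero (pre_zero _) (pre_zero _) (NCom.PreHtpy.ext
      (funext fun a => funext fun i => funext fun e => fromHatA_naturality f a i e))
  · exact add_add_eq_of_mid_zero (pre_zero _) (pre_zero _) (congrArg₂ (· + ·) (post_zero _)
      (post_zero _) |>.trans (congrArg₂ (· + ·) (pre_zero _) (post_zero _)).symm)

variable (A) in
/-- The lax natural transformation with components `fromPair`. -/
def fromTriangle : LaxTrans (coneTriangulation A).triangle
    (fillerF A ⋙ (recalageTriangulation A).triangle) where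
  app x := fromPair x
  cell f := (fromDomCell f, 0, 0)
  cell_isTwo f := fromPair_isTwo f
  cell_id x := by
    refine Prod.ext ?_ rfl
    refine NCom.PreHtpy.ext (funext fun a => funext fun i => funext fun e => ?_)
    show (0 : x.dom.ob a ⟶ x.cod.ob i) ≫ x.cod.E i (degX (idx 2 i)) ≫
      (biprod.inr : _ ⟶ x.dom.ob (degC (idx 2 i)) ⊞ x.cod.ob (degX (idx 2 i))) = 0
    rw [zero_comp]
  cell_comp f g := by
    refine Prod.ext ?_ (Prod.ext ?_ ?_)
    · exact NCom.PreHtpy.ext (funext fun a => funext fun i => funext fun e =>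
        fromDomCell_comp f a i e g)
    · exact ((congrArg₂ (· + ·) (pre_zero _) (post_zero _)).trans (zero_add _)).symm
    · exact ((congrArg₂ (· + ·) (pre_zero _) (post_zero _)).trans (zero_add _)).symm

variable (x) in
theorem toPair_fromPair_isTwo :
    IsTwo (toPair x ≫ fromPair x) (𝟙 _) (htpyDom x, htpyCod x, 0) := by
  refine ⟨isHtpy_htpyDom x, isHtpy_htpyCod x, isTwo_zero_of_eq (toCone_fromCone x), ?_, ?_⟩
  · exact (add_zero _).trans (NCom.PreHtpy.ext (funext fun a => funext fun i => funext fun e =>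
      htpyDom_faceτ x a i e))
  · refine (add_zero _).trans (Eq.trans ?_ (congrArg₂ (· + ·)
      (congrArg₂ (· + ·) (pre_zero _).symm rfl) (pre_zero _).symm))
    refine Eq.trans ?_ ((zero_add _).symm.trans (add_zero _).symm)
    exact NCom.PreHtpy.ext (funext fun a => funext fun i => funext fun e =>
      htpyCod_faceτ x a i e)

variable (x) in
theorem fromPair_toPair_isTwo : IsTwo (fromPair x ≫ toPair x) (𝟙 _) 0 := by
  refine ⟨isTwo_zero_of_eq (fromDom_toDom x), isTwo_zero_of_eq (fromCod_toCod x),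
    isTwo_zero_of_eq (fromCone_toCone x), ?_, ?_⟩
  · refine (congrArg₂ (· + ·) (post_zero _) rfl).trans ((add_zero _).trans (Eq.symm
      ((congrArg₂ (· + ·) ?_ (pre_zero _)).trans (add_zero _))))
    exact NCom.PreHtpy.ext (funext fun a => funext fun i => funext fun e =>
      fromDom_toHatA x a i e)
  · refine (congrArg₂ (· + ·) (post_zero _) rfl).trans ((add_zero _).trans (Eq.symm
      ((congrArg₂ (· + ·) ((congrArg₂ (· + ·) ?_ (post_zero _)).trans (add_zero _))
        (pre_zero _)).trans (add_zero _))))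
    exact NCom.PreHtpy.ext (funext fun a => funext fun i => funext fun e =>
      fromCod_toHatB x a i)

variable (A) in
/-- The triangles of the filler are equivalent to the cone triangles. -/
def fillerTriangleEquiv : LaxEquiv (fillerF A ⋙ (recalageTriangulation A).triangle)
    (coneTriangulation A).triangle where
  hom := toTriangle A
  inv := fromTriangle A
  homInv :=
    { app := fun x => (htpyDom x, htpyCod x, 0)
      isTwo := fun x => toPair_fromPair_isTwo x
      naturality := fun {x y} f => by
        refine Prod.ext ?_ (Prod.ext ?_ ?_)
        · refine (congrArg₂ (· + ·)
            ((congrArg₂ (· + ·) (post_zero _) rfl).trans (zero_add _)) rfl).trans ?_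
          exact NCom.PreHtpy.ext (funext fun a => funext fun i => funext fun e =>
            htpyDom_naturality f a i e)
        · refine (congrArg₂ (· + ·)
            ((congrArg₂ (· + ·) rfl (pre_zero _)).trans (add_zero _)) rfl).trans ?_
          exact NCom.PreHtpy.ext (funext fun a => funext fun i => funext fun e =>
            htpyCod_naturality f a i e)
        · exact add_add_eq_zero (post_zero _) (pre_zero _) (post_zero _) (pre_zero _) }
  invHom :=
    { app := fun x => 0
      isTwo := fun x => fromPair_toPair_isTwo x
      naturality := fun {x y} f => by
        refine Prod.ext ?_ (Prod.ext ?_ ?_)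
        · exact add_add_eq_zero (NCom.PreHtpy.ext (funext fun a => funext fun i =>
            funext fun e => fromDomCell_toDom f a i e)) (pre_zero _) (post_zero _) (pre_zero _)
        · exact add_add_eq_zero (post_zero _) (NCom.PreHtpy.ext (funext fun a => funext fun i =>
            funext fun e => fromCod_toCodCell f a i e)) (post_zero _) (pre_zero _)
        · exact add_add_eq_zero (post_zero _) (pre_zero _) (post_zero _) (pre_zero _) }

end

end FillerEquivalence

/-! ### Fillers of spines -/

section StrictEquivalences

/-- An equivalence given by strict natural transformations `α`, `β` with `β ≫ α = 𝟙`. -/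
def LaxEquiv.ofRetraction {C : Type u} [Category.{v} C] [TwoCells C] {D : Type u'}
    [Category.{v'} D] {F G : D ⥤ C} (α : F ⟶ G) (β : G ⟶ F)
    (h : ∀ X, β.app X ≫ α.app X = 𝟙 (G.obj X)) (m : ∀ X, Cell (F.obj X) (F.obj X))
    (hm : ∀ X, IsTwo (α.app X ≫ β.app X) (𝟙 (F.obj X)) (m X))
    (nat : ∀ {X Y : D} (f : X ⟶ Y), post (m X) (F.map f) = pre (F.map f) (m Y)) :
    LaxEquiv F G where
  hom := LaxTrans.ofNatTrans α
  inv := LaxTrans.ofNatTrans β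
  homInv :=
    { app := m
      isTwo := hm
      naturality := fun f => by
        show (post 0 _ + pre _ 0) + _ = _
        rw [post_zero, pre_zero, add_zero, zero_add, nat] }
  invHom :=
    { app := fun _ => 0
      isTwo := fun X => isTwo_zero_of_eq (h X)
      naturality := fun f => by
        show (post 0 _ + pre _ 0) + post 0 _ = pre _ 0
        rw [post_zero, pre_zero, post_zero, pre_zero, add_zero, add_zero] }

end StrictEquivalences

noncomputable section SpineFiller

variable {A : Type u} [Category.{v} A] [Preadditive A] [HasFiniteBiproducts A]

attribute [local instance] hasBinaryBiproducts_of_finite_biproducts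

theorem idx_two_degC (i : ℤ) : idx 2 (degC i) = i + (i + 1) / 3 - i / 3 := by
  rw [idx_two]; unfold degC; lia

theorem idx_one_degX (i : ℤ) : idx 1 (degX i) = i - (i + 2) / 3 + (i + 1) / 3 := by
  rw [idx_one]; unfold degX; lia

variable (Y : NCom A 3)

/-- The differential of the filler of the spine of `Y`, for `i < j`. -/
def spineFillerD (i j : ℤ) : Y.ob (idx 2 (degC i)) ⊞ Y.ob (idx 1 (degX i)) ⟶
    Y.ob (idx 2 (degC j)) ⊞ Y.ob (idx 1 (degX j)) :=
  tri (Y.E (idx 2 (degC i)) (idx 2 (degC j)))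
    ((ind i - ind j) • Y.E (idx 2 (degC i)) (idx 1 (degX j)))
    (Y.E (idx 1 (degX i)) (idx 1 (degX j)))

theorem fillerObj_spine_E {i j : ℤ} (h : i < j) :
    (fillerObj ((spine A).obj Y)).E i j = spineFillerD Y i j := by
  rw [fillerObj_E _ h.le]
  have e : Y.E (idx 2 (degC i)) (idx 1 (degC i)) ≫ Y.E (idx 1 (degC i)) (idx 1 (degX j)) =
      Y.E (idx 2 (degC i)) (idx 1 (degX j)) :=
    Y.E_comp (by rw [idx_one, idx_two]; lia) (by rw [idx_le_idx]; unfold degC degX; lia)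
  unfold fillerD spineFillerD
  rw [spine_dom_E, spine_cod_E, spine_cod_E, spine_arr_c, ← e]
  rfl

/-- The component in degree `i` of `fromFiller`. -/
def fromFillerC (i : ℤ) : Y.ob (idx 2 (degC i)) ⊞ Y.ob (idx 1 (degX i)) ⟶ Y.ob i :=
  biprod.desc (ind i • Y.E (idx 2 (degC i)) i) (Y.E (idx 1 (degX i)) i)

/-- The projection of the filler of the spine of `Y` to `Y`: in the degrees `3q, 3q + 1, 3q + 2` it
is `(0, 1)`, `(1, d)`, `(0, 1)`. -/
def fromFiller : fillerObj ((spine A).obj Y) ⟶ Y :=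
  NCom.homOfE (X := fillerObj ((spine A).obj Y)) (fromFillerC Y) fun i => by
    rw [fillerObj_spine_E Y (by lia)]
    show spineFillerD Y i (i + 1) ≫ fromFillerC Y (i + 1) = fromFillerC Y i ≫ Y.E i (i + 1)
    have h₁ := idx_two_degC i
    have h₂ := idx_two_degC (i + 1)
    have h₃ := idx_one_degX i
    have h₄ := idx_one_degX (i + 1)
    unfold spineFillerD fromFillerC tri
    apply biprod.hom_ext'
    · rcases (by lia : i % 3 = 0 ∨ i % 3 = 1 ∨ i % 3 = 2) with h | h | h
      · rw [ind_zero (i := i) (by lia), ind_one (i := i + 1) (by lia)]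
        simp (disch := omega) [NCom.E_comp]
      · rw [ind_one (i := i) (by lia), ind_zero (i := i + 1) (by lia)]
        simp (disch := omega) [NCom.E_comp]
      · rw [ind_zero (i := i) (by lia), ind_zero (i := i + 1) (by lia)]
        simp
    · simp (disch := omega) [NCom.E_comp]

/-- The component in degree `i` of `toFiller`. -/
def toFillerC (i : ℤ) : Y.ob i ⟶ Y.ob (idx 2 (degC i)) ⊞ Y.ob (idx 1 (degX i)) :=
  biprod.lift (Y.E i (idx 2 (degC i))) (Y.E i (idx 1 (degX i)))

/-- The inclusion of `Y` in the filler of its spine: in the degrees `3q, 3q + 1, 3q + 2` it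
is `(1; 1)`, `(1; 0)`, `(d; 1)`. -/
def toFiller : Y ⟶ fillerObj ((spine A).obj Y) :=
  NCom.homOfE (Y := fillerObj ((spine A).obj Y)) (toFillerC Y) fun i => by
    rw [fillerObj_spine_E Y (by lia)]
    show Y.E i (i + 1) ≫ toFillerC Y (i + 1) = toFillerC Y i ≫ spineFillerD Y i (i + 1)
    have h₁ := idx_two_degC i
    have h₂ := idx_two_degC (i + 1)
    have h₃ := idx_one_degX i
    have h₄ := idx_one_degX (i + 1)
    unfold spineFillerD toFillerC tri
    apply biprod.hom_ext
    · simp (disch := omega) [NCom.E_comp]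
    · rcases (by lia : i % 3 = 0 ∨ i % 3 = 1 ∨ i % 3 = 2) with h | h | h
      · rw [ind_zero (i := i) (by lia), ind_one (i := i + 1) (by lia),
          NCom.E_of_lt Y (i := i + 1) (j := idx 1 (degX (i + 1))) (by lia)]
        simp (disch := omega) [NCom.E_comp]
      · rw [ind_one (i := i) (by lia), ind_zero (i := i + 1) (by lia),
          NCom.E_of_lt Y (i := i) (j := idx 1 (degX i)) (by lia)]
        simp (disch := omega) [NCom.E_comp]
      · rw [ind_zero (i := i) (by lia), ind_zero (i := i + 1) (by lia)]
        simp (disch := omega) [NCom.E_comp]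

theorem toFiller_fromFiller : toFiller Y ≫ fromFiller Y = 𝟙 Y := by
  apply NCom.hom_ext
  intro i
  show toFillerC Y i ≫ fromFillerC Y i = 𝟙 (Y.ob i)
  have h₁ := idx_two_degC i
  have h₃ := idx_one_degX i
  unfold toFillerC fromFillerC
  rw [biprod.lift_desc]
  by_cases h : i % 3 = 1
  · rw [ind_one h, NCom.E_of_lt Y (i := i) (j := idx 1 (degX i)) (by lia)]
    simp (disch := omega) [NCom.E_comp]
  · rw [ind_zero h]
    simp (disch := omega) [NCom.E_comp]

/-- The component `F^a ⟶ F^i` of `fillerHtpy`. -/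
def fillerHtpyC (a i : ℤ) : Y.ob (idx 2 (degC a)) ⊞ Y.ob (idx 1 (degX a)) ⟶
    Y.ob (idx 2 (degC i)) ⊞ Y.ob (idx 1 (degX i)) :=
  biprod.snd ≫ (-Y.E (idx 1 (degX a)) (idx 2 (degC i))) ≫ biprod.inl

/-- The homotopy from the projection on `Y` to the identity of the filler of the spine of `Y`. Only
its components `F^{3q+4} ⟶ F^{3q+2}` are nonzero. -/
def fillerHtpy : NCom.PreHtpy (fillerObj ((spine A).obj Y)) (fillerObj ((spine A).obj Y)) :=
  ⟨fun a i _ => fillerHtpyC Y a i⟩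

-- Each of the three residues of `i` modulo 3 gives four identities between matrix entries.
set_option maxHeartbeats 1000000 in
theorem fillerHtpy_eq (i : ℤ) :
    𝟙 (Y.ob (idx 2 (degC i)) ⊞ Y.ob (idx 1 (degX i))) - fromFillerC Y i ≫ toFillerC Y i =
      spineFillerD Y i (i + 2) ≫ fillerHtpyC Y (i + 2) i +
        spineFillerD Y i (i + 1) ≫ fillerHtpyC Y (i + 1) (i - 1) ≫ spineFillerD Y (i - 1) i +
        fillerHtpyC Y i (i - 2) ≫ spineFillerD Y (i - 2) i := by
  have h₁ := idx_two_degC i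
  have h₂ := idx_two_degC (i + 1)
  have h₃ := idx_two_degC (i + 2)
  have h₄ := idx_two_degC (i - 1)
  have h₅ := idx_two_degC (i - 2)
  have k₁ := idx_one_degX i
  have k₂ := idx_one_degX (i + 1)
  have k₃ := idx_one_degX (i + 2)
  have k₄ := idx_one_degX (i - 1)
  have k₅ := idx_one_degX (i - 2)
  unfold spineFillerD fromFillerC toFillerC fillerHtpyC tri
  rcases (by lia : i % 3 = 0 ∨ i % 3 = 1 ∨ i % 3 = 2) with h | h | h
  · rw [ind_zero (i := i) (by lia), ind_one (i := i + 1) (by lia),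
      ind_zero (i := i + 2) (by lia), ind_zero (i := i - 1) (by lia), ind_one (i := i - 2) (by lia),
      NCom.E_of_lt Y (i := idx 1 (degX (i + 2))) (j := idx 2 (degC i)) (by lia),
      NCom.E_of_lt Y (i := idx 1 (degX i)) (j := idx 2 (degC (i - 2))) (by lia)]
    apply biprod.hom_ext' <;> apply biprod.hom_ext <;> simp (disch := omega) [NCom.E_comp]
  · rw [ind_one (i := i) (by lia), ind_zero (i := i + 1) (by lia),
      ind_zero (i := i + 2) (by lia), ind_zero (i := i - 1) (by lia),
      ind_zero (i := i - 2) (by lia),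
      NCom.E_of_lt Y (i := idx 1 (degX (i + 2))) (j := idx 2 (degC i)) (by lia),
      NCom.E_of_lt Y (i := idx 1 (degX (i + 1))) (j := idx 2 (degC (i - 1))) (by lia),
      NCom.E_of_lt Y (i := i) (j := idx 1 (degX i)) (by lia)]
    apply biprod.hom_ext' <;> apply biprod.hom_ext <;> simp (disch := omega) [NCom.E_comp]
  · rw [ind_zero (i := i) (by lia), ind_zero (i := i + 1) (by lia),
      ind_one (i := i + 2) (by lia), ind_one (i := i - 1) (by lia),
      ind_zero (i := i - 2) (by lia),
      NCom.E_of_lt Y (i := idx 1 (degX (i + 1))) (j := idx 2 (degC (i - 1))) (by lia),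
      NCom.E_of_lt Y (i := idx 1 (degX i)) (j := idx 2 (degC (i - 2))) (by lia)]
    apply biprod.hom_ext' <;> apply biprod.hom_ext <;> simp (disch := omega) [NCom.E_comp]

theorem isHtpy_fillerHtpy :
    NCom.IsHtpy (fromFiller Y ≫ toFiller Y) (𝟙 (fillerObj ((spine A).obj Y))) (fillerHtpy Y) := by
  refine NCom.isHtpy_three_iff.2 fun i => ?_
  rw [fillerObj_spine_E Y (by lia), fillerObj_spine_E Y (by lia), fillerObj_spine_E Y (by lia),
    fillerObj_spine_E Y (by lia)]
  exact fillerHtpy_eq Y i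

variable {Y} {Z : NCom A 3} (f : Y ⟶ Z)

theorem fillerC_spine (i : ℤ) : fillerC ((spine A).map f) i =
    tri (NCom.c f (idx 2 (degC i))) 0 (NCom.c f (idx 1 (degX i))) :=
  congrArg (fun b => tri (NCom.c f (idx 2 (degC i))) b (NCom.c f (idx 1 (degX i))))
    ((congrArg _ zero_comp).trans (smul_zero (2 * ind i - 1)))

theorem fromFiller_naturality :
    (fillerF A).map ((spine A).map f) ≫ fromFiller Z = fromFiller Y ≫ f := by
  apply NCom.hom_ext
  intro i
  show fillerC ((spine A).map f) i ≫ fromFillerC Z i = fromFillerC Y i ≫ NCom.c f i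
  rw [fillerC_spine]
  show tri (NCom.c f (idx 2 (degC i))) 0 (NCom.c f (idx 1 (degX i))) ≫ fromFillerC Z i = _
  unfold fromFillerC tri
  apply biprod.hom_ext' <;> simp [NCom.E_c]

theorem toFiller_naturality :
    f ≫ toFiller Z = toFiller Y ≫ (fillerF A).map ((spine A).map f) := by
  apply NCom.hom_ext
  intro i
  show NCom.c f i ≫ toFillerC Z i = toFillerC Y i ≫ fillerC ((spine A).map f) i
  rw [fillerC_spine]
  show _ = toFillerC Y i ≫ tri (NCom.c f (idx 2 (degC i))) 0 (NCom.c f (idx 1 (degX i)))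
  unfold toFillerC tri
  apply biprod.hom_ext <;> simp [NCom.E_c]

theorem fillerHtpy_naturality (a i : ℤ) :
    fillerHtpyC Y a i ≫ tri (NCom.c f (idx 2 (degC i))) 0 (NCom.c f (idx 1 (degX i))) =
      tri (NCom.c f (idx 2 (degC a))) 0 (NCom.c f (idx 1 (degX a))) ≫ fillerHtpyC Z a i := by
  unfold fillerHtpyC tri
  apply biprod.hom_ext <;> simp [NCom.E_c]

variable (A) in
/-- A 3-complex is equivalent to the filler of its spine. -/
def spineFillerEquiv : LaxEquiv (spine A ⋙ fillerF A) (𝟭 (NCom A 3)) :=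
  LaxEquiv.ofRetraction (F := spine A ⋙ fillerF A) (G := 𝟭 (NCom A 3))
    { app := fun Y => fromFiller Y
      naturality := fun _ _ f => fromFiller_naturality f }
    { app := fun Y => toFiller Y
      naturality := fun _ _ f => toFiller_naturality f }
    (fun Y => toFiller_fromFiller Y) (fun Y => fillerHtpy Y) (fun Y => isHtpy_fillerHtpy Y)
    (fun {Y Z} f => NCom.PreHtpy.ext (funext fun a => funext fun i => funext fun _ => by
      show fillerHtpyC Y a i ≫ fillerC ((spine A).map f) i =
        fillerC ((spine A).map f) a ≫ fillerHtpyC Z a i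
      rw [fillerC_spine, fillerC_spine]
      exact fillerHtpy_naturality f a i))

end SpineFiller

/-! ### Cone triangles of spines -/

noncomputable section SpineCone

variable {A : Type u} [Category.{v} A] [Preadditive A] [HasFiniteBiproducts A]

attribute [local instance] hasBinaryBiproducts_of_finite_biproducts

variable (Y : NCom A 3)

/-- The differential of the cone of the spine of `Y`. -/
def spineConeD (k : ℤ) : Y.ob (idx 2 (k + 1)) ⊞ Y.ob (idx 1 k) ⟶
    Y.ob (idx 2 (k + 1 + 1)) ⊞ Y.ob (idx 1 (k + 1)) :=
  tri (-Y.E (idx 2 (k + 1)) (idx 2 (k + 1 + 1))) (Y.E (idx 2 (k + 1)) (idx 1 (k + 1)))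
    (Y.E (idx 1 k) (idx 1 (k + 1)))

theorem coneObj_spine_E (k : ℤ) :
    (coneObj ((spine A).obj Y)).E k (k + 1) = spineConeD Y k := by
  rw [coneObj_E, spine_dom_E, spine_cod_E, spine_arr_c]
  rfl

/-- The differential into degree `k` of the cone of the spine of `Y`. -/
def spineConeDPred (k : ℤ) : Y.ob (idx 2 (k - 1 + 1)) ⊞ Y.ob (idx 1 (k - 1)) ⟶
    Y.ob (idx 2 (k + 1)) ⊞ Y.ob (idx 1 k) :=
  tri (-Y.E (idx 2 (k - 1 + 1)) (idx 2 (k + 1))) (Y.E (idx 2 (k - 1 + 1)) (idx 1 k))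
    (Y.E (idx 1 (k - 1)) (idx 1 k))

theorem coneObj_spine_E_pred (k : ℤ) :
    (coneObj ((spine A).obj Y)).E (k - 1) k = spineConeDPred Y k := by
  have e : Y.E (idx 2 (k - 1 + 1)) (idx 1 (k - 1 + 1)) ≫ Y.E (idx 1 (k - 1 + 1)) (idx 1 k) =
      Y.E (idx 2 (k - 1 + 1)) (idx 1 k) :=
    Y.E_comp (by rw [idx_one, idx_two]; lia) (by rw [idx_le_idx]; lia)
  unfold spineConeDPred
  rw [coneObj_E_pred, spine_dom_E, spine_cod_E, spine_cod_E, spine_arr_c, ← e]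
  rfl

/-- The component in degree `k` of `spineConeToFace`. -/
def spineConeToFaceC (k : ℤ) : Y.ob (idx 2 (k + 1)) ⊞ Y.ob (idx 1 k) ⟶ Y.ob (idx 0 k) :=
  biprod.desc (Y.E (idx 2 (k + 1)) (idx 0 k)) (Y.E (idx 1 k) (idx 0 k))

/-- The projection of the cone of the spine of `Y` to `d₀ Y`: in even degrees it is `(1, d)`, in odd
degrees `(0, 1)`. -/
def spineConeToFace : coneObj ((spine A).obj Y) ⟶ (face A 1 0).obj Y :=
  NCom.homOfE (X := coneObj ((spine A).obj Y)) (Y := (face A 1 0).obj Y) (spineConeToFaceC Y)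
    fun k => by
      rw [coneObj_spine_E, face_E]
      show spineConeD Y k ≫ spineConeToFaceC Y (k + 1) =
        spineConeToFaceC Y k ≫ Y.E (idx 0 k) (idx 0 (k + 1))
      have h₁ := idx_two (k + 1)
      have h₂ := idx_two (k + 1 + 1)
      have h₃ := idx_one k
      have h₄ := idx_one (k + 1)
      have h₅ := idx_zero k
      have h₆ := idx_zero (k + 1)
      unfold spineConeD spineConeToFaceC tri
      apply biprod.hom_ext'
      · rcases (by lia : k % 2 = 0 ∨ k % 2 = 1) with hk | hk
        · rw [NCom.E_of_lt Y (i := idx 2 (k + 1 + 1)) (j := idx 0 (k + 1)) (by lia)]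
          simp (disch := omega) [NCom.E_comp]
        · rw [NCom.E_of_lt Y (i := idx 2 (k + 1)) (j := idx 0 k) (by lia)]
          simp (disch := omega) [NCom.E_comp]
      · simp (disch := omega) [NCom.E_comp]

/-- The component in degree `k` of `faceToSpineCone`. -/
def faceToSpineConeC (k : ℤ) : Y.ob (idx 0 k) ⟶ Y.ob (idx 2 (k + 1)) ⊞ Y.ob (idx 1 k) :=
  biprod.lift (sgn k • Y.E (idx 0 k) (idx 2 (k + 1))) (Y.E (idx 0 k) (idx 1 k))

/-- The inclusion of `d₀ Y` in the cone of the spine of `Y`: in even degrees it is `(1; 0)`, in odd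
degrees `(-d; 1)`. -/
def faceToSpineCone : (face A 1 0).obj Y ⟶ coneObj ((spine A).obj Y) :=
  NCom.homOfE (X := (face A 1 0).obj Y) (Y := coneObj ((spine A).obj Y)) (faceToSpineConeC Y)
    fun k => by
      rw [coneObj_spine_E, face_E]
      show Y.E (idx 0 k) (idx 0 (k + 1)) ≫ faceToSpineConeC Y (k + 1) =
        faceToSpineConeC Y k ≫ spineConeD Y k
      have h₁ := idx_two (k + 1)
      have h₂ := idx_two (k + 1 + 1)
      have h₃ := idx_one k
      have h₄ := idx_one (k + 1)
      have h₅ := idx_zero k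
      have h₆ := idx_zero (k + 1)
      unfold spineConeD faceToSpineConeC tri
      rw [sgn_succ]
      apply biprod.hom_ext
      · simp (disch := omega) [NCom.E_comp]
      · rcases (by lia : k % 2 = 0 ∨ k % 2 = 1) with hk | hk
        · rw [NCom.E_of_lt Y (i := idx 0 k) (j := idx 1 k) (by lia),
            show sgn k = 1 from if_pos hk]
          simp (disch := omega) [NCom.E_comp]
        · rw [NCom.E_of_lt Y (i := idx 0 (k + 1)) (j := idx 1 (k + 1)) (by lia),
            show sgn k = -1 from if_neg (by lia)]
          simp (disch := omega) [NCom.E_comp]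

theorem faceToSpineCone_spineConeToFace :
    faceToSpineCone Y ≫ spineConeToFace Y = 𝟙 ((face A 1 0).obj Y) := by
  apply NCom.hom_ext
  intro k
  show faceToSpineConeC Y k ≫ spineConeToFaceC Y k = 𝟙 (Y.ob (idx 0 k))
  have h₁ := idx_two (k + 1)
  have h₃ := idx_one k
  have h₅ := idx_zero k
  unfold faceToSpineConeC spineConeToFaceC
  rw [biprod.lift_desc]
  rcases (by lia : k % 2 = 0 ∨ k % 2 = 1) with hk | hk
  · rw [NCom.E_of_lt Y (i := idx 0 k) (j := idx 1 k) (by lia), show sgn k = 1 from if_pos hk]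
    simp (disch := omega) [NCom.E_comp]
  · rw [NCom.E_of_lt Y (i := idx 2 (k + 1)) (j := idx 0 k) (by lia)]
    simp (disch := omega) [NCom.E_comp]

theorem coneInr_spineConeToFace : coneInr ((spine A).obj Y) ≫ spineConeToFace Y =
    (faceτ (A := A) 1 0).app Y := by
  apply NCom.hom_ext
  intro k
  exact biprod.inr_desc (Y.E (idx 2 (k + 1)) (idx 0 k)) (Y.E (idx 1 k) (idx 0 k)) |>.trans
    (faceτ_zero_c Y k).symm

/-- The component of `faceToSpineConeHat` between degrees `a` and `i`. -/
def faceToSpineConeHatC (a i : ℤ) : Y.ob (idx 1 a) ⟶ Y.ob (idx 2 (i + 1)) ⊞ Y.ob (idx 1 i) :=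
  (-Y.E (idx 1 a) (idx 2 (i + 1))) ≫ biprod.inl

/-- The homotopy comparing `d₁ Y ⟶ Cone` with `d₁ Y ⟶ d₀ Y ⟶ Cone`, where the cone is that of the
spine of `Y`. -/
def faceToSpineConeHat : NCom.PreHtpy ((face A 1 1).obj Y) (coneObj ((spine A).obj Y)) :=
  ⟨fun a i _ => faceToSpineConeHatC Y a i⟩

theorem isHtpy_faceToSpineConeHat :
    NCom.IsHtpy (𝟙 ((face A 1 1).obj Y) ≫ coneInr ((spine A).obj Y))
      ((faceτ (A := A) 1 0).app Y ≫ faceToSpineCone Y) (faceToSpineConeHat Y) := by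
  have key : ∀ k : ℤ,
      Y.E (idx 1 k) (idx 0 k) ≫ faceToSpineConeC Y k - 𝟙 _ ≫ biprod.inr =
        Y.E (idx 1 k) (idx 1 (k + 1)) ≫ faceToSpineConeHatC Y (k + 1) k +
          faceToSpineConeHatC Y k (k - 1) ≫ spineConeDPred Y k := by
    intro k
    have h₁ := idx_two (k + 1)
    have h₂ := idx_two (k - 1 + 1)
    have h₃ := idx_one k
    have h₄ := idx_one (k + 1)
    have h₅ := idx_zero k
    unfold faceToSpineConeHatC faceToSpineConeC spineConeDPred tri
    rcases (by lia : k % 2 = 0 ∨ k % 2 = 1) with hk | hk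
    · rw [NCom.E_of_lt Y (i := idx 0 k) (j := idx 1 k) (by lia), show sgn k = 1 from if_pos hk,
        NCom.E_of_lt Y (i := idx 1 (k + 1)) (j := idx 2 (k + 1)) (by lia)]
      apply biprod.hom_ext <;> simp (disch := omega) [NCom.E_comp]
    · rw [show sgn k = -1 from if_neg (by lia),
        NCom.E_of_lt Y (i := idx 1 k) (j := idx 2 (k - 1 + 1)) (by lia)]
      apply biprod.hom_ext <;> simp (disch := omega) [NCom.E_comp]
  refine NCom.isHtpy_two_of (fun k => Y.E (idx 1 k) (idx 1 (k + 1))) (spineConeDPred Y)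
    (fun k => face_E Y 1 _ _) (fun k => coneObj_spine_E_pred Y k) fun k => ?_
  refine Eq.trans ?_ (key k)
  rw [NCom.c_comp, faceτ_zero_c]
  rfl

/-- The component of `spineConeHtpy` between degrees `a` and `i`. -/
def spineConeHtpyC (a i : ℤ) : Y.ob (idx 2 (a + 1)) ⊞ Y.ob (idx 1 a) ⟶
    Y.ob (idx 2 (i + 1)) ⊞ Y.ob (idx 1 i) :=
  biprod.snd ≫ Y.E (idx 1 a) (idx 2 (i + 1)) ≫ biprod.inl

/-- The homotopy from the projection on `d₀ Y` to the identity of the cone of the spine of `Y`. -/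
def spineConeHtpy :
    NCom.PreHtpy (coneObj ((spine A).obj Y)) (coneObj ((spine A).obj Y)) :=
  ⟨fun a i _ => spineConeHtpyC Y a i⟩

theorem isHtpy_spineConeHtpy : NCom.IsHtpy (spineConeToFace Y ≫ faceToSpineCone Y)
    (𝟙 (coneObj ((spine A).obj Y))) (spineConeHtpy Y) := by
  have key : ∀ k : ℤ,
      𝟙 (Y.ob (idx 2 (k + 1)) ⊞ Y.ob (idx 1 k)) - spineConeToFaceC Y k ≫ faceToSpineConeC Y k =
        spineConeD Y k ≫ spineConeHtpyC Y (k + 1) k +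
          spineConeHtpyC Y k (k - 1) ≫ spineConeDPred Y k := by
    intro k
    have h₁ := idx_two (k + 1)
    have h₂ := idx_two (k - 1 + 1)
    have h₃ := idx_one k
    have h₄ := idx_one (k + 1)
    have h₅ := idx_zero k
    unfold spineConeHtpyC spineConeToFaceC faceToSpineConeC spineConeDPred spineConeD tri
    rcases (by lia : k % 2 = 0 ∨ k % 2 = 1) with hk | hk
    · rw [NCom.E_of_lt Y (i := idx 0 k) (j := idx 1 k) (by lia), show sgn k = 1 from if_pos hk,
        NCom.E_of_lt Y (i := idx 1 (k + 1)) (j := idx 2 (k + 1)) (by lia)]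
      apply biprod.hom_ext' <;> apply biprod.hom_ext <;> simp (disch := omega) [NCom.E_comp]
    · rw [show sgn k = -1 from if_neg (by lia),
        NCom.E_of_lt Y (i := idx 1 k) (j := idx 2 (k - 1 + 1)) (by lia),
        NCom.E_of_lt Y (i := idx 2 (k + 1)) (j := idx 0 k) (by lia)]
      apply biprod.hom_ext' <;> apply biprod.hom_ext <;> simp (disch := omega) [NCom.E_comp]
  exact NCom.isHtpy_two_of (spineConeD Y) (spineConeDPred Y)
    (fun k => coneObj_spine_E Y k) (fun k => coneObj_spine_E_pred Y k) key

theorem faceToSpineConeHat_spineConeToFace (a i : ℤ) (e : a + 1 = i + (2 : ℕ)) :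
    faceToSpineConeHatC Y a i ≫ spineConeToFaceC Y i = 0 := by
  have h₁ := idx_two (i + 1)
  have h₂ := idx_one a
  have h₃ := idx_zero i
  push_cast at e
  unfold faceToSpineConeHatC spineConeToFaceC
  rw [Category.assoc, biprod.inl_desc]
  rcases (by lia : i % 2 = 0 ∨ i % 2 = 1) with hk | hk
  · rw [NCom.E_of_lt Y (i := idx 1 a) (by lia), neg_zero, zero_comp]
  · rw [NCom.E_of_lt Y (j := idx 0 i) (by lia), comp_zero]

theorem faceToSpineConeHat_add_spineConeHtpy (a i : ℤ) :
    faceToSpineConeHatC Y a i + biprod.inr ≫ spineConeHtpyC Y a i = 0 := by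
  unfold faceToSpineConeHatC spineConeHtpyC
  simp

variable {Y} {Z : NCom A 3} (f : Y ⟶ Z)

theorem spineConeToFace_naturality : (coneF A).map ((spine A).map f) ≫ spineConeToFace Z =
    spineConeToFace Y ≫ (face A 1 0).map f := by
  apply NCom.hom_ext
  intro k
  show tri (NCom.c f (idx 2 (k + 1))) 0 (NCom.c f (idx 1 k)) ≫ spineConeToFaceC Z k =
    spineConeToFaceC Y k ≫ NCom.c f (idx 0 k)
  unfold spineConeToFaceC tri
  apply biprod.hom_ext' <;> simp [NCom.E_c]

theorem faceToSpineCone_naturality : (face A 1 0).map f ≫ faceToSpineCone Z =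
    faceToSpineCone Y ≫ (coneF A).map ((spine A).map f) := by
  apply NCom.hom_ext
  intro k
  show NCom.c f (idx 0 k) ≫ faceToSpineConeC Z k =
    faceToSpineConeC Y k ≫ tri (NCom.c f (idx 2 (k + 1))) 0 (NCom.c f (idx 1 k))
  unfold faceToSpineConeC tri
  apply biprod.hom_ext <;> simp [NCom.E_c]

theorem faceToSpineConeHat_naturality (a i : ℤ) :
    NCom.c f (idx 1 a) ≫ faceToSpineConeHatC Z a i =
      faceToSpineConeHatC Y a i ≫ tri (NCom.c f (idx 2 (i + 1))) 0 (NCom.c f (idx 1 i)) := by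
  unfold faceToSpineConeHatC tri
  apply biprod.hom_ext <;> simp [NCom.E_c]

theorem spineConeHtpy_naturality (a i : ℤ) :
    spineConeHtpyC Y a i ≫ tri (NCom.c f (idx 2 (i + 1))) 0 (NCom.c f (idx 1 i)) =
      tri (NCom.c f (idx 2 (a + 1))) 0 (NCom.c f (idx 1 a)) ≫ spineConeHtpyC Z a i := by
  unfold spineConeHtpyC tri
  apply biprod.hom_ext <;> simp [NCom.E_c]

variable (Y) in
/-- The morphism `(1, 1, spineConeToFace)` from the cone triangle of the spine of `Y` to the
triangle of `Y`. -/
def spineConeToPair : (spine A ⋙ (coneTriangulation A).triangle).obj Y ⟶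
    (recalageTriangulation A).triangle.obj Y :=
  show LPair.Hom _ _ from
  ⟨𝟙 ((face A 1 2).obj Y), 𝟙 ((face A 1 1).obj Y), spineConeToFace Y, 0, 0,
    isTwo_zero_of_eq ((Category.id_comp _).trans (Category.comp_id _).symm),
    isTwo_zero_of_eq ((Category.id_comp _).trans (coneInr_spineConeToFace Y).symm)⟩

variable (Y) in
/-- The morphism `(1, 1, faceToSpineCone)` from the triangle of `Y` to the cone triangle of the
spine of `Y`. -/
def pairToSpineCone : (recalageTriangulation A).triangle.obj Y ⟶
    (spine A ⋙ (coneTriangulation A).triangle).obj Y :=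
  show LPair.Hom _ _ from
  ⟨𝟙 ((face A 1 2).obj Y), 𝟙 ((face A 1 1).obj Y), faceToSpineCone Y, 0, faceToSpineConeHat Y,
    isTwo_zero_of_eq ((Category.id_comp _).trans (Category.comp_id _).symm),
    isHtpy_faceToSpineConeHat Y⟩

theorem add_eq_add_of_zero {G : Type v} [AddCommGroup G] {p q r s : G} (hp : p = 0) (hq : q = 0)
    (hr : r = 0) (hs : s = 0) : p + q = r + s := by
  rw [hp, hq, hr, hs]

theorem spineConeToPair_naturality :
    (spine A ⋙ (coneTriangulation A).triangle).map f ≫ spineConeToPair Z =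
      spineConeToPair Y ≫ (recalageTriangulation A).triangle.map f :=
  LPair.Hom.ext ((Category.comp_id _).trans (Category.id_comp _).symm)
    ((Category.comp_id _).trans (Category.id_comp _).symm) (spineConeToFace_naturality f)
    (add_eq_add_of_zero (pre_zero _) (post_zero _) (pre_zero _) (post_zero _))
    (add_eq_add_of_zero (pre_zero _) (post_zero _) (pre_zero _) (post_zero _))

theorem pairToSpineCone_naturality :
    (recalageTriangulation A).triangle.map f ≫ pairToSpineCone Z =
      pairToSpineCone Y ≫ (spine A ⋙ (coneTriangulation A).triangle).map f := by
  refine LPair.Hom.ext ((Category.comp_id _).trans (Category.id_comp _).symm)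
    ((Category.comp_id _).trans (Category.id_comp _).symm) (faceToSpineCone_naturality f)
    (add_eq_add_of_zero (pre_zero _) (post_zero _) (pre_zero _) (post_zero _))
    ((congrArg₂ (· + ·) ?_ (post_zero _)).trans ((add_comm _ _).trans
      (congrArg₂ (· + ·) (pre_zero _).symm rfl)))
  exact NCom.PreHtpy.ext (funext fun a => funext fun i => funext fun _ =>
    faceToSpineConeHat_naturality f a i)

variable (Y) in
theorem pairToSpineCone_spineConeToPair : pairToSpineCone Y ≫ spineConeToPair Y = 𝟙 _ := by
  refine LPair.Hom.ext (Category.comp_id _) (Category.comp_id _)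
    (faceToSpineCone_spineConeToFace Y)
    ((congrArg₂ (· + ·) (pre_zero _) (post_zero _)).trans (add_zero _))
    ((congrArg₂ (· + ·) (pre_zero _) ?_).trans (add_zero _))
  exact NCom.PreHtpy.ext (funext fun a => funext fun i => funext fun e =>
    faceToSpineConeHat_spineConeToFace Y a i e)

variable (Y) in
theorem spineConeToPair_pairToSpineCone_isTwo :
    IsTwo (spineConeToPair Y ≫ pairToSpineCone Y) (𝟙 _) (0, 0, spineConeHtpy Y) := by
  refine ⟨isTwo_zero_of_eq (Category.comp_id _), isTwo_zero_of_eq (Category.comp_id _),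
    isHtpy_spineConeHtpy Y, ?_, ?_⟩
  · exact add_eq_add_of_zero (post_zero _) rfl
      ((congrArg₂ (· + ·) (pre_zero _) (post_zero _)).trans (add_zero _)) (pre_zero _)
  · refine (congrArg₂ (· + ·) (post_zero _) rfl).trans ((add_zero _).trans (Eq.symm
      ((congrArg₂ (· + ·) ((congrArg₂ (· + ·) (pre_id _) (post_zero _)).trans (add_zero _))
        rfl).trans ?_)))
    exact NCom.PreHtpy.ext (funext fun a => funext fun i => funext fun _ =>
      faceToSpineConeHat_add_spineConeHtpy Y a i)

variable (A) in
/-- The cone triangles of spines are equivalent to the triangles of 3-complexes. -/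
def spineTriangleEquiv : LaxEquiv (spine A ⋙ (coneTriangulation A).triangle)
    (recalageTriangulation A).triangle :=
  LaxEquiv.ofRetraction
    { app := fun Y => spineConeToPair Y
      naturality := fun _ _ f => spineConeToPair_naturality f }
    { app := fun Y => pairToSpineCone Y
      naturality := fun _ _ f => pairToSpineCone_naturality f }
    (fun Y => pairToSpineCone_spineConeToPair Y) (fun Y => (0, 0, spineConeHtpy Y))
    (fun Y => spineConeToPair_pairToSpineCone_isTwo Y)
    (fun {Y Z} f => by
      refine Prod.ext ((post_zero _).trans (pre_zero _).symm)
        (Prod.ext ((post_zero _).trans (pre_zero _).symm) ?_)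
      exact NCom.PreHtpy.ext (funext fun a => funext fun i => funext fun _ =>
        spineConeHtpy_naturality f a i))

end SpineCone

theorem mainTheorem12 (A : Type u) [Category.{v} A] [Preadditive A] [HasFiniteBiproducts A] :
    (∃ filler : LArr (NCom A 2) ⥤ NCom A 3,
      Nonempty (LaxEquiv (spine A ⋙ filler) (𝟭 (NCom A 3))) ∧
      Nonempty (LaxEquiv (filler ⋙ spine A) (𝟭 (LArr (NCom A 2)))) ∧
      Nonempty (filler ⋙ face A 1 0 ≅ coneF A) ∧
      Nonempty (LaxEquiv (filler ⋙ (recalageTriangulation A).triangle)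
        (coneTriangulation A).triangle) ∧
      Nonempty (LaxEquiv (spine A ⋙ (coneTriangulation A).triangle)
        (recalageTriangulation A).triangle)) ∧
    (∀ D : ComposableArrows (Decat (NCom A 2)) 2,
      (coneTriangulation A).IsTriangle D ↔ (recalageTriangulation A).IsTriangle D) := by
  -- The first arrows of the triangles `T' ∘ fillerF` and `T` are `fillerF ⋙ spine` and `𝟭`.
  refine ⟨⟨fillerF A, ⟨spineFillerEquiv A⟩, ⟨(fillerTriangleEquiv A).firstArrow⟩,
    ⟨fillerConeIso A⟩, ⟨fillerTriangleEquiv A⟩, ⟨spineTriangleEquiv A⟩⟩, fun D => ?_⟩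
  rw [TriangulationData.isTriangle_iff, TriangulationData.isTriangle_iff]
  constructor
  · rintro ⟨x, ⟨e⟩⟩
    exact ⟨(fillerF A).obj x, ⟨e ≪≫ ((fillerTriangleEquiv A).decatIso x).symm⟩⟩
  · rintro ⟨Y, ⟨e⟩⟩
    exact ⟨(spine A).obj Y, ⟨e ≪≫ ((spineTriangleEquiv A).decatIso Y).symm⟩⟩
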